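/- \textbf{Setting.} Let $\mathcal M$ be the set of matrices $A=(a_{ij})_{i,j\ge 1}$ with entries in $\mathbb Z_{\ge 0}$ and finite support, let $\mathbb O$ be the zero matrix, and let $\mathbf 0\notin\mathcal M$ be a formal symbol killed by all operators. For $i\ge 1$ let $\tilde f_i$ act on finite words in the letters $1,2,\dots$ as the $\mathfrak{gl}$-crystal operator on $w_1\cdots w_r=w_1\otimes\cdots\otimes w_r$, where $\tilde f_i$ sends the letter $i$ to $i+1$ and every other letter to $\mathbf 0$, and $\tilde f_i(b_1\otimes b_2)=\tilde f_ib_1\otimes b_2$ if $\varphi_i(b_1)>\varepsilon_i(b_2)$, and $=b_1\otimes\tilde f_ib_2$ otherwise. Let $\mathbf i=\mathbf i(A)$ (with companion word $\mathbf j$) be the first components of the list of all pairs $(i,j)$, each taken $a_{ij}$ times, sorted by increasing $j$ and, for equal $j$, by decreasing $i$; let $\mathbf l=\mathbf l(A)$ (with companion word $\mathbf k$) be the second components of the same list sorted by increasing $i$ and, for equal $i$, by decreasing $j$. For $i\ge1$, $\tilde f_iA$ is obtained by applying $\tilde f_i$ to $\mathbf l$ and keeping $\mathbf k$, $\tilde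 f_{-i}A$ by applying $\tilde f_i$ to $\mathbf i$ and keeping $\mathbf j$, the matrix being recovered by counting pairs of letters; $\tilde f_0A$ is $A$ with $a_{11}$ increased by $1$. Let $\epsilon\in\{1,2\}$, and put $\tilde F_0=\tilde f_0^{\,\epsilon}$ and $\tilde F_i=\tilde f_i\tilde f_{-i}$ for $i\ge1$. Let $\widehat{\mathcal M}^{\epsilon}$ be the set of symmetric $A\in\mathcal M$ all of whose diagonal entries are divisible by $\epsilon$. Let $W$ be the group of permutations of $\mathbb Z^\times=\mathbb Z\setminus\{0\}$ generated by the transpositions $s_i=(i\ \,i{+}1)$, $s_{-i}=(-i{-}1\ \,{-i})$ for $i\ge1$, and $s_0=(-1\ \,1)$. It acts on $P=\bigoplus_{i\in\mathbb Z^\times}\mathbb Z\epsilon_i\oplus\mathbb Z\Lambda_0$, the lattice of functionals on the diagonal matrices $\bigoplus_{i\in\mathbb Z^\times}\mathbb CE_{ii}$ generated by the dual basis vectors $\epsilon_i$ of $E_{ii}$ and by $\Lambda_0$, where $\Lambda_0(E_{-i,-i})=-\Lambda_0(E_{ii})=\tfrac12$ for $i\ge1$; here $w\epsilon_i=\epsilon_{w(i)}$.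 Let $\sigma$ be the linear automorphism of $P$ with $\sigma(\Lambda_0)=\Lambda_0$, $\sigma(\epsilon_i)=-\epsilon_{-i}$, and let $\widehat W=\{w\in W : w\sigma=\sigma w\}$, a Coxeter group with generators $\hat s_0=s_0$, $\hat s_i=s_is_{-i}$ $(i\ge1)$. Let $\widehat W^{\widehat\Lambda_0}$ be the set of minimal length representatives of the left cosets in $\widehat W$ of the stabilizer of $\widehat\Lambda_0=\epsilon\Lambda_0$. For $w\in\widehat W^{\widehat\Lambda_0}$ and reduced expressions $w=s_{j_1}\cdots s_{j_t}$ in $W$ and $w=\hat s_{i_1}\cdots\hat s_{i_r}$ in $\widehat W$, define the Demazure crystals $$\mathcal M_w=\{\tilde f_{j_1}^{m_1}\cdots\tilde f_{j_t}^{m_t}\mathbb O : m_1,\dots,m_t\ge0\}\setminus\{\mathbf 0\},\qquad \widehat{\mathcal M}^{\epsilon}_w=\{\tilde F_{i_1}^{m_1}\cdots\tilde F_{i_r}^{m_r}\mathbb O : m_1,\dots,m_r\ge0\}\setminus\{\mathbf 0\}.$$ The latter is the $\mathfrak b_\infty$-Demazure crystal if $\epsilon=1$ and the $\mathfrak c_\infty$-Demazure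 crystal if $\epsilon=2$. For such $w$ let $\lambda(w)$ be the partition with parts $\lambda(w)_i=|\{j\in\mathbb Z^\times : -i<w^{-1}(j),\ j<w(-i)\}|$ $(i\ge1)$, let $d=d(w)$ be its diagonal length, let $\alpha_k=\lambda(w)'_k-k+1$ for $1\le k\le d$, and put $\phi(w)=(\phi_1,\dots,\phi_d)=(\alpha_d,\dots,\alpha_1)$. For a partition $\nu$ let $\nu^\pi$ be its rotation by $180^\circ$. Let $SST(\nu^\pi)_{\phi(w)}$ be the set of fillings of $\nu^\pi$ by positive integers, with rows weakly increasing from left to right and columns strictly increasing from top to bottom, such that the entries in the $i$-th row from the bottom are at most $\phi_{d-i+1}$; it is defined for $\ell(\nu)\le d$. For a filling $T$ of some $\nu^\pi$ and a positive integer $a$, let $T\leftarrow a$ be defined as follows: if the right-most column has entries $\le a$, replace the largest of them, $a'$, by $a$ and go on by inserting $a'$ in the same way into the next column to the left; otherwise put $a$ on top of the column and stop. For a word $v=v_1\cdots v_r$ let $\mathbf P(v)=(\cdots(v_1\leftarrow v_2)\cdots)\leftarrow v_r$. For $A\in\widehat{\mathcal M}^{\epsilon}$ let $\widehat\kappa(A)=\mathbf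 P(\mathbf l(A)_{\rm rev})$, where ${\rm rev}$ denotes reversal of a word. \textbf{Proposition.} Let $\epsilon\in\{1,2\}$ and $w\in\widehat W^{\widehat\Lambda_0}$. The sets $\mathcal M_w$ and $\widehat{\mathcal M}^{\epsilon}_w$ do not depend on the chosen reduced expressions, and $$\widehat{\mathcal M}^{\epsilon}_w=\widehat{\mathcal M}^{\epsilon}\cap\mathcal M_w,\qquad \widehat\kappa\bigl(\widehat{\mathcal M}^{\epsilon}_w\bigr)=\bigsqcup_{\nu:\ \ell(\nu)\le d(w),\ \epsilon\mid\nu_i\text{ for all }i}SST(\nu^\pi)_{\phi(w)},$$ where the union is over partitions $\nu$ and is disjoint. -/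

import Mathlib

namespace SymDemazure

noncomputable section

/-! ### Matrices of finite support and their word models

The letter `-k^∨` of the dual crystal and the letter `k` are both encoded by the positive integer
`k`. The highest weight letter is the smallest one in both crystals, and the arrow `-i`
(resp. `i`) goes from `-i^∨` to `-(i+1)^∨` (resp. from `i` to `i+1`). -/

/-- Matrices `A = (a_{-i^∨, j})_{i, j ≥ 1}` of non-negative integers with finite support;
`A (i, j)` is the entry `a_{-i^∨, j}`. -/
abbrev Mat : Type := (ℕ+ × ℕ+) →₀ ℕ

/-- The order defining `Ω`: compare second components, ties broken by decreasing first ones. -/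
def OmegaLE (p q : ℕ+ × ℕ+) : Prop := p.2 < q.2 ∨ (p.2 = q.2 ∧ q.1 ≤ p.1)

/-- The order defining `Ω'`: compare first components, ties broken by decreasing second ones. -/
def OmegaLE' (p q : ℕ+ × ℕ+) : Prop := p.1 < q.1 ∨ (p.1 = q.1 ∧ q.2 ≤ p.2)

instance : DecidableRel OmegaLE := fun p q => by unfold OmegaLE; infer_instance

instance : DecidableRel OmegaLE' := fun p q => by unfold OmegaLE'; infer_instance

instance : IsTrans (ℕ+ × ℕ+) OmegaLE := ⟨fun a b c h₁ h₂ => by unfold OmegaLE at *; grind⟩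

instance : IsTrans (ℕ+ × ℕ+) OmegaLE' := ⟨fun a b c h₁ h₂ => by unfold OmegaLE' at *; grind⟩

instance : Std.Antisymm OmegaLE := ⟨fun a b h₁ h₂ => by unfold OmegaLE at *; grind⟩

instance : Std.Antisymm OmegaLE' := ⟨fun a b h₁ h₂ => by unfold OmegaLE' at *; grind⟩

instance : Std.Total OmegaLE := ⟨fun a b => by unfold OmegaLE; grind⟩

instance : Std.Total OmegaLE' := ⟨fun a b => by unfold OmegaLE'; grind⟩

/-- The biword `(i_1, j_1) ≤ ⋯ ≤ (i_r, j_r)` in `Ω` of the matrix `A`. -/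
def biword (A : Mat) : List (ℕ+ × ℕ+) := (Finsupp.toMultiset A).sort OmegaLE

/-- The biword `(k_1, l_1) ≤' ⋯ ≤' (k_r, l_r)` in `Ω'` of the matrix `A`. -/
def biword' (A : Mat) : List (ℕ+ × ℕ+) := (Finsupp.toMultiset A).sort OmegaLE'

/-- The word `𝐢` in `A = A(𝐢, 𝐣)`. -/
def iWord (A : Mat) : List ℕ+ := (biword A).map Prod.fst

/-- The word `𝐣` in `A = A(𝐢, 𝐣)`. -/
def jWord (A : Mat) : List ℕ+ := (biword A).map Prod.snd

/-- The word `𝐤` in `A = A(𝐤, 𝐥)`. -/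
def kWord (A : Mat) : List ℕ+ := (biword' A).map Prod.fst

/-- The word `𝐥` in `A = A(𝐤, 𝐥)`. -/
def lWord (A : Mat) : List ℕ+ := (biword' A).map Prod.snd

/-- The matrix whose `(i, j)` entry counts the positions where the words `u`, `v` have letters
`i`, `j`. -/
def matOfWords (u v : List ℕ+) : Mat := Multiset.toFinsupp (↑(u.zip v) : Multiset (ℕ+ × ℕ+))

/-! ### Kashiwara operators -/

/-- `ε_i` of a letter. -/
def letterEps (i c : ℕ+) : ℤ := if c = i + 1 then 1 else 0

/-- `φ_i` of a letter. -/
def letterPhi (i c : ℕ+) : ℤ := if c = i then 1 else 0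

/-- `ε_i` of a word `c w_2 ⋯ w_r = c ⊗ (w_2 ⊗ ⋯ ⊗ w_r)`, by the tensor product rule
`ε_i(b₁ ⊗ b₂) = max(ε_i(b₁), ε_i(b₂) - ⟨wt b₁, h_i⟩)`. -/
def wordEps (i : ℕ+) : List ℕ+ → ℤ
  | [] => 0
  | c :: w => max (letterEps i c) (wordEps i w - (letterPhi i c - letterEps i c))

/-- The operator `f̃_i` on a letter; `none` stands for the formal symbol `𝟎`. -/
def letterF (i c : ℕ+) : Option ℕ+ := if c = i then some (i + 1) else none

/-- The operator `f̃_i` on words, by the tensor product rule: `f̃_i (b₁ ⊗ b₂)` is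
`f̃_i b₁ ⊗ b₂` if `φ_i(b₁) > ε_i(b₂)` and `b₁ ⊗ f̃_i b₂` otherwise. -/
def wordF (i : ℕ+) : List ℕ+ → Option (List ℕ+)
  | [] => none
  | c :: w =>
    if wordEps i w < letterPhi i c then (letterF i c).map (fun c' => c' :: w)
    else (wordF i w).map (fun w' => c :: w')

/-- The operators `f̃_i` (`i ∈ ℤ`) on matrices: `f̃_0` adds `1` at the position `(1, 1)`,
`f̃_i` for `i > 0` acts on the word `𝐥` of `A(𝐤, 𝐥)`, and `f̃_{-i}` for `i > 0` acts on the word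
`𝐢` of `A(𝐢, 𝐣)`. -/
def crystalF : ℤ → Mat → Option Mat
  | Int.ofNat 0, A => some (A + Finsupp.single (1, 1) 1)
  | Int.ofNat (n + 1), A => (wordF n.succPNat (lWord A)).map (fun l => matOfWords (kWord A) l)
  | Int.negSucc n, A => (wordF n.succPNat (iWord A)).map (fun i => matOfWords i (jWord A))

/-- The `m`-th power of an operator `g : B → B ∪ {𝟎}`, with `g 𝟎 = 𝟎`. -/
def opPow {B : Type} (g : B → Option B) (m : ℕ) (b : B) : Option B :=
  (fun x : Option B => x.bind g)^[m] (some b)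

/-- The folded operators `F̃_0 = f̃_0^ε` and `F̃_i = f̃_i f̃_{-i}` for `i > 0`. -/
def foldedF (ε : ℕ) : ℕ → Mat → Option Mat
  | 0, A => opPow (crystalF 0) ε A
  | n + 1, A => (crystalF (-((n : ℤ) + 1)) A).bind (crystalF ((n : ℤ) + 1))

/-- For a word `i_1 ⋯ i_r` in the indices, the set
`{f_{i_1}^{m_1} ⋯ f_{i_r}^{m_r} b | m_1, …, m_r ≥ 0} \ {𝟎}`. -/
def demazureSet {I B : Type} (f : I → B → Option B) (b : B) : List I → Set B
  | [] => {b}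
  | i :: l => {b' | ∃ c ∈ demazureSet f b l, ∃ m : ℕ, opPow (f i) m c = some b'}

/-- Symmetric matrices with all diagonal entries divisible by `ε`. -/
def symMat (ε : ℕ) : Set Mat :=
  {A | (∀ i j, A (i, j) = A (j, i)) ∧ ∀ i, ε ∣ A (i, i)}

/-! ### The Weyl group -/

/-- The set `ℤ^×` of non-zero integers. -/
abbrev Zx : Type := {k : ℤ // k ≠ 0}

/-- `-i ∈ ℤ^×` for `i ≥ 1`. -/
def negZx (i : ℕ+) : Zx := ⟨-(i : ℤ), by have := i.pos; omega⟩

/-- Negation on `ℤ^×`. -/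
def oppZx (i : Zx) : Zx := ⟨-i.1, neg_ne_zero.mpr i.2⟩

/-- The smaller of the two indices with `h_i = E_{lo i, lo i} - E_{hi i, hi i}`. -/
def lo (i : ℤ) : Zx := ⟨if 0 < i then i else i - 1, by split_ifs <;> omega⟩

/-- The larger of the two indices with `h_i = E_{lo i, lo i} - E_{hi i, hi i}`. -/
def hi (i : ℤ) : Zx := ⟨if 0 ≤ i then i + 1 else i, by split_ifs <;> omega⟩

/-- The dual of the Cartan subalgebra `⨁_{i ∈ ℤ^×} ℂ E_{ii}`: a functional is given by its values
on the basis `E_{ii}`. -/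
abbrev HDual : Type := Zx → ℂ

/-- `ε_i`, the functional dual to `E_{ii}`. -/
def epsWt (i : Zx) : HDual := Pi.single i 1

/-- The simple root `α_i`. -/
def simpleRoot (i : ℤ) : HDual := epsWt (lo i) - epsWt (hi i)

/-- The pairing `⟨λ, h_i⟩` with the simple coroot `h_i`. -/
def pairing (μ : HDual) (i : ℤ) : ℂ := μ (lo i) - μ (hi i)

/-- The fundamental weight `Λ_0`. -/
def Lambda0 : HDual := fun i => if i.1 < 0 then 1 / 2 else -(1 / 2)

/-- The weight lattice `P = ⨁ ℤ ε_i ⊕ ℤ Λ_0`. -/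
def weightLattice : AddSubgroup HDual := AddSubgroup.closure (Set.range epsWt ∪ {Lambda0})

/-- The action of permutations of `ℤ^×` on weights, with `w ε_i = ε_{w(i)}`. -/
def act (w : Equiv.Perm Zx) (μ : HDual) : HDual := fun i => μ (w⁻¹ i)

/-- The simple reflection `s_i`, as a transposition of `ℤ^×`. -/
def simpleReflection (i : ℤ) : Equiv.Perm Zx := Equiv.swap (lo i) (hi i)

/-- `s_i` acts on weights as the reflection `λ ↦ λ - ⟨λ, h_i⟩ α_i`. -/
theorem act_simpleReflection (i : ℤ) (μ : HDual) :
    act (simpleReflection i) μ = μ - pairing μ i • simpleRoot i := by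
  have hne : lo i ≠ hi i := by
    intro h
    have h2 := congrArg Subtype.val h
    simp only [lo, hi] at h2
    split_ifs at h2 <;> omega
  funext k
  simp only [act, simpleReflection, Equiv.swap_inv, Pi.sub_apply, Pi.smul_apply, simpleRoot,
    epsWt, pairing, smul_eq_mul]
  by_cases h1 : k = lo i
  · subst h1
    simp [hne]
  · by_cases h2 : k = hi i
    · subst h2
      simp [hne.symm]
    · rw [Equiv.swap_apply_of_ne_of_ne h1 h2]
      simp [h1, h2]

/-- The Weyl group `W`, generated by the simple reflections. -/
def weylGroup : Subgroup (Equiv.Perm Zx) := Subgroup.closure (Set.range simpleReflection)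

/-- `σ`, the linear map with `σ(Λ_0) = Λ_0` and `σ(ε_i) = -ε_{-i}`. -/
def sigma (μ : HDual) : HDual := fun i => -μ (oppZx i)

/-- The group `Ŵ` of all `w ∈ W` that commute with `σ` on `P`. -/
def hatW : Set (Equiv.Perm Zx) :=
  {w | w ∈ weylGroup ∧ ∀ μ ∈ weightLattice, act w (sigma μ) = sigma (act w μ)}

/-- The simple reflections of `Ŵ`: `ŝ_0 = s_0` and `ŝ_i = s_i s_{-i}` for `i > 0`. -/
def hatReflection : ℕ → Equiv.Perm Zx
  | 0 => simpleReflection 0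
  | n + 1 => simpleReflection ((n : ℤ) + 1) * simpleReflection (-((n : ℤ) + 1))

/-- The word `l = i_1 ⋯ i_r` is a reduced expression `g = s_{i_1} ⋯ s_{i_r}` with respect to the
generators `s`. -/
def IsReducedExpr {I G : Type} [Group G] (s : I → G) (l : List I) (g : G) : Prop :=
  (l.map s).prod = g ∧ ∀ l' : List I, (l'.map s).prod = g → l.length ≤ l'.length

/-- The length with respect to the generators `s`, for elements that are products of them. -/
def len {I G : Type} [Group G] (s : I → G) (g : G) : ℕ :=
  sInf {n | ∃ l : List I, (l.map s).prod = g ∧ l.length = n}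

/-- The minimal length representatives of the left cosets in `Ŵ` of the stabilizer
of `Λ̂_0 = ε Λ_0`. -/
def hatWCosetReps (ε : ℕ) : Set (Equiv.Perm Zx) :=
  {w | w ∈ hatW ∧ ∀ u ∈ hatW, act u (ε • Lambda0) = ε • Lambda0 →
    len hatReflection w ≤ len hatReflection (w * u)}

/-- The diagram `D(w)` of a permutation. -/
def diagram (w : Equiv.Perm Zx) : Set (Zx × Zx) := {p | p.1 < w⁻¹ p.2 ∧ p.2 < w p.1}

/-- The parts `λ(w)_i` (`i ≥ 1`) of the shape of `w`. -/
def shape (w : Equiv.Perm Zx) (i : ℕ+) : ℕ := {j : Zx | (negZx i, j) ∈ diagram w}.ncard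

/-- The parts of the conjugate `λ(w)'`. -/
def shapeConj (w : Equiv.Perm Zx) (k : ℕ+) : ℕ := {i : ℕ+ | (k : ℕ) ≤ shape w i}.ncard

/-- The diagonal length `d(w)` of `λ(w)`. -/
def diagLen (w : Equiv.Perm Zx) : ℕ := {k : ℕ+ | (k : ℕ) ≤ shape w k}.ncard

/-- The number `α_k` (`1 ≤ k ≤ d(w)`) in the Frobenius notation
`λ(w) = (α_1, …, α_d | β_1, …, β_d)`: the number of boxes of the `k`-th column of `λ(w)` on or
below the diagonal. -/
def frobAlpha (w : Equiv.Perm Zx) (k : ℕ+) : ℕ := shapeConj w k + 1 - k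

/-- The flag `φ(w) = (α_d, …, α_1)`. -/
def flag (w : Equiv.Perm Zx) : List ℕ :=
  ((List.range (diagLen w)).map (fun k => frobAlpha w k.succPNat)).reverse

/-! ### Demazure crystals -/

/-- The Demazure crystal `ℳ_w`, taken over the reduced expressions of `w`
(it does not depend on the reduced expression). -/
def demazure (w : Equiv.Perm Zx) : Set Mat :=
  {A | ∃ l : List ℤ, IsReducedExpr simpleReflection l w ∧ A ∈ demazureSet crystalF 0 l}

/-- The Demazure crystal of symmetric matrices, taken over the reduced expressions of `w` in the
generators `ŝ_i` (it does not depend on the reduced expression). -/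
def hatDemazure (ε : ℕ) (w : Equiv.Perm Zx) : Set Mat :=
  {A | ∃ l : List ℕ, IsReducedExpr hatReflection l w ∧ A ∈ demazureSet (foldedF ε) 0 l}

/-! ### Tableaux of anti-normal shape and the RSK correspondence -/

/-- A filling of an anti-normal shape: the list of its columns from right to left, each column
being read from top to bottom. The columns are aligned at the bottom. -/
abbrev Filling : Type := List (List ℕ+)

/-- The entry in the row `r` counted from the bottom and the column `k` counted from the right
(both starting from `0`). -/
def Filling.entry (T : Filling) (r k : ℕ) : Option ℕ+ :=
  (T[k]?).bind (fun c => c.reverse[r]?)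

/-- The set `SST(ν^π)` of semistandard tableaux of shape `ν^π`, the rotation of `ν` by 180°.
Columns are strictly increasing from top to bottom, rows weakly increasing from left to right. -/
def SST (ν : YoungDiagram) : Set Filling :=
  {T | T.map List.length = (List.range (ν.rowLen 0)).map ν.colLen ∧
    (∀ c ∈ T, c.Pairwise (· < ·)) ∧
    ∀ r k a b, Filling.entry T r k = some a → Filling.entry T r (k + 1) = some b → b ≤ a}

/-- The set `SST(ν^π)_φ` for a flag `φ = (φ_1, …, φ_d)`: here `ℓ(ν) ≤ d`, and the entries of the
`i`-th row from the bottom are at most `φ_{d-i+1}`. -/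
def flaggedSST (ν : YoungDiagram) (φ : List ℕ) : Set Filling :=
  {T | T ∈ SST ν ∧ ν.colLen 0 ≤ φ.length ∧
    ∀ r k a, Filling.entry T r k = some a → (a : ℕ) ≤ φ.getD (φ.length - (r + 1)) 0}

/-- The insertion `T ← a`: in the right-most column let `a'` be the largest entry that is at most
`a`; if it exists, replace it by `a` and insert `a'` into the next column; otherwise put `a` on
top of the column. -/
def insertFilling : Filling → ℕ+ → Filling
  | [], a => [[a]]
  | c :: T, a =>
    match (c.filter (fun x => x ≤ a)).max? with
    | none => (a :: c) :: T
    | some a' => c.map (fun x => if x = a' then a else x) :: insertFilling T a'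

/-- The tableau `𝐏(w) = ((w_1 ← w_2) ← ⋯) ← w_r` of a word. -/
def insertWord (w : List ℕ+) : Filling := w.foldl insertFilling []

/-- The RSK map `κ(A) = (𝐏(A), 𝐐(A)) = (𝐏(𝐢_rev), 𝐏(𝐥_rev))`. -/
def kappa (A : Mat) : Filling × Filling :=
  (insertWord (iWord A).reverse, insertWord (lWord A).reverse)

/-- The map `κ̂ : A ↦ S` for symmetric `A`, where `κ(A) = (-S^∨, S)`. -/
def kappaHat (A : Mat) : Filling := (kappa A).2

end

end SymDemazure

/-! Both Demazure crystals are computed in closed form. For finite sets `a`, `b` of positive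
integers, `ladder a b` is the set of matrices in whose support every chain (for the strict product
order) inside the columns `> k` has at most `numGT a k` elements, and every chain inside the rows `>
k` at most `numGT b k`. If `w` is increasing on the positive and on the negative integers, then `ℳ_w
= ladder a b`, where `a` consists of the positive values taken at negative arguments and `b` of the
absolute values of the negative values taken at positive arguments (`demazureSet_eq_ladder`). If
moreover `w` commutes with negation, then `a = b` and the folded Demazure crystal is `symMat ε ∩
ladder a a` (`demazureSet_foldedF_eq`). As `a` and `b` depend on `w` only, independence of the
reduced expression and the first equality follow.

The closed form is proved along a reduced word. Left multiplication by `s_i` replaces `i` by `i + 1`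
in `a` (or in `b`, for negative index), and `s_0` adds `1` to both. In the matrix, `f̃_i` moves one
unit from column `i` to column `i + 1`, in the last row where the signature `colHeight` is maximal.
Such a move does not affect chain lengths for column thresholds other than `i`
(`hasChain_moveRight_iff`), and the bound at `i` is redundant once `i + 1` lies in the set.
Conversely, a matrix with nonpositive signature satisfies the sharper bound
(`mem_ladder_of_colHeight_le`). In the folded case the operators `f̃_i` and `f̃_{-j}` commute
(`crystalF_commute`), so symmetry is preserved, and a parity argument controls the diagonal.

For the tableaux, the right-most column of the insertion tableau records the chain lengths
(`hasChain_iff`), and the numbers `α_k` are the elements of `a` (`frobAlpha_eq`); thus the ladder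
condition on a symmetric matrix is the flag condition on its tableau. It remains to see that
symmetric matrices with diagonal divisible by `ε` give exactly the tableaux with row lengths
divisible by `ε`. Knuth equivalence is compatible with `f̃_i` and characterises equality of
insertion tableaux, and `f̃_{-j}` does not change the tableau at all. Raising with the folded
operators therefore reduces the question to diagonal matrices, where the row lengths are the
diagonal entries. -/

namespace SymDemazure

/-! ### The signature rule on words. -/

/-- The excess of letters `i + 1` over letters `i` in a word. -/
def height (i : ℕ+) (w : List ℕ+) : ℤ := (w.count (i + 1) : ℤ) - w.count i

lemma pnat_succ_ne (i : ℕ+) : i + 1 ≠ i := by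
  intro h
  have := congrArg PNat.val h
  simp at this

lemma height_cons (i c : ℕ+) (w : List ℕ+) :
    height i (c :: w) = height i w + (if c = i + 1 then 1 else 0) - (if c = i then 1 else 0) := by
  simp only [height, List.count_cons, beq_iff_eq]
  split_ifs <;> push_cast <;> ring

@[simp] lemma height_nil (i : ℕ+) : height i [] = 0 := by simp [height]

lemma height_append (i : ℕ+) (u v : List ℕ+) : height i (u ++ v) = height i u + height i v := by
  simp only [height, List.count_append]
  push_cast
  ring

lemma height_singleton_cases (i c : ℕ+) :
    (c = i + 1 ∧ c ≠ i ∧ height i [c] = 1) ∨ (c = i ∧ c ≠ i + 1 ∧ height i [c] = -1) ∨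
      (c ≠ i ∧ c ≠ i + 1 ∧ height i [c] = 0) := by
  have := pnat_succ_ne i
  rw [height_cons, height_nil]
  by_cases h1 : c = i + 1
  · subst h1; simp [this]
  · by_cases h2 : c = i
    · subst h2; simp [this.symm]
    · simp [h1, h2]

lemma wordEps_nonneg (i : ℕ+) (w : List ℕ+) : 0 ≤ wordEps i w := by
  cases w with
  | nil => simp [wordEps]
  | cons c w =>
    simp only [wordEps, letterEps]
    split_ifs <;> simp

/-- A letter `i + 1` counts `+1` and a letter `i` counts `-1`: the tensor product rule becomes the
recursion for the maximal height of a prefix, the empty prefix giving the `0`. -/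
lemma wordEps_cons (i c : ℕ+) (w : List ℕ+) :
    wordEps i (c :: w) = max 0 (wordEps i w + height i [c]) := by
  have h := wordEps_nonneg i w
  simp only [wordEps, letterEps, letterPhi]
  rcases height_singleton_cases i c with ⟨h1, h2, h3⟩ | ⟨h1, h2, h3⟩ | ⟨h1, h2, h3⟩ <;>
    rw [h3] <;> simp only [h2, if_false] <;> (try rw [if_pos h1]) <;> (try rw [if_neg h1]) <;>
    omega

lemma wordF_cons (i c : ℕ+) (w : List ℕ+) :
    wordF i (c :: w) = if c = i ∧ wordEps i w = 0 then some ((i + 1) :: w)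
      else (wordF i w).map (c :: ·) := by
  have h := wordEps_nonneg i w
  simp only [wordF, letterPhi, letterF]
  by_cases hc : c = i
  · by_cases h0 : wordEps i w = 0
    · simp [hc, h0]
    · have : ¬ wordEps i w < 1 := by omega
      simp [hc, h0, this]
  · have : ¬ wordEps i w < 0 := by omega
    simp [hc, this]

lemma wordEps_append (i : ℕ+) (u v : List ℕ+) :
    wordEps i (u ++ v) = max (wordEps i u) (wordEps i v + height i u) := by
  induction u with
  | nil => simp [wordEps, wordEps_nonneg]
  | cons c u ih =>
    have := height_append i [c] u
    have := height_append i [c] (u ++ v)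
    simp only [List.cons_append, List.nil_append] at *
    simp only [wordEps_cons, ih]
    omega

lemma height_le_wordEps (i : ℕ+) (w : List ℕ+) : height i w ≤ wordEps i w := by
  induction w with
  | nil => simp [wordEps]
  | cons c w ih =>
    have := height_append i [c] w
    simp only [List.cons_append, List.nil_append] at *
    rw [wordEps_cons]
    omega

/-- With `exists_prefix_height` this identifies `wordEps` as the maximum of the heights of all
prefixes. -/
lemma height_le_wordEps_of_prefix {i : ℕ+} {u w : List ℕ+} (h : u <+: w) :
    height i u ≤ wordEps i w := by
  obtain ⟨v, rfl⟩ := h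
  rw [wordEps_append]
  exact (height_le_wordEps i u).trans (le_max_left _ _)

lemma exists_prefix_height (i : ℕ+) (w : List ℕ+) :
    ∃ u, u <+: w ∧ height i u = wordEps i w := by
  induction w with
  | nil => exact ⟨[], List.prefix_rfl, by simp [wordEps]⟩
  | cons c w ih =>
    obtain ⟨u, hu, h⟩ := ih
    rw [wordEps_cons]
    by_cases h0 : 0 ≤ wordEps i w + height i [c]
    · refine ⟨c :: u, by simpa using hu, ?_⟩
      have := height_append i [c] u
      simp only [List.cons_append, List.nil_append] at this
      omega
    · exact ⟨[], List.nil_prefix, by rw [height_nil]; omega⟩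

/-- The difference `wordEps i w - height i w` is `φ_i(w)`. -/
lemma wordF_eq_none_iff (i : ℕ+) (w : List ℕ+) : wordF i w = none ↔ wordEps i w = height i w := by
  induction w with
  | nil => simp [wordF, wordEps]
  | cons c w ih =>
    have h1 := height_append i [c] w
    simp only [List.cons_append, List.nil_append] at h1
    have h2 := height_le_wordEps i w
    have h3 := wordEps_nonneg i w
    rw [wordF_cons, wordEps_cons, h1]
    by_cases hc : c = i ∧ wordEps i w = 0
    · have : height i [c] = -1 := by simp [height_cons, hc.1, (pnat_succ_ne i).symm]
      rw [if_pos hc, hc.2]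
      simp only [reduceCtorEq, false_iff]
      omega
    · rw [if_neg hc, Option.map_eq_none_iff, ih]
      have : ¬ wordEps i w + height i [c] < 0 := fun h => by
        rcases height_singleton_cases i c with ⟨e1, -, e3⟩ | ⟨e1, -, e3⟩ | ⟨e1, -, e3⟩
        · omega
        · exact hc ⟨e1, by omega⟩
        · omega
      omega

/-- The tensor product rule for two words, `wordEps i u - height i u` being `φ_i(u)`. -/
lemma wordF_append (i : ℕ+) (u v : List ℕ+) :
    wordF i (u ++ v) = if wordEps i v < wordEps i u - height i u then (wordF i u).map (· ++ v)
      else (wordF i v).map (u ++ ·) := by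
  induction u with
  | nil =>
    have := wordEps_nonneg i v
    have h : ¬ wordEps i v < 0 := by omega
    simp [wordEps, h]
  | cons c u ih =>
    have h1 := height_append i [c] u
    simp only [List.cons_append, List.nil_append] at *
    have h2 := height_le_wordEps i u
    have h3 := wordEps_nonneg i u
    have h4 := wordEps_nonneg i v
    rw [wordF_cons, ih, wordF_cons, wordEps_append, wordEps_cons, h1]
    by_cases hc : c = i
    · have hh : height i [c] = -1 := by simp [height_cons, hc, (pnat_succ_ne i).symm]
      subst hc
      rw [hh]
      by_cases h0 : wordEps c u = 0
      · by_cases h5 : wordEps c v + height c u ≤ 0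
        · have : max (wordEps c u) (wordEps c v + height c u) = 0 := by omega
          have h6 : wordEps c v < max 0 (wordEps c u + -1) - (-1 + height c u) := by omega
          rw [if_pos ⟨rfl, this⟩, if_pos h6, if_pos ⟨rfl, h0⟩]
          rfl
        · have : max (wordEps c u) (wordEps c v + height c u) ≠ 0 := by omega
          have h6 : ¬ wordEps c v < max 0 (wordEps c u + -1) - (-1 + height c u) := by omega
          have h7 : ¬ wordEps c v < wordEps c u - height c u := by omega
          simp only [this, h6, h7, and_false, if_false]
          simp [Function.comp_def]
      · have : max (wordEps c u) (wordEps c v + height c u) ≠ 0 := by omega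
        simp only [this, and_false, if_false, h0]
        have h6 : wordEps c v < max 0 (wordEps c u + -1) - (-1 + height c u) ↔
          wordEps c v < wordEps c u - height c u := by omega
        simp only [h6]
        split_ifs <;> simp [Function.comp_def]
    · have h6 : wordEps i v < max 0 (wordEps i u + height i [c]) - (height i [c] + height i u) ↔
          wordEps i v < wordEps i u - height i u := by
        have : 0 ≤ height i [c] := by
          rcases height_singleton_cases i c with ⟨e1, -, e3⟩ | ⟨e1, -, e3⟩ | ⟨e1, -, e3⟩
          · omega
          · exact absurd e1 hc
          · omega
        omega
      simp only [h6, hc, false_and, if_false]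
      split_ifs <;> simp [Function.comp_def]

/-- The last two conditions say that `u` is the longest prefix of maximal height: the letter `i`
after it lowers the height by one, and no prefix of `v` makes up for this. -/
lemma wordF_eq_some {i : ℕ+} {w w' : List ℕ+} (h : wordF i w = some w') :
    ∃ u v, w = u ++ i :: v ∧ w' = u ++ (i + 1) :: v ∧ height i u = wordEps i w ∧
      wordEps i v = 0 := by
  induction w generalizing w' with
  | nil => simp [wordF] at h
  | cons c w ih =>
    rw [wordF_cons] at h
    split_ifs at h with hc
    · obtain ⟨rfl, h0⟩ := hc
      refine ⟨[], w, rfl, by simpa using h.symm, ?_, h0⟩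
      rw [wordEps_cons, h0]
      simp [height_cons, (pnat_succ_ne c).symm]
    · obtain ⟨w1, h1, rfl⟩ := Option.map_eq_some_iff.1 h
      obtain ⟨u, v, rfl, rfl, h2, h3⟩ := ih h1
      refine ⟨c :: u, v, rfl, rfl, ?_, h3⟩
      rw [wordEps_cons, ← h2]
      have h4 := height_append i [c] u
      simp only [List.cons_append, List.nil_append] at h4
      rw [h4]
      have h5 := wordEps_nonneg i (u ++ i :: v)
      have h6 := wordEps_append i u (i :: v)
      have h7 := height_le_wordEps i u
      have h8 := wordEps_nonneg i u
      have : ¬ wordEps i (u ++ i :: v) + height i [c] < 0 := fun h => by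
        rcases height_singleton_cases i c with ⟨e1, -, e3⟩ | ⟨e1, -, e3⟩ | ⟨e1, -, e3⟩
        · omega
        · exact hc ⟨e1, by omega⟩
        · omega
      omega

lemma wordEps_wordF {i : ℕ+} {w w' : List ℕ+} (h : wordF i w = some w') :
    wordEps i w' = wordEps i w + 1 := by
  obtain ⟨u, v, rfl, rfl, h1, h2⟩ := wordF_eq_some h
  have h3 := height_le_wordEps i u
  have h4 := wordEps_nonneg i u
  have h5 : height i [i] = -1 := by simp [height_cons, (pnat_succ_ne i).symm]
  have h6 : height i [i + 1] = 1 := by simp [height_cons, pnat_succ_ne i]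
  have h7 := wordEps_append i u (i :: v)
  have h8 := wordEps_append i u ((i + 1) :: v)
  rw [wordEps_cons, h2] at h7 h8
  omega

/-- The raising operator acts in the tail if the tail has positive `ε_i`; otherwise only a leading
letter `i + 1` can make `ε_i` positive. -/
lemma exists_wordF_eq {i : ℕ+} {w : List ℕ+} (h : 0 < wordEps i w) : ∃ u, wordF i u = some w := by
  induction w with
  | nil => simp [wordEps] at h
  | cons c w ih =>
    rw [wordEps_cons] at h
    by_cases h0 : wordEps i w = 0
    · have hc : c = i + 1 := by
        rcases height_singleton_cases i c with ⟨e1, -, e3⟩ | ⟨e1, -, e3⟩ | ⟨e1, -, e3⟩ <;>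
          first | exact e1 | omega
      exact ⟨i :: w, by simp [wordF_cons, h0, hc]⟩
    · have h1 := wordEps_nonneg i w
      obtain ⟨u, hu⟩ := ih (by omega)
      refine ⟨c :: u, ?_⟩
      have h2 := wordEps_wordF hu
      rw [wordF_cons, if_neg, hu]
      · rfl
      · rintro ⟨rfl, h3⟩
        simp [h2, h3, height_cons, (pnat_succ_ne c).symm] at h

/-! ### Signatures of matrices -/

/-- The excess of letters `i + 1` over letters `i` in the part of the word `𝐥` of `A` that ends with
the letters `i + 1` in the row `k`. -/
def colHeight (A : Mat) (i k : ℕ+) : ℤ :=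
  ∑ x ∈ Finset.Iic k, (A (x, i + 1) : ℤ) - ∑ x ∈ Finset.Iio k, (A (x, i) : ℤ)

/-- The matrix obtained by moving one unit in the row `p` from the column `i` to the next one. -/
noncomputable def moveRight (A : Mat) (p i : ℕ+) : Mat :=
  A - Finsupp.single (p, i) 1 + Finsupp.single (p, i + 1) 1

/-- The row `p` is the last one at which `colHeight A i` attains its maximum. -/
def IsLastMax (A : Mat) (i p : ℕ+) : Prop :=
  (∀ k, colHeight A i k ≤ colHeight A i p) ∧ ∀ k, p < k → colHeight A i k < colHeight A i p

/-- The transpose of a matrix. -/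
noncomputable def transpose (A : Mat) : Mat := Finsupp.equivMapDomain (Equiv.prodComm _ _) A

@[simp] lemma transpose_apply (A : Mat) (i j : ℕ+) : transpose A (i, j) = A (j, i) := by
  simp [transpose]

@[simp] lemma transpose_transpose (A : Mat) : transpose (transpose A) = A := by
  ext ⟨i, j⟩
  simp

lemma toMultiset_injective :
    Function.Injective (Finsupp.toMultiset : Mat → Multiset (ℕ+ × ℕ+)) := fun A B h => by
  rw [← Finsupp.toMultiset_toFinsupp A, h, Finsupp.toMultiset_toFinsupp]

lemma biword'_pairwise (A : Mat) : (biword' A).Pairwise OmegaLE' := Multiset.pairwise_sort _ _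

lemma coe_biword' (A : Mat) : ((biword' A : List (ℕ+ × ℕ+)) : Multiset (ℕ+ × ℕ+)) =
    Finsupp.toMultiset A := Multiset.sort_eq _ _

lemma eq_of_pairwise_of_coe_eq {r : ℕ+ × ℕ+ → ℕ+ × ℕ+ → Prop} [Std.Antisymm r]
    {l₁ l₂ : List (ℕ+ × ℕ+)} (h₁ : l₁.Pairwise r) (h₂ : l₂.Pairwise r)
    (h : (l₁ : Multiset (ℕ+ × ℕ+)) = l₂) : l₁ = l₂ :=
  List.Perm.eq_of_pairwise (fun _ _ _ _ h h' => antisymm_of r h h') h₁ h₂ (Multiset.coe_eq_coe.1 h)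

lemma biword'_eq {A : Mat} {l : List (ℕ+ × ℕ+)} (h : l.Pairwise OmegaLE')
    (hA : (l : Multiset (ℕ+ × ℕ+)) = Finsupp.toMultiset A) : biword' A = l :=
  eq_of_pairwise_of_coe_eq (biword'_pairwise A) h (by rw [coe_biword', hA])

lemma toMultiset_transpose (A : Mat) :
    Finsupp.toMultiset (transpose A) = (Finsupp.toMultiset A).map Prod.swap := by
  rw [Finsupp.toMultiset_map]
  congr 1
  exact Finsupp.equivMapDomain_eq_mapDomain _ _

/-- Swapping the coordinates exchanges the two orders. This is what reduces every statement on
`f̃_{-i}` to one on `f̃_i` and the transposed matrix. -/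
lemma biword_eq (A : Mat) : biword A = (biword' (transpose A)).map Prod.swap := by
  refine eq_of_pairwise_of_coe_eq (r := OmegaLE) (Multiset.pairwise_sort _ _) ?_ ?_
  · rw [List.pairwise_map]
    exact (biword'_pairwise _).imp fun {a b} h => h.imp id fun h => ⟨h.1, h.2⟩
  · rw [← Multiset.map_coe, coe_biword', toMultiset_transpose, Multiset.map_map, biword,
      Multiset.sort_eq]
    simp

lemma iWord_eq (A : Mat) : iWord A = lWord (transpose A) := by
  simp [iWord, lWord, biword_eq, Function.comp_def]

lemma jWord_eq (A : Mat) : jWord A = kWord (transpose A) := by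
  simp [jWord, kWord, biword_eq, Function.comp_def]

lemma matOfWords_swap (u v : List ℕ+) : matOfWords u v = transpose (matOfWords v u) := by
  apply toMultiset_injective
  rw [toMultiset_transpose, matOfWords, matOfWords, Multiset.toFinsupp_toMultiset,
    Multiset.toFinsupp_toMultiset, Multiset.map_coe, List.zip_swap]

lemma crystalF_coe (i : ℕ+) (A : Mat) :
    crystalF (i : ℤ) A = (wordF i (lWord A)).map (matOfWords (kWord A)) := by
  obtain ⟨n, rfl⟩ : ∃ n : ℕ, i = n.succPNat := ⟨i.natPred, by simp⟩
  rfl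

lemma crystalF_neg (i : ℕ+) (A : Mat) :
    crystalF (-(i : ℤ)) A = (crystalF (i : ℤ) (transpose A)).map transpose := by
  rw [crystalF_coe]
  obtain ⟨n, rfl⟩ : ∃ n : ℕ, i = n.succPNat := ⟨i.natPred, by simp⟩
  have : crystalF (-((n.succPNat : ℕ+) : ℤ)) A =
    (wordF n.succPNat (iWord A)).map (fun i => matOfWords i (jWord A)) := rfl
  rw [this, iWord_eq, jWord_eq, Option.map_map]
  congr 1
  funext i
  exact matOfWords_swap _ _

lemma countP_toMultiset (A : Mat) (S : Finset ℕ+) (c : ℕ+) :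
    Multiset.countP (fun x : ℕ+ × ℕ+ => x.1 ∈ S ∧ x.2 = c) (Finsupp.toMultiset A) =
      ∑ y ∈ S, A (y, c) := by
  induction A using Finsupp.induction_linear with
  | zero => simp
  | add f g hf hg => simp [hf, hg, Finset.sum_add_distrib, Multiset.countP_add]
  | single a n =>
    obtain ⟨a, b⟩ := a
    rw [Finsupp.toMultiset_single, Multiset.countP_nsmul, ← Multiset.cons_zero,
      Multiset.countP_cons]
    by_cases hb : b = c
    · subst hb
      by_cases ha : a ∈ S
      · simp [ha, Finsupp.single_apply]
      · have : ∀ y ∈ S, a ≠ y := fun y hy h => ha (h ▸ hy)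
        simp only [ha, false_and, if_false, Finsupp.single_apply, Prod.mk.injEq]
        rw [Finset.sum_eq_zero]
        · simp
        · intro y hy
          simp [this y hy]
    · simp [hb]

lemma count_map_filter (A : Mat) (P : ℕ+ × ℕ+ → Prop) [DecidablePred P] (S : Finset ℕ+) (c : ℕ+)
    (h : ∀ k, P (k, c) ↔ k ∈ S) :
    (((biword' A).filter P).map Prod.snd).count c = ∑ y ∈ S, A (y, c) := by
  rw [← countP_toMultiset, ← coe_biword', Multiset.coe_countP, List.count, List.countP_map,
    List.countP_filter]
  congr 1
  funext x
  obtain ⟨k, d⟩ := x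
  by_cases hd : d = c
  · subst hd; simp [h]
  · simp [hd]

lemma pnat_lt_succ (i : ℕ+) : i < i + 1 := by
  rw [← PNat.coe_lt_coe]; simp

/-- The pairs up to `(k, i + 1)` fill the rows before `k`, but in row `k` only the columns from `i +
1` on. So the letters `i` of row `k` are not yet counted, whence `Iio` next to `Iic` in `colHeight`.
-/
lemma height_filter (A : Mat) (i k : ℕ+) :
    height i (((biword' A).filter (OmegaLE' · (k, i + 1))).map Prod.snd) = colHeight A i k := by
  rw [height, colHeight, count_map_filter A _ (Finset.Iic k), count_map_filter A _ (Finset.Iio k)]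
  · push_cast; rfl
  · intro y
    simp [OmegaLE']
  · intro y
    simp [OmegaLE', le_iff_lt_or_eq]

lemma filter_prefix_of_pairwise {α : Type*} {r : α → α → Prop} [IsTrans α r] [DecidableRel r]
    {l : List α} (h : l.Pairwise r) (x : α) : l.filter (r · x) <+: l := by
  induction l with
  | nil => simp
  | cons a l ih =>
    rw [List.pairwise_cons] at h
    by_cases ha : r a x
    · rw [List.filter_cons_of_pos (by simpa using ha)]
      simpa using ih h.2
    · have : (a :: l).filter (r · x) = [] := by
        rw [List.filter_eq_nil_iff]
        intro b hb
        rcases List.mem_cons.1 hb with rfl | hb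
        · simpa using ha
        · simpa using fun hbx => ha (_root_.trans (h.1 b hb) hbx)
      rw [this]
      exact List.nil_prefix

lemma colHeight_le_wordEps (A : Mat) (i k : ℕ+) : colHeight A i k ≤ wordEps i (lWord A) := by
  rw [← height_filter]
  exact height_le_wordEps_of_prefix ((filter_prefix_of_pairwise (biword'_pairwise A) _).map _)

lemma exists_row_bound (A : Mat) : ∃ K : ℕ+, ∀ x, A x ≠ 0 → x.1 < K ∧ x.2 < K := by
  refine ⟨(∑ x ∈ A.support, (x.1 + x.2 : ℕ)).succPNat, fun x hx => ?_⟩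
  have := Finset.single_le_sum (f := fun x : ℕ+ × ℕ+ => (x.1 + x.2 : ℕ)) (fun _ _ => Nat.zero_le _)
    (Finsupp.mem_support_iff.2 hx)
  rw [← PNat.coe_lt_coe, ← PNat.coe_lt_coe, Nat.succPNat_coe]
  have := (Nat.lt_succ_of_le this)
  constructor <;> omega

lemma mem_biword' {A : Mat} {x : ℕ+ × ℕ+} : x ∈ biword' A ↔ A x ≠ 0 := by
  rw [← Multiset.mem_coe, coe_biword', Finsupp.mem_toMultiset, Finsupp.mem_support_iff]

/-- Beyond the support, `colHeight` takes the value `ε_i - φ_i` of the whole word; whether `f̃_i` is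
defined can thus be read off from `colHeight`. -/
lemma exists_colHeight_eq_height (A : Mat) (i : ℕ+) :
    ∃ K, ∀ k, K ≤ k → colHeight A i k = height i (lWord A) := by
  obtain ⟨K, hK⟩ := exists_row_bound A
  refine ⟨K, fun k hk => ?_⟩
  rw [← height_filter, List.filter_eq_self.2, lWord]
  intro x hx
  exact decide_eq_true (Or.inl ((hK x (mem_biword'.1 hx)).1.trans_le hk))

lemma IsLastMax.unique {A : Mat} {i p q : ℕ+} (hp : IsLastMax A i p) (hq : IsLastMax A i q) :
    p = q := by
  rcases lt_trichotomy p q with h | h | h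
  · exact absurd (hp.2 q h) (hq.1 p).not_gt
  · exact h
  · exact absurd (hq.2 p h) (hp.1 q).not_gt

lemma height_eq_neg_length {i : ℕ+} {w : List ℕ+} (h : ∀ c ∈ w, c = i) :
    height i w = -(w.length : ℤ) := by
  rw [List.eq_replicate_of_mem h]
  simp [height, List.count_replicate, (pnat_succ_ne i).symm]

/-- The letters before the altered one are exactly the pairs up to `(p, i + 1)`, so altering it
leaves the list sorted: on matrices, `f̃_i` moves one unit and the word needs no re-sorting. -/
lemma wordF_lWord {A : Mat} {i : ℕ+} {l : List ℕ+} (h : wordF i (lWord A) = some l) :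
    ∃ p, IsLastMax A i p ∧ A (p, i) ≠ 0 ∧ matOfWords (kWord A) l = moveRight A p i ∧
      lWord (moveRight A p i) = l := by
  obtain ⟨u, v, h1, rfl, h2, h3⟩ := wordF_eq_some h
  obtain ⟨U, V', hUV, rfl, h4⟩ := List.map_eq_append_iff.1 h1
  obtain ⟨⟨p, c⟩, V, rfl, rfl, rfl⟩ := List.map_eq_cons_iff.1 h4
  simp only at *
  have hs := biword'_pairwise A
  have hs2 := hs
  rw [hUV, List.pairwise_append, List.pairwise_cons] at hs
  obtain ⟨hU, ⟨hcV, hV⟩, hUcV⟩ := hs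
  have hUc : ∀ x ∈ U, OmegaLE' x (p, c) := fun x hx => hUcV x hx _ List.mem_cons_self
  have hlt := pnat_lt_succ c
  have hfil : ∀ k, p ≤ k → (biword' A).filter (OmegaLE' · (k, c + 1)) =
      U.filter (OmegaLE' · (k, c + 1)) ++ if p < k then (p, c) :: V.filter (OmegaLE' · (k, c + 1))
        else [] := by
    intro k hk
    rw [hUV, List.filter_append]
    congr 1
    split_ifs with hpk
    · rw [List.filter_cons_of_pos]
      exact decide_eq_true (Or.inl hpk)
    · have hkp : k = p := le_antisymm (not_lt.1 hpk) hk
      subst hkp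
      rw [List.filter_eq_nil_iff]
      intro x hx hx2
      have h5 : OmegaLE' (k, c) x := by
        rcases List.mem_cons.1 hx with rfl | hx
        · exact Or.inr ⟨rfl, le_rfl⟩
        · exact hcV x hx
      have h6 : OmegaLE' (k, c) (k, c + 1) := _root_.trans h5 (by simpa using hx2)
      rcases h6 with h6 | h6
      · exact lt_irrefl _ h6
      · exact absurd h6.2 (not_le.2 hlt)
  -- A pair of `U` beyond `(p, c + 1)` would be a letter `c` in row `p`. Dropping all of these
  -- raises the height by their number, but the height of `U` is already maximal.
  have hUall : U.filter (OmegaLE' · (p, c + 1)) = U := by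
    have e1 := height_le_wordEps_of_prefix (i := c)
      ((filter_prefix_of_pairwise hs2 (p, c + 1)).map Prod.snd)
    rw [hfil p le_rfl, if_neg (lt_irrefl p), List.append_nil] at e1
    have e2 : height c (U.map Prod.snd) =
        height c ((U.filter (OmegaLE' · (p, c + 1))).map Prod.snd) +
        height c ((U.filter (fun x => ¬ OmegaLE' x (p, c + 1))).map Prod.snd) := by
      rw [← height_append, ← List.map_append]
      have := (List.filter_append_perm (fun x => decide (OmegaLE' x (p, c + 1))) U).map Prod.snd
      simp only [height, ← this.count_eq]
      simp
    have e3 : ∀ d ∈ (U.filter (fun x => ¬ OmegaLE' x (p, c + 1))).map Prod.snd, d = c := by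
      intro d hd
      obtain ⟨⟨y, d⟩, hx, rfl⟩ := List.mem_map.1 hd
      rw [List.mem_filter] at hx
      have h5 := hUc _ hx.1
      have h6 : ¬ OmegaLE' (y, d) (p, c + 1) := by simpa using hx.2
      simp only [OmegaLE', not_or, not_and, not_le] at h5 h6
      rcases h5 with h5 | h5
      · exact absurd h5 h6.1
      · exact le_antisymm (PNat.lt_add_one_iff.1 (h6.2 h5.1)) h5.2
    rw [height_eq_neg_length e3, h2] at e2
    have e4 : ((U.filter (fun x => ¬ OmegaLE' x (p, c + 1))).map Prod.snd).length = 0 := by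
      change height c _ ≤ wordEps c (lWord A) at e1
      omega
    rw [List.length_map, List.length_eq_zero_iff, List.filter_eq_nil_iff] at e4
    rw [List.filter_eq_self]
    intro x hx
    simpa using e4 x hx
  have hHp : colHeight A c p = wordEps c (lWord A) := by
    rw [← height_filter, hfil p le_rfl, if_neg (lt_irrefl p), List.append_nil, hUall, h2]
  have hUc' : ∀ x ∈ U, OmegaLE' x (p, c + 1) := by
    intro x hx
    simpa using List.filter_eq_self.1 hUall x hx
  have hApc : A (p, c) ≠ 0 := by
    rw [← mem_biword', hUV]
    simp
  have hmul : Finsupp.toMultiset (moveRight A p c) = ((U ++ (p, c + 1) :: V : List _) :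
      Multiset (ℕ+ × ℕ+)) := by
    have e1 : Finsupp.toMultiset A = (((p, c) :: (U ++ V) : List _) : Multiset (ℕ+ × ℕ+)) := by
      rw [← coe_biword', hUV, Multiset.coe_eq_coe]
      exact List.perm_middle
    have e2 : A = Multiset.toFinsupp ((U ++ V : List _) : Multiset (ℕ+ × ℕ+)) +
        Finsupp.single (p, c) 1 := by
      apply toMultiset_injective
      rw [map_add, e1, Multiset.toFinsupp_toMultiset, Finsupp.toMultiset_single, one_nsmul,
        ← Multiset.cons_coe, add_comm, Multiset.singleton_add]
    rw [moveRight, e2, add_tsub_cancel_right, map_add, Multiset.toFinsupp_toMultiset,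
      Finsupp.toMultiset_single, one_nsmul, add_comm, Multiset.singleton_add, Multiset.cons_coe,
      Multiset.coe_eq_coe]
    exact List.perm_middle.symm
  refine ⟨p, ⟨fun k => hHp ▸ colHeight_le_wordEps A c k, fun k hk => ?_⟩, hApc, ?_, ?_⟩
  · have e1 : U.filter (OmegaLE' · (k, c + 1)) = U := by
      rw [List.filter_eq_self]
      intro x hx
      have := hUc x hx
      refine decide_eq_true ?_
      rcases this with h | h
      · exact Or.inl (h.trans hk)
      · exact Or.inl (h.1 ▸ hk)
    rw [hHp, ← h2, ← height_filter, hfil k hk.le, if_pos hk, e1, List.map_append, height_append,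
      List.map_cons]
    have e2 := height_le_wordEps_of_prefix (i := c)
      ((filter_prefix_of_pairwise hV (k, c + 1)).map Prod.snd)
    rw [h3] at e2
    have e3 := height_append c [c] ((V.filter (OmegaLE' · (k, c + 1))).map Prod.snd)
    have e4 : height c [c] = -1 := by simp [height_cons, (pnat_succ_ne c).symm]
    simp only [List.cons_append, List.nil_append] at e3 ⊢
    omega
  · apply toMultiset_injective
    rw [hmul, matOfWords, Multiset.toFinsupp_toMultiset, kWord, hUV, List.map_append,
      List.zip_append (by simp), List.map_cons, List.zip_cons_cons, ← List.zip_of_prod rfl rfl,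
      ← List.zip_of_prod rfl rfl]
  · rw [lWord, biword'_eq (l := U ++ (p, c + 1) :: V) _ hmul.symm]
    · simp
    · rw [List.pairwise_append, List.pairwise_cons]
      refine ⟨hU, ⟨fun x hx => _root_.trans (b := (p, c)) (Or.inr ⟨rfl, hlt.le⟩) (hcV x hx), hV⟩, ?_⟩
      intro x hx y hy
      rcases List.mem_cons.1 hy with rfl | hy
      · exact hUc' x hx
      · exact hUcV x hx y (List.mem_cons_of_mem _ hy)

lemma crystalF_eq_some_iff {A B : Mat} {i : ℕ+} :
    crystalF (i : ℤ) A = some B ↔ ∃ p, IsLastMax A i p ∧ B = moveRight A p i := by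
  rw [crystalF_coe]
  cases h : wordF i (lWord A) with
  | none =>
    simp only [Option.map_none, reduceCtorEq, false_iff, not_exists, not_and]
    intro p hp
    rw [wordF_eq_none_iff] at h
    obtain ⟨K, hK⟩ := exists_colHeight_eq_height A i
    -- In a row beyond `p` and the support, `colHeight` is the height of the whole word, here equal
    -- to its maximum; hence `p` is not the last maximum.
    have h1 := hp.2 (max (p + 1) K) ((pnat_lt_succ p).trans_le (le_max_left _ _))
    rw [hK _ (le_max_right _ _), ← h] at h1
    exact absurd (colHeight_le_wordEps A i p) h1.not_ge
  | some l =>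
    obtain ⟨p, h1, -, h2, -⟩ := wordF_lWord h
    simp only [Option.map_some, Option.some.injEq, h2]
    constructor
    · rintro rfl
      exact ⟨p, h1, rfl⟩
    · rintro ⟨q, hq, rfl⟩
      rw [h1.unique hq]

lemma IsLastMax.ne_zero {A : Mat} {i p : ℕ+} (hp : IsLastMax A i p) : A (p, i) ≠ 0 := by
  have h := crystalF_eq_some_iff.2 ⟨p, hp, rfl⟩
  rw [crystalF_coe, Option.map_eq_some_iff] at h
  obtain ⟨l, hl, -⟩ := h
  obtain ⟨q, hq, h0, -⟩ := wordF_lWord hl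
  rwa [hp.unique hq]

lemma wordF_lWord_of_crystalF {A B : Mat} {i : ℕ+} (h : crystalF (i : ℤ) A = some B) :
    wordF i (lWord A) = some (lWord B) := by
  rw [crystalF_coe, Option.map_eq_some_iff] at h
  obtain ⟨l, hl, rfl⟩ := h
  obtain ⟨q, hq, h0, h1, h2⟩ := wordF_lWord hl
  rw [hl, h1, h2]

/-- Prefix heights rise only at letters `i + 1`, and a prefix ending in such a letter in row `k` is
at most as high as the full prefix up to `(k, i + 1)`, since only letters `i + 1` are missing. -/
lemma wordEps_lWord_eq_zero {A : Mat} {i : ℕ+} (h : ∀ k, colHeight A i k ≤ 0) :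
    wordEps i (lWord A) = 0 := by
  obtain ⟨u, hu, h1⟩ := exists_prefix_height i (lWord A)
  obtain ⟨U, hU, rfl⟩ := List.prefix_map_iff.1 hu
  refine le_antisymm (h1 ▸ ?_) (wordEps_nonneg _ _)
  clear h1 hu
  induction U using List.reverseRecOn with
  | nil => simp
  | append_singleton U x ih =>
    obtain ⟨k, c⟩ := x
    have ih := ih ((List.prefix_append _ _).trans hU)
    by_cases hc : c = i + 1
    · subst hc
      refine le_trans ?_ (h k)
      obtain ⟨V, hV⟩ := hU
      have hs := biword'_pairwise A
      rw [← hV, List.pairwise_append, List.pairwise_append] at hs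
      obtain ⟨⟨-, -, h2⟩, -, h3⟩ := hs
      have e1 : (U ++ [(k, i + 1)]).filter (OmegaLE' · (k, i + 1)) = U ++ [(k, i + 1)] := by
        rw [List.filter_eq_self]
        intro x hx
        rcases List.mem_append.1 hx with hx | hx
        · simpa using h2 x hx (k, i + 1) (by simp)
        · simp only [List.mem_singleton] at hx
          simp [hx, OmegaLE']
      rw [← height_filter, ← hV, List.filter_append, e1, List.map_append (l₂ := V.filter _),
        height_append]
      have e2 : ∀ c ∈ (V.filter (OmegaLE' · (k, i + 1))).map Prod.snd, c = i + 1 := by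
        intro c hc
        obtain ⟨x, hx, rfl⟩ := List.mem_map.1 hc
        rw [List.mem_filter] at hx
        have := h3 (k, i + 1) (by simp) x hx.1
        rw [antisymm_of OmegaLE' (by simpa using hx.2) this]
      have e3 : height i ((V.filter (OmegaLE' · (k, i + 1))).map Prod.snd) ≥ 0 := by
        rw [List.eq_replicate_of_mem e2]
        simp [height, List.count_replicate, pnat_succ_ne i]
      omega
    · rw [List.map_append, height_append]
      have : height i (List.map Prod.snd [(k, c)]) ≤ 0 := by
        rcases height_singleton_cases i c with ⟨e1, -, e3⟩ | ⟨e1, -, e3⟩ | ⟨e1, -, e3⟩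
        · exact absurd e1 hc
        · simp [e3]
        · simp [e3]
      omega

/-! ### Signatures after the move of one unit. -/

/-- The matrix obtained by moving one unit in the column `q` from the row `j` to the next one. -/
noncomputable def moveDown (A : Mat) (j q : ℕ+) : Mat :=
  A - Finsupp.single (j, q) 1 + Finsupp.single (j + 1, q) 1

lemma sub_single_add_single_apply {A : Mat} {x : ℕ+ × ℕ+} (hx : A x ≠ 0) (y z : ℕ+ × ℕ+) :
    (((A - Finsupp.single x 1 + Finsupp.single y 1 : Mat) z : ℕ) : ℤ) =
      A z - (if z = x then 1 else 0) + (if z = y then 1 else 0) := by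
  classical
  simp only [Finsupp.add_apply, Finsupp.tsub_apply, Finsupp.single_apply]
  by_cases h1 : z = x
  · subst h1
    by_cases h2 : z = y
    · subst h2; simp; omega
    · have : ¬ y = z := fun h => h2 h.symm
      simp [h2, this]; omega
  · have h1' : ¬ x = z := fun h => h1 h.symm
    by_cases h2 : z = y
    · subst h2; simp [h1, h1']
    · have : ¬ y = z := fun h => h2 h.symm
      simp [h1, h1', h2, this]

lemma moveRight_apply {A : Mat} {p i : ℕ+} (h : A (p, i) ≠ 0) (z : ℕ+ × ℕ+) :
    ((moveRight A p i z : ℕ) : ℤ) =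
      A z - (if z = (p, i) then 1 else 0) + (if z = (p, i + 1) then 1 else 0) :=
  sub_single_add_single_apply h _ z

lemma moveDown_apply {A : Mat} {j q : ℕ+} (h : A (j, q) ≠ 0) (z : ℕ+ × ℕ+) :
    ((moveDown A j q z : ℕ) : ℤ) =
      A z - (if z = (j, q) then 1 else 0) + (if z = (j + 1, q) then 1 else 0) :=
  sub_single_add_single_apply h _ z

lemma transpose_moveRight (A : Mat) (p i : ℕ+) :
    transpose (moveRight A p i) = moveDown (transpose A) i p := by
  ext ⟨x, y⟩
  simp [moveRight, moveDown, Finsupp.single_apply, and_comm]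

lemma crystalF_neg_eq_some_iff {A B : Mat} {j : ℕ+} :
    crystalF (-(j : ℤ)) A = some B ↔ ∃ q, IsLastMax (transpose A) j q ∧ B = moveDown A j q := by
  rw [crystalF_neg, Option.map_eq_some_iff]
  constructor
  · rintro ⟨C, hC, rfl⟩
    obtain ⟨q, hq, rfl⟩ := crystalF_eq_some_iff.1 hC
    exact ⟨q, hq, by rw [transpose_moveRight, transpose_transpose]⟩
  · rintro ⟨q, hq, rfl⟩
    exact ⟨_, crystalF_eq_some_iff.2 ⟨q, hq, rfl⟩, by rw [transpose_moveRight, transpose_transpose]⟩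

lemma crystalF_transpose (i : ℕ+) (A : Mat) :
    crystalF (i : ℤ) (transpose A) = (crystalF (-(i : ℤ)) A).map transpose := by
  rw [crystalF_neg, Option.map_map]
  simp [Function.comp_def]

lemma crystalF_neg_transpose (i : ℕ+) (A : Mat) :
    crystalF (-(i : ℤ)) (transpose A) = (crystalF (i : ℤ) A).map transpose := by
  rw [crystalF_neg, transpose_transpose]

lemma sum_ite_mem (S : Finset ℕ+) (p : ℕ+) :
    ∑ x ∈ S, (if x = p then (1 : ℤ) else 0) = if p ∈ S then 1 else 0 := by
  simp

lemma colHeight_moveRight {A : Mat} {p i : ℕ+} (h : A (p, i) ≠ 0) (k : ℕ+) :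
    colHeight (moveRight A p i) i k =
      colHeight A i k + (if p ≤ k then 1 else 0) + (if p < k then 1 else 0) := by
  have h1 := pnat_succ_ne i
  simp only [colHeight, moveRight_apply h, Prod.mk.injEq, h1, h1.symm, and_false, and_true,
    if_false, Finset.sum_add_distrib, Finset.sum_sub_distrib, sum_ite_mem, Finset.mem_Iic,
    Finset.mem_Iio, Finset.sum_const_zero]
  ring

/-- A unit going down by one row changes a partial column sum for a single cut-off only, so at most
one row feels the move. -/
lemma colHeight_moveDown {A : Mat} {j q : ℕ+} (h : A (j, q) ≠ 0) (i k : ℕ+) :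
    colHeight (moveDown A j q) i k =
      colHeight A i k - (if q = i + 1 ∧ k = j then 1 else 0) +
        (if q = i ∧ k = j + 1 then 1 else 0) := by
  have h1 := pnat_succ_ne i
  have e (c : ℕ+) (S : Finset ℕ+) (x : ℕ+) :
      ∑ y ∈ S, (if y = x ∧ c = q then (1 : ℤ) else 0) = if x ∈ S ∧ q = c then 1 else 0 := by
    by_cases hc : q = c
    · simp [hc]
    · have : ¬ c = q := fun h => hc h.symm
      simp [hc, this]
  simp only [colHeight, moveDown_apply h, Prod.mk.injEq,
    Finset.sum_add_distrib, Finset.sum_sub_distrib, e, Finset.mem_Iic, Finset.mem_Iio]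
  have h2 : (if j ≤ k then (1 : ℤ) else 0) - (if j + 1 ≤ k then 1 else 0) =
      if k = j then 1 else 0 := by
    simp only [PNat.add_one_le_iff]
    rcases lt_trichotomy j k with h | h | h
    · simp [h, h.le, h.ne']
    · simp [h]
    · simp [h.not_gt, h.not_ge, h.ne]
  have h3 : (if j < k then (1 : ℤ) else 0) - (if j + 1 < k then 1 else 0) =
      if k = j + 1 then 1 else 0 := by
    have h3 : j < k ↔ j + 1 ≤ k := PNat.add_one_le_iff.symm
    simp only [h3]
    rcases lt_trichotomy (j + 1) k with h | h | h
    · simp [h, h.le, h.ne']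
    · simp [h]
    · simp [h.not_gt, h.not_ge, h.ne]
  by_cases e1 : q = i + 1
  · simp only [e1, h1, and_true, true_and, and_false, false_and, if_false]
    rw [← h2]; ring
  · by_cases e2 : q = i
    · simp only [e2, h1.symm, and_true, true_and, and_false, false_and, if_false]
      rw [← h3]; ring
    · simp only [e1, e2, and_false, false_and, if_false]
      ring

lemma colHeight_sub {A : Mat} {p k : ℕ+} (h : p < k) (i : ℕ+) :
    colHeight A i k - colHeight A i p =
      ∑ x ∈ Finset.Ioc p k, (A (x, i + 1) : ℤ) - ∑ x ∈ Finset.Ico p k, (A (x, i) : ℤ) := by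
  have e1 : Finset.Iic k = Finset.Iic p ∪ Finset.Ioc p k := by
    ext x; simp only [Finset.mem_union, Finset.mem_Iic, Finset.mem_Ioc]
    exact ⟨fun hx => (le_or_gt x p).imp id fun h' => ⟨h', hx⟩,
      fun hx => hx.elim (fun h' => h'.trans h.le) fun h' => h'.2⟩
  have e2 : Finset.Iio k = Finset.Iio p ∪ Finset.Ico p k := by
    ext x; simp only [Finset.mem_union, Finset.mem_Iio, Finset.mem_Ico]
    exact ⟨fun hx => (lt_or_ge x p).imp id fun h' => ⟨h', hx⟩,
      fun hx => hx.elim (fun h' => h'.trans h) fun h' => h'.2⟩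
  have d1 : Disjoint (Finset.Iic p) (Finset.Ioc p k) := by
    rw [Finset.disjoint_left]; intro x hx hx'
    exact absurd (Finset.mem_Iic.1 hx) (Finset.mem_Ioc.1 hx').1.not_ge
  have d2 : Disjoint (Finset.Iio p) (Finset.Ico p k) := by
    rw [Finset.disjoint_left]; intro x hx hx'
    exact absurd (Finset.mem_Iio.1 hx) (Finset.mem_Ico.1 hx').1.not_gt
  rw [colHeight, colHeight, e1, e2, Finset.sum_union d1, Finset.sum_union d2]
  ring

/-- The increment `A (j + 1, i + 1) - A (j, i)` is the same for `colHeight A i` between `j` and `j +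
1` and for the transposed signature between `i` and `i + 1`. The commutation of the two crystal
structures rests on this coincidence. -/
lemma colHeight_succ (A : Mat) (i j : ℕ+) :
    colHeight A i (j + 1) = colHeight A i j + A (j + 1, i + 1) - A (j, i) := by
  have h := colHeight_sub (A := A) (pnat_lt_succ j) i
  have e1 : Finset.Ioc j (j + 1) = {j + 1} := by
    ext x
    simp only [Finset.mem_Ioc, Finset.mem_singleton, ← PNat.add_one_le_iff]
    exact ⟨fun h => le_antisymm h.2 h.1, fun h => ⟨h.ge, h.le⟩⟩
  have e2 : Finset.Ico j (j + 1) = {j} := by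
    ext x
    simp only [Finset.mem_Ico, Finset.mem_singleton, PNat.lt_add_one_iff]
    exact ⟨fun h => le_antisymm h.2 h.1, fun h => ⟨h.ge, h.le⟩⟩
  rw [e1, e2, Finset.sum_singleton, Finset.sum_singleton] at h
  omega

lemma exists_max_colHeight (A : Mat) (i : ℕ+) : ∃ q, ∀ k, colHeight A i k ≤ colHeight A i q := by
  obtain ⟨m, ⟨q, rfl⟩, h⟩ := Int.exists_greatest_of_bdd (P := fun m => ∃ k, colHeight A i k = m)
    ⟨wordEps i (lWord A), by rintro _ ⟨k, rfl⟩; exact colHeight_le_wordEps A i k⟩ ⟨_, 1, rfl⟩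
  exact ⟨q, fun k => h _ ⟨k, rfl⟩⟩

lemma exists_isLastMax {A : Mat} {i p K : ℕ+} (h : ∀ k, K ≤ k → colHeight A i k < colHeight A i p) :
    ∃ q, IsLastMax A i q := by
  obtain ⟨q, hq⟩ := exists_max_colHeight A i
  obtain ⟨S, hS⟩ : ∃ S : Finset ℕ+, ∀ k, k ∈ S ↔ colHeight A i k = colHeight A i q := by
    refine ⟨(Finset.Iio K).filter fun k => colHeight A i k = colHeight A i q, fun k => ?_⟩
    simp only [Finset.mem_filter, Finset.mem_Iio, and_iff_right_iff_imp]
    intro hk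
    by_contra hK
    have := h k (not_lt.1 hK)
    have := hq p
    omega
  have hne : S.Nonempty := ⟨q, (hS q).2 rfl⟩
  have hm := (hS _).1 (S.max'_mem hne)
  refine ⟨S.max' hne, fun k => hm ▸ hq k, fun k hk => ?_⟩
  rw [hm]
  refine lt_of_le_of_ne (hq k) fun he => ?_
  exact absurd (S.le_max' k ((hS k).2 he)) hk.not_ge

/-! ### Raising -/

/-- The raising operator moves a unit left in the first row `p` where `colHeight` is maximal. Being
first and having positive height force a unit at `(p, i + 1)`, by `colHeight_succ`. -/
lemma exists_crystalF_eq {A : Mat} {i k : ℕ+} (h : 0 < colHeight A i k) :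
    ∃ B, crystalF (i : ℤ) B = some A := by
  obtain ⟨q, hq⟩ := exists_max_colHeight A i
  have hex : ∃ n : ℕ+, colHeight A i n = colHeight A i q := ⟨q, rfl⟩
  let p := PNat.find hex
  have hp : colHeight A i p = colHeight A i q := PNat.find_spec hex
  have hlt : ∀ x, x < p → colHeight A i x < colHeight A i p := fun x hx =>
    lt_of_le_of_ne (hp ▸ hq x) fun he => PNat.find_min hex hx (he.trans hp)
  have hpos : 0 < colHeight A i p := hp ▸ h.trans_le (hq k)
  have h0 : A (p, i + 1) ≠ 0 := by
    intro h0
    by_cases h1 : p = 1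
    · have : colHeight A i 1 ≤ A (1, i + 1) := by
        have : Finset.Iic (1 : ℕ+) = {1} := by
          ext x; simp
        simp only [colHeight, this, Finset.sum_singleton]
        have : 0 ≤ ∑ x ∈ Finset.Iio (1 : ℕ+), (A (x, i) : ℤ) :=
          Finset.sum_nonneg fun _ _ => by positivity
        omega
      rw [h1] at h0 hpos
      omega
    · obtain ⟨x, hx⟩ := PNat.exists_eq_succ_of_ne_one h1
      have h2 := hlt x (hx ▸ pnat_lt_succ x)
      have h3 := colHeight_succ A i x
      rw [← hx] at h3
      omega
  let B : Mat := A - Finsupp.single (p, i + 1) 1 + Finsupp.single (p, i) 1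
  have hB := fun z => sub_single_add_single_apply h0 (p, i) z
  have hB0 : B (p, i) ≠ 0 := by
    have := hB (p, i)
    simp only [Prod.mk.injEq, (pnat_succ_ne i).symm, and_false, if_false, if_true] at this
    change ((B (p, i) : ℕ) : ℤ) = _ at this
    omega
  have hmv : moveRight B p i = A := by
    ext z
    have h1 := moveRight_apply hB0 z
    have h2 : ((B z : ℕ) : ℤ) = _ := hB z
    omega
  have hH := colHeight_moveRight hB0
  rw [hmv] at hH
  refine ⟨B, crystalF_eq_some_iff.2 ⟨p, ⟨fun x => ?_, fun x hx => ?_⟩, hmv.symm⟩⟩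
  · have e1 := hH x
    have e2 := hH p
    have e3 := hq x
    simp only [le_refl, if_true, lt_irrefl, if_false] at e2
    rcases lt_trichotomy x p with h | h | h
    · have := hlt x h
      simp only [h.not_ge, h.not_gt, if_false] at e1
      omega
    · rw [h]
    · simp only [h, h.le, if_true] at e1
      omega
  · have e1 := hH x
    have e2 := hH p
    have e3 := hq x
    simp only [le_refl, if_true, lt_irrefl, if_false] at e2
    simp only [hx, hx.le, if_true] at e1
    omega

/-- The last maximum before the move is the first maximum after it, so the image determines the row
of the move. -/
lemma crystalF_injective {A B C : Mat} {i : ℕ+} (hA : crystalF (i : ℤ) A = some C)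
    (hB : crystalF (i : ℤ) B = some C) : A = B := by
  obtain ⟨p, hp, h1⟩ := crystalF_eq_some_iff.1 hA
  obtain ⟨q, hq, h2⟩ := crystalF_eq_some_iff.1 hB
  have key : ∀ {D : Mat} {x : ℕ+}, IsLastMax D i x → C = moveRight D x i →
      (∀ k, colHeight C i k ≤ colHeight C i x) ∧ ∀ k, k < x → colHeight C i k < colHeight C i x := by
    rintro D x hx rfl
    have h := colHeight_moveRight hx.ne_zero
    have hx' := h x
    simp only [le_refl, if_true, lt_irrefl, if_false] at hx'
    constructor
    · intro k
      have hk := h k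
      have h3 := hx.1 k
      rcases lt_trichotomy k x with h | h | h
      · simp only [h.not_ge, h.not_gt, if_false] at hk
        omega
      · rw [h]
      · have h4 := hx.2 k h
        simp only [h, h.le, if_true] at hk
        omega
    · intro k h
      have hk := h
      have h3 := hx.1 k
      have hk := colHeight_moveRight hx.ne_zero k
      simp only [h.not_ge, h.not_gt, if_false] at hk
      omega
  have hpq : p = q := by
    have k1 := key hp h1
    have k2 := key hq h2
    rcases lt_trichotomy p q with h | h | h
    · exact absurd (k2.2 p h) (k1.1 q).not_gt
    · exact h
    · exact absurd (k1.2 q h) (k2.1 p).not_gt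
  subst hpq
  ext z
  have e1 := moveRight_apply hp.ne_zero z
  have e2 := moveRight_apply hq.ne_zero z
  rw [← h1] at e1
  rw [← h2] at e2
  omega

/-! ### The two crystal structures commute -/

section Commute

variable {A : Mat} {i j p q : ℕ+}

lemma IsLastMax.ne_zero' (hq : IsLastMax (transpose A) j q) : A (j, q) ≠ 0 := by
  simpa using hq.ne_zero

/-- `ε_i` is unchanged by `f̃_{-j}`. If `q = i + 1`, row `j` loses one, but maximality of `q` shows
that row `j + 1` is at least as high; if `q = i`, row `j + 1` gains one, but being the last maximum
shows that it was lower than row `j`. -/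
lemma colHeight_moveDown_le_iff (hq : IsLastMax (transpose A) j q) (m : ℤ) :
    (∀ k, colHeight (moveDown A j q) i k ≤ m) ↔ ∀ k, colHeight A i k ≤ m := by
  have h := colHeight_moveDown hq.ne_zero' i
  have hs := colHeight_succ A i j
  have hs' := colHeight_succ (transpose A) j i
  simp only [transpose_apply] at hs'
  have h1 := pnat_succ_ne i
  have h2 := pnat_succ_ne j
  constructor
  · intro hm k
    by_cases hk : q = i + 1 ∧ k = j
    · obtain ⟨rfl, rfl⟩ := hk
      have e1 := h (k + 1)
      have e2 := hq.1 i
      have e3 := hm (k + 1)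
      simp only [h2, h1, and_false, false_and, if_false] at e1
      omega
    · have e1 := h k
      have e2 := hm k
      rw [if_neg hk] at e1
      split_ifs at e1 <;> omega
  · intro hm k
    by_cases hk : q = i ∧ k = j + 1
    · obtain ⟨rfl, rfl⟩ := hk
      have e1 := h (j + 1)
      have e2 := hq.2 (q + 1) (pnat_lt_succ q)
      have e3 := hm j
      simp only [h2, h1.symm, if_false, and_self, if_true] at e1
      omega
    · have e1 := h k
      have e2 := hm k
      rw [if_neg hk] at e1
      split_ifs at e1 <;> omega

/-- The move spares the row `p`, and a new maximum after `p` can only be created in row `j + 1`, by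
a gain of one; this happens precisely in the excluded case. -/
lemma IsLastMax.moveDown (hq : IsLastMax (transpose A) j q) (hp : IsLastMax A i p)
    (hn : ¬ (p = j ∧ q = i ∧ A (j + 1, i + 1) + 1 = A (j, i))) :
    IsLastMax (moveDown A j q) i p := by
  have h := colHeight_moveDown hq.ne_zero' i
  have hs := colHeight_succ A i j
  have hs' := colHeight_succ (transpose A) j i
  simp only [transpose_apply] at hs'
  have h1 := pnat_succ_ne i
  have h2 := pnat_succ_ne j
  have hpp : colHeight (SymDemazure.moveDown A j q) i p = colHeight A i p := by
    have e1 := h p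
    rw [if_neg, if_neg] at e1
    · omega
    · rintro ⟨rfl, rfl⟩
      have := hq.2 (q + 1) (pnat_lt_succ q)
      have := hp.1 j
      omega
    · rintro ⟨rfl, rfl⟩
      have := hq.1 i
      have := hp.2 (p + 1) (pnat_lt_succ p)
      omega
  refine ⟨?_, ?_⟩
  · rw [hpp]
    exact (colHeight_moveDown_le_iff hq _).2 hp.1
  · intro k hk
    have e1 := h k
    have e2 := hp.2 k hk
    rw [hpp]
    by_cases hk2 : q = i ∧ k = j + 1
    · obtain ⟨rfl, rfl⟩ := hk2
      have e3 := hq.2 (q + 1) (pnat_lt_succ q)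
      simp only [h1.symm, false_and, if_false, and_self, if_true] at e1
      by_cases hpj : p = j
      · subst hpj
        have : ¬ A (p + 1, q + 1) + 1 = A (p, q) := fun h => hn ⟨rfl, rfl, h⟩
        omega
      · have hpj : p < j := lt_of_le_of_ne (PNat.lt_add_one_iff.1 hk) hpj
        have := hp.2 j hpj
        omega
    · rw [if_neg hk2] at e1
      split_ifs at e1 <;> omega

/-- The excluded case of `IsLastMax.moveDown`: row `j + 1` was one below row `j` and now ties with
the maximum. -/
lemma IsLastMax.moveDown_succ (hq : IsLastMax (transpose A) j i) (hp : IsLastMax A i j)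
    (hn : A (j + 1, i + 1) + 1 = A (j, i)) : IsLastMax (SymDemazure.moveDown A j i) i (j + 1) := by
  have h := colHeight_moveDown hq.ne_zero' i
  have hs := colHeight_succ A i j
  have h1 := pnat_succ_ne i
  have h2 := pnat_succ_ne j
  have hpp : colHeight (SymDemazure.moveDown A j i) i (j + 1) = colHeight A i j := by
    have e1 := h (j + 1)
    simp only [h1.symm, false_and, if_false, and_self, if_true] at e1
    omega
  refine ⟨?_, ?_⟩
  · rw [hpp]
    exact (colHeight_moveDown_le_iff hq _).2 hp.1
  · intro k hk
    have e1 := h k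
    have e2 := hp.2 k ((pnat_lt_succ j).trans hk)
    rw [hpp]
    simp only [h1.symm, hk.ne', false_and, and_false, if_false] at e1
    omega

lemma exists_isLastMax_of_moveDown (hq : IsLastMax (transpose A) j q)
    (hp : IsLastMax (SymDemazure.moveDown A j q) i p) : ∃ p', IsLastMax A i p' := by
  obtain ⟨p₀, hp₀⟩ := exists_max_colHeight A i
  have h := colHeight_moveDown hq.ne_zero' i
  have h1 := (colHeight_moveDown_le_iff (i := i) hq _).2 hp₀ p
  -- From this row on, the move has no effect and the rows lie after the last maximum `p` of the
  -- moved matrix.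
  refine exists_isLastMax (p := p₀) (K := p + (j + 1) + 1) fun k hk => ?_
  have hk1 : p < k := by
    rw [← PNat.coe_lt_coe]; rw [← PNat.coe_le_coe] at hk; simp only [PNat.add_coe, PNat.one_coe] at hk; omega
  have hk2 : j + 1 < k := by
    rw [← PNat.coe_lt_coe]; rw [← PNat.coe_le_coe] at hk; simp only [PNat.add_coe, PNat.one_coe] at *; omega
  have e1 := h k
  simp only [hk2.ne', ((pnat_lt_succ j).trans hk2).ne', and_false, if_false] at e1
  have := hp.2 k hk1
  omega

end Commute

/-- Generically the two moves do not disturb each other. In the exceptional case both orders carry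
the same unit from `(j, i)` to `(j + 1, i + 1)`, via `(j + 1, i)` or via `(j, i + 1)`. -/
lemma crystalF_commute {A B C : Mat} {i j : ℕ+} (hB : crystalF (-(j : ℤ)) A = some B)
    (hC : crystalF (i : ℤ) A = some C) :
    ∃ D, crystalF (i : ℤ) B = some D ∧ crystalF (-(j : ℤ)) C = some D := by
  obtain ⟨q, hq, rfl⟩ := crystalF_neg_eq_some_iff.1 hB
  obtain ⟨p, hp, rfl⟩ := crystalF_eq_some_iff.1 hC
  have h1 := pnat_succ_ne i
  have h2 := pnat_succ_ne j
  by_cases hn : p = j ∧ q = i ∧ A (j + 1, i + 1) + 1 = A (j, i)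
  · obtain ⟨rfl, rfl, hn⟩ := hn
    have e1 := IsLastMax.moveDown_succ hq hp hn
    have e2 := IsLastMax.moveDown_succ (A := transpose A) (by simpa using hp) hq (by simpa using hn)
    rw [← transpose_moveRight] at e2
    refine ⟨_, crystalF_eq_some_iff.2 ⟨_, e1, rfl⟩, crystalF_neg_eq_some_iff.2 ⟨_, e2, ?_⟩⟩
    ext z
    have f1 := moveRight_apply e1.ne_zero z
    have f2 := moveDown_apply e2.ne_zero' z
    have f3 := moveRight_apply hp.ne_zero z
    have f4 := moveDown_apply hq.ne_zero' z
    omega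
  · have e1 := IsLastMax.moveDown hq hp hn
    have e2 := IsLastMax.moveDown (A := transpose A) (by simpa using hp) hq
      (by rintro ⟨rfl, rfl, h⟩; exact hn ⟨rfl, rfl, by simpa using h⟩)
    rw [← transpose_moveRight] at e2
    refine ⟨_, crystalF_eq_some_iff.2 ⟨_, e1, rfl⟩, crystalF_neg_eq_some_iff.2 ⟨_, e2, ?_⟩⟩
    ext z
    have f1 := moveRight_apply e1.ne_zero z
    have f2 := moveDown_apply e2.ne_zero' z
    have f3 := moveRight_apply hp.ne_zero z
    have f4 := moveDown_apply hq.ne_zero' z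
    omega

/-- The part needed of the invariance of `φ_i` under `f̃_{-j}`. -/
lemma exists_crystalF_of_crystalF_neg {A B D : Mat} {i j : ℕ+}
    (hB : crystalF (-(j : ℤ)) A = some B) (hD : crystalF (i : ℤ) B = some D) :
    ∃ C, crystalF (i : ℤ) A = some C := by
  obtain ⟨q, hq, rfl⟩ := crystalF_neg_eq_some_iff.1 hB
  obtain ⟨p, hp, rfl⟩ := crystalF_eq_some_iff.1 hD
  obtain ⟨p', hp'⟩ := exists_isLastMax_of_moveDown hq hp
  exact ⟨_, crystalF_eq_some_iff.2 ⟨p', hp', rfl⟩⟩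

lemma colHeight_le_iff_of_crystalF_neg {A B : Mat} {i j : ℕ+} (h : crystalF (-(j : ℤ)) A = some B)
    (m : ℤ) : (∀ k, colHeight B i k ≤ m) ↔ ∀ k, colHeight A i k ≤ m := by
  obtain ⟨q, hq, rfl⟩ := crystalF_neg_eq_some_iff.1 h
  exact colHeight_moveDown_le_iff hq m

/-! ### Chains in the support of a matrix -/

/-- The support of `A` contains at least `m` positions with row index `> r` and column index `> c`
that form a chain for the strict product order. -/
def HasChain (A : Mat) (r c m : ℕ) : Prop :=
  ∃ s : Finset (ℕ+ × ℕ+), m ≤ s.card ∧ (∀ x ∈ s, A x ≠ 0 ∧ r < (x.1 : ℕ) ∧ c < (x.2 : ℕ)) ∧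
    ∀ x ∈ s, ∀ y ∈ s, x ≠ y → (x.1 < y.1 ∧ x.2 < y.2) ∨ (y.1 < x.1 ∧ y.2 < x.2)

lemma HasChain.congr {A B : Mat} {r c m : ℕ} (h : HasChain A r c m)
    (hAB : ∀ x : ℕ+ × ℕ+, r < (x.1 : ℕ) → c < (x.2 : ℕ) → A x ≠ 0 → B x ≠ 0) :
    HasChain B r c m := by
  obtain ⟨s, h1, h2, h3⟩ := h
  exact ⟨s, h1, fun x hx => ⟨hAB x (h2 x hx).2.1 (h2 x hx).2.2 (h2 x hx).1, (h2 x hx).2⟩, h3⟩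

lemma HasChain.transpose {A : Mat} {r c m : ℕ} (h : HasChain A r c m) :
    HasChain (transpose A) c r m := by
  classical
  obtain ⟨s, h1, h2, h3⟩ := h
  refine ⟨s.map (Equiv.prodComm _ _).toEmbedding, by simpa using h1, ?_, ?_⟩
  · intro x hx
    obtain ⟨y, hy, rfl⟩ := Finset.mem_map.1 hx
    have := h2 y hy
    refine ⟨?_, this.2.2, this.2.1⟩
    exact this.1
  · intro x' hx' y' hy' hxy
    obtain ⟨x, hx, rfl⟩ := Finset.mem_map.1 hx'
    obtain ⟨y, hy, rfl⟩ := Finset.mem_map.1 hy'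
    have := h3 x hx y hy (fun h => hxy (h ▸ rfl))
    simp only [Equiv.coe_toEmbedding, Equiv.prodComm_apply, Prod.fst_swap, Prod.snd_swap]
    tauto

lemma HasChain.replace {A B : Mat} {r c m : ℕ} {s : Finset (ℕ+ × ℕ+)} (h1 : m ≤ s.card)
    (h2 : ∀ x ∈ s, A x ≠ 0 ∧ r < (x.1 : ℕ) ∧ c < (x.2 : ℕ))
    (h3 : ∀ x ∈ s, ∀ y ∈ s, x ≠ y → (x.1 < y.1 ∧ x.2 < y.2) ∨ (y.1 < x.1 ∧ y.2 < x.2))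
    {x y : ℕ+ × ℕ+} (hx : x ∈ s) (hy : B y ≠ 0 ∧ r < (y.1 : ℕ) ∧ c < (y.2 : ℕ))
    (hB : ∀ z ∈ s, z ≠ x → B z ≠ 0)
    (hr : ∀ z ∈ s, z ≠ x → (y.1 < z.1 ∧ y.2 < z.2) ∨ (z.1 < y.1 ∧ z.2 < y.2)) :
    HasChain B r c m := by
  classical
  have hys : y ∉ s.erase x := by
    intro hy
    rw [Finset.mem_erase] at hy
    rcases hr y hy.2 hy.1 with h | h <;> exact lt_irrefl _ h.1
  refine ⟨insert y (s.erase x), ?_, ?_, ?_⟩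
  · rw [Finset.card_insert_of_notMem hys, Finset.card_erase_of_mem hx]
    omega
  · intro z hz
    rcases Finset.mem_insert.1 hz with rfl | hz
    · exact hy
    · rw [Finset.mem_erase] at hz
      exact ⟨hB z hz.2 hz.1, (h2 z hz.2).2⟩
  · intro z hz w hw hzw
    rcases Finset.mem_insert.1 hz with rfl | hz' <;> rcases Finset.mem_insert.1 hw with rfl | hw'
    · exact absurd rfl hzw
    · rw [Finset.mem_erase] at hw'
      exact hr w hw'.2 hw'.1
    · rw [Finset.mem_erase] at hz'
      exact (hr z hz'.2 hz'.1).symm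
    · rw [Finset.mem_erase] at hz' hw'
      exact h3 z hz'.2 w hw'.2 hzw

/-- A chain spoiled by the move is repaired by exchanging one element within its column or moving it
to the adjacent column. Only for `c = i` could the latter leave the region. -/
lemma hasChain_moveRight_iff {A : Mat} {i p : ℕ+} (hp : IsLastMax A i p) {r c m : ℕ}
    (hc : c ≠ i) : HasChain (moveRight A p i) r c m ↔ HasChain A r c m := by
  have hap := moveRight_apply hp.ne_zero
  have hne := pnat_succ_ne i
  have hlt := pnat_lt_succ i
  have h0 := hp.ne_zero
  constructor
  · rintro ⟨s, h1, h2, h3⟩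
    by_cases hs : (p, i + 1) ∈ s ∧ A (p, i + 1) = 0
    · obtain ⟨hs, hA⟩ := hs
      have hB : ∀ z ∈ s, z ≠ (p, i + 1) → A z ≠ 0 := by
        intro z hz hz2
        have e1 := hap z
        have e2 := (h2 z hz).1
        rw [if_neg hz2] at e1
        split_ifs at e1 <;> omega
      have hc' : c < (i : ℕ) := by
        have := (h2 _ hs).2.2
        simp only [PNat.add_coe, PNat.one_coe] at this
        omega
      -- If the chain also meets column `i`, in row `k < p`, then `(p, i)` is not available.
      -- Maximality at `p` compared with `k` yields another unit of column `i + 1` strictly between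
      -- the rows `k` and `p`.
      by_cases hz : ∃ z ∈ s, z.2 = i
      · obtain ⟨⟨k, d⟩, hz, hd⟩ := hz
        obtain rfl : i = d := hd.symm
        have hk : k < p := by
          rcases h3 _ hz _ hs (by simp [hne.symm]) with h | h
          · exact h.1
          · exact absurd h.2 hlt.not_gt
        have e1 := hp.1 k
        have e2 := colHeight_sub (A := A) hk i
        have e3 : (1 : ℤ) ≤ ∑ x ∈ Finset.Ico k p, (A (x, i) : ℤ) := by
          have h4 := hB _ hz (by simp [hne.symm])
          have := Finset.single_le_sum (s := Finset.Ico k p) (f := fun x => (A (x, i) : ℤ))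
            (fun _ _ => by positivity) (Finset.mem_Ico.2 ⟨le_rfl, hk⟩)
          omega
        have e4 : ∑ x ∈ Finset.Ioc k p, (A (x, i + 1) : ℤ) ≠ 0 := by omega
        obtain ⟨x, hx, hx0⟩ := Finset.exists_ne_zero_of_sum_ne_zero e4
        rw [Finset.mem_Ioc] at hx
        have hxp : x < p := by
          refine lt_of_le_of_ne hx.2 ?_
          rintro rfl
          exact hx0 (by simp [hA])
        refine HasChain.replace h1 h2 h3 hs (y := (x, i + 1)) ⟨by exact_mod_cast hx0, ?_, ?_⟩ hB ?_
        · exact (h2 _ hz).2.1.trans (PNat.coe_lt_coe _ _ |>.2 hx.1)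
        · exact (h2 _ hs).2.2
        · intro w hw hwx
          rcases h3 w hw _ hs hwx with h | h
          · right
            refine ⟨?_, h.2⟩
            by_cases hwz : w = (k, i)
            · rw [hwz]; exact hx.1
            · rcases h3 w hw _ hz hwz with h' | h'
              · exact h'.1.trans hx.1
              · exact absurd (PNat.lt_add_one_iff.1 h.2) h'.2.not_ge
          · left
            exact ⟨hxp.trans h.1, h.2⟩
      · refine HasChain.replace h1 h2 h3 hs (y := (p, i)) ⟨h0, (h2 _ hs).2.1, hc'⟩ hB ?_
        intro w hw hwx
        rcases h3 w hw _ hs hwx with h | h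
        · right
          exact ⟨h.1, lt_of_le_of_ne (PNat.lt_add_one_iff.1 h.2) fun h' => hz ⟨w, hw, h'⟩⟩
        · left
          exact ⟨h.1, hlt.trans h.2⟩
    · refine ⟨s, h1, fun x hx => ⟨?_, (h2 x hx).2⟩, h3⟩
      have e1 := hap x
      have e2 := (h2 x hx).1
      by_cases hx1 : x = (p, i + 1)
      · intro h
        exact hs ⟨hx1 ▸ hx, hx1 ▸ h⟩
      · rw [if_neg hx1] at e1
        split_ifs at e1 <;> omega
  · rintro ⟨s, h1, h2, h3⟩
    by_cases hs : (p, i) ∈ s ∧ A (p, i) = 1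
    · obtain ⟨hs, hA⟩ := hs
      have hB : ∀ z ∈ s, z ≠ (p, i) → moveRight A p i z ≠ 0 := by
        intro z hz hz2
        have e1 := hap z
        have e2 := (h2 z hz).1
        rw [if_neg hz2] at e1
        split_ifs at e1 <;> omega
      -- The mirror situation: if the chain meets column `i + 1` in row `k > p`, strictness of the
      -- last maximum gives a unit of column `i` strictly between `p` and `k`, besides the single
      -- one at `(p, i)`.
      by_cases hz : ∃ z ∈ s, z.2 = i + 1
      · obtain ⟨⟨k, d⟩, hz, hd⟩ := hz
        simp only at hd
        subst hd
        have hk : p < k := by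
          rcases h3 _ hs _ hz (by simp [hne.symm]) with h | h
          · exact h.1
          · exact absurd h.2 hlt.not_gt
        have e1 := hp.2 k hk
        have e2 := colHeight_sub (A := A) hk i
        have e3 : (1 : ℤ) ≤ ∑ x ∈ Finset.Ioc p k, (A (x, i + 1) : ℤ) := by
          have h4 := (h2 _ hz).1
          have := Finset.single_le_sum (s := Finset.Ioc p k) (f := fun x => (A (x, i + 1) : ℤ))
            (fun _ _ => by positivity) (Finset.mem_Ioc.2 ⟨hk, le_rfl⟩)
          omega
        have e4 : ∑ x ∈ (Finset.Ico p k).erase p, (A (x, i) : ℤ) ≠ 0 := by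
          have := Finset.add_sum_erase (Finset.Ico p k) (fun x => (A (x, i) : ℤ))
            (Finset.mem_Ico.2 ⟨le_rfl, hk⟩)
          omega
        obtain ⟨x, hx, hx0⟩ := Finset.exists_ne_zero_of_sum_ne_zero e4
        rw [Finset.mem_erase, Finset.mem_Ico] at hx
        have hpx : p < x := lt_of_le_of_ne hx.2.1 hx.1.symm
        refine HasChain.replace h1 h2 h3 hs (y := (x, i)) ⟨?_, ?_, ?_⟩ hB ?_
        · have e5 := hap (x, i)
          simp only [Prod.mk.injEq, hx.1, hne.symm, false_and, and_false, if_false] at e5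
          omega
        · exact (h2 _ hs).2.1.trans (PNat.coe_lt_coe _ _ |>.2 hpx)
        · exact (h2 _ hs).2.2
        · intro w hw hwx
          rcases h3 w hw _ hs hwx with h | h
          · right
            exact ⟨h.1.trans hpx, h.2⟩
          · left
            refine ⟨?_, h.2⟩
            by_cases hwz : w = (k, i + 1)
            · rw [hwz]; exact hx.2.2
            · rcases h3 w hw _ hz hwz with h' | h'
              · exact absurd (PNat.lt_add_one_iff.1 h'.2) h.2.not_ge
              · exact hx.2.2.trans h'.1
      · refine HasChain.replace h1 h2 h3 hs (y := (p, i + 1)) ⟨?_, (h2 _ hs).2.1, ?_⟩ hB ?_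
        · have e5 := hap (p, i + 1)
          simp only [Prod.mk.injEq, hne, and_false, if_false, if_true] at e5
          omega
        · exact (h2 _ hs).2.2.trans (PNat.coe_lt_coe _ _ |>.2 hlt)
        · intro w hw hwx
          rcases h3 w hw _ hs hwx with h | h
          · right
            exact ⟨h.1, h.2.trans hlt⟩
          · left
            exact ⟨h.1, lt_of_le_of_ne (PNat.add_one_le_iff.2 h.2) fun h' => hz ⟨w, hw, h'.symm⟩⟩
    · refine ⟨s, h1, fun x hx => ⟨?_, (h2 x hx).2⟩, h3⟩
      have e1 := hap x
      have e2 := (h2 x hx).1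
      by_cases hx1 : x = (p, i)
      · subst hx1
        have : A (p, i) ≠ 1 := fun h => hs ⟨hx, h⟩
        simp only [if_true, Prod.mk.injEq, hne.symm, and_false, if_false] at e1
        omega
      · rw [if_neg hx1] at e1
        split_ifs at e1 <;> omega

/-- A chain has at most one element in each column. -/
lemma HasChain.of_succ {A : Mat} {r c m : ℕ} (h : HasChain A r c (m + 1)) :
    HasChain A r (c + 1) m := by
  classical
  obtain ⟨s, h1, h2, h3⟩ := h
  have hcard : (s.filter fun x => ¬ c + 1 < (x.2 : ℕ)).card ≤ 1 := by
    rw [Finset.card_le_one]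
    intro x hx y hy
    rw [Finset.mem_filter] at hx hy
    by_contra hxy
    have e1 := (h2 x hx.1).2.2
    have e2 := (h2 y hy.1).2.2
    rcases h3 x hx.1 y hy.1 hxy with h | h
    · have := PNat.coe_lt_coe _ _ |>.2 h.2
      omega
    · have := PNat.coe_lt_coe _ _ |>.2 h.2
      omega
  have := Finset.card_filter_add_card_filter_not (s := s) fun x => c + 1 < (x.2 : ℕ)
  refine ⟨s.filter fun x => c + 1 < (x.2 : ℕ), by omega, fun x hx => ?_, fun x hx y hy => ?_⟩
  · rw [Finset.mem_filter] at hx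
    exact ⟨(h2 x hx.1).1, (h2 x hx.1).2.1, hx.2⟩
  · rw [Finset.mem_filter] at hx hy
    exact h3 x hx.1 y hy.1

/-- If the chain meets column `i + 1` in row `k`, then `colHeight A i k ≤ 0` provides a unit of
column `i` above row `k`, which can be put in front of the chain. -/
lemma HasChain.of_colHeight_le {A : Mat} {i : ℕ+} (hA : ∀ k, colHeight A i k ≤ 0) {m : ℕ}
    (h : HasChain A 0 i m) : HasChain A 0 (i + 1) m ∨ HasChain A 0 (i - 1) (m + 1) := by
  classical
  obtain ⟨s, h1, h2, h3⟩ := h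
  by_cases hz : ∃ z ∈ s, z.2 = i + 1
  · right
    obtain ⟨⟨k, d⟩, hz, hd⟩ := hz
    simp only at hd
    subst hd
    have e1 := hA k
    rw [colHeight] at e1
    have e3 : (1 : ℤ) ≤ ∑ x ∈ Finset.Iic k, (A (x, i + 1) : ℤ) := by
      have h4 := (h2 _ hz).1
      have := Finset.single_le_sum (s := Finset.Iic k) (f := fun x => (A (x, i + 1) : ℤ))
        (fun _ _ => by positivity) (Finset.mem_Iic.2 le_rfl)
      omega
    have e4 : ∑ x ∈ Finset.Iio k, (A (x, i) : ℤ) ≠ 0 := by omega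
    obtain ⟨x, hx, hx0⟩ := Finset.exists_ne_zero_of_sum_ne_zero e4
    rw [Finset.mem_Iio] at hx
    have hle : ∀ w ∈ s, x < w.1 ∧ i < w.2 := by
      intro w hw
      have h4 := PNat.coe_lt_coe _ _ |>.1 (h2 w hw).2.2
      refine ⟨?_, h4⟩
      by_cases hwz : w = (k, i + 1)
      · rw [hwz]; exact hx
      · rcases h3 w hw _ hz hwz with h' | h'
        · exact absurd (PNat.lt_add_one_iff.1 h'.2) h4.not_ge
        · exact hx.trans h'.1
    have hns : (x, i) ∉ s := fun h => lt_irrefl _ (hle _ h).1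
    refine ⟨insert (x, i) s, ?_, ?_, ?_⟩
    · rw [Finset.card_insert_of_notMem hns]
      omega
    · intro z hz
      rcases Finset.mem_insert.1 hz with rfl | hz
      · have := i.pos
        exact ⟨by exact_mod_cast hx0, x.pos, by simp⟩
      · have := h2 z hz
        exact ⟨this.1, this.2.1, by omega⟩
    · intro z hz w hw hzw
      rcases Finset.mem_insert.1 hz with rfl | hz <;> rcases Finset.mem_insert.1 hw with rfl | hw
      · exact absurd rfl hzw
      · exact Or.inl (hle w hw)
      · exact Or.inr (hle z hz)
      · exact h3 z hz w hw hzw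
  · left
    refine ⟨s, h1, fun x hx => ⟨(h2 x hx).1, (h2 x hx).2.1, ?_⟩, h3⟩
    have e1 := (h2 x hx).2.2
    have e2 : (x.2 : ℕ) ≠ i + 1 := fun h => hz ⟨x, hx, PNat.coe_injective (by simpa using h)⟩
    omega

/-- An element of a chain in column `1` and one in row `1` are both minimal, hence equal, hence at
`(1, 1)`. -/
lemma HasChain.of_one_one {A : Mat} (hA : A (1, 1) = 0) {m : ℕ} (h : HasChain A 0 0 m) :
    HasChain A 0 1 m ∨ HasChain A 1 0 m := by
  obtain ⟨s, h1, h2, h3⟩ := h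
  have hone : ∀ k : ℕ+, k ≠ 1 → 1 < (k : ℕ) := fun k hk =>
    PNat.coe_lt_coe 1 k |>.2 (lt_of_le_of_ne one_le hk.symm)
  by_cases hy : ∃ y ∈ s, y.2 = 1
  · right
    refine ⟨s, h1, fun x hx => ⟨(h2 x hx).1, hone _ fun hx1 => ?_, (h2 x hx).2.2⟩, h3⟩
    obtain ⟨y, hy, hy1⟩ := hy
    by_cases hxy : x = y
    · subst hxy
      have : x = (1, 1) := Prod.ext hx1 hy1
      exact (h2 x hx).1 (this ▸ hA)
    · rcases h3 x hx y hy hxy with h | h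
      · exact absurd h.2 (by rw [hy1]; exact one_le.not_gt)
      · exact absurd h.1 (by rw [hx1]; exact one_le.not_gt)
  · left
    exact ⟨s, h1, fun x hx => ⟨(h2 x hx).1, (h2 x hx).2.1, hone _ fun h => hy ⟨x, hx, h⟩⟩, h3⟩

/-! ### Ladders -/

/-- The number of elements of `a` greater than `k`. -/
def numGT (a : Finset ℕ+) (k : ℕ) : ℕ := (a.filter fun x : ℕ+ => k < (x : ℕ)).card

/-- The matrices whose chains are bounded by the flags `a` and `b`. -/
def ladder (a b : Finset ℕ+) : Set Mat :=
  {A | ∀ k m, (HasChain A 0 k m → m ≤ numGT a k) ∧ (HasChain A k 0 m → m ≤ numGT b k)}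

lemma transpose_mem_ladder_iff {A : Mat} {a b : Finset ℕ+} :
    transpose A ∈ ladder a b ↔ A ∈ ladder b a := by
  have key : ∀ (A : Mat) (a b : Finset ℕ+), A ∈ ladder b a → transpose A ∈ ladder a b :=
    fun A a b h k m => ⟨fun hc => (h k m).2 (by simpa using hc.transpose),
      fun hc => (h k m).1 (by simpa using hc.transpose)⟩
  exact ⟨fun h => by simpa using key _ _ _ h, key _ _ _⟩

lemma numGT_succ (a : Finset ℕ+) (i : ℕ+) :
    numGT a (i - 1) = numGT a i + if i ∈ a then 1 else 0 := by
  classical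
  have e : (a.filter fun x : ℕ+ => (i : ℕ) - 1 < (x : ℕ)) =
      (a.filter fun x : ℕ+ => (i : ℕ) < (x : ℕ)) ∪ a.filter (· = i) := by
    ext x
    have := i.pos
    have h : x = i ↔ (x : ℕ) = i := PNat.coe_inj.symm
    simp only [Finset.mem_filter, Finset.mem_union, h, ← and_or_left]
    apply and_congr_right
    intro _
    omega
  rw [numGT, e, Finset.card_union_of_disjoint, Finset.filter_eq']
  · split_ifs <;> simp [numGT]
  · rw [Finset.disjoint_filter]
    rintro x - h rfl
    exact lt_irrefl _ h

lemma numGT_succ' (a : Finset ℕ+) (i : ℕ+) :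
    numGT a i = numGT a (i + 1) + if i + 1 ∈ a then 1 else 0 := by
  simpa using numGT_succ a (i + 1)

/-- Replace `i` by `i + 1`. -/
def bumpSet (a : Finset ℕ+) (i : ℕ+) : Finset ℕ+ := insert (i + 1) (a.erase i)

lemma mem_bumpSet {a : Finset ℕ+} {i j : ℕ+} :
    j ∈ bumpSet a i ↔ j = i + 1 ∨ (j ≠ i ∧ j ∈ a) := by
  simp [bumpSet]

lemma numGT_bumpSet {a : Finset ℕ+} {i : ℕ+} (h1 : i ∈ a) (h2 : i + 1 ∉ a) (k : ℕ) :
    numGT (bumpSet a i) k = numGT a k + if k = i then 1 else 0 := by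
  classical
  have hne := pnat_succ_ne i
  rw [numGT, bumpSet, Finset.filter_insert, Finset.filter_erase, numGT]
  have h2' : i + 1 ∉ (a.filter fun x : ℕ+ => k < (x : ℕ)).erase i := by simp [h2]
  have e : k < ((i + 1 : ℕ+) : ℕ) ↔ k ≤ i := by
    simp only [PNat.add_coe, PNat.one_coe]; omega
  by_cases hk : k < (i : ℕ)
  · have hm : i ∈ a.filter fun x : ℕ+ => k < (x : ℕ) := by simp [h1, hk]
    have := Finset.card_pos.2 ⟨i, hm⟩
    rw [if_pos (e.2 hk.le), Finset.card_insert_of_notMem h2', Finset.card_erase_of_mem hm,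
      if_neg hk.ne]
    omega
  · have hm : i ∉ a.filter fun x : ℕ+ => k < (x : ℕ) := by simp [hk]
    rw [Finset.erase_eq_of_notMem hm] at h2' ⊢
    by_cases hk2 : k = i
    · rw [if_pos (e.2 hk2.le), Finset.card_insert_of_notMem h2', if_pos hk2]
    · rw [if_neg (fun h => hk (lt_of_le_of_ne (e.1 h) hk2)), if_neg hk2, add_zero]

lemma card_bumpSet {a : Finset ℕ+} {i : ℕ+} (h1 : i ∈ a) (h2 : i + 1 ∉ a) :
    (bumpSet a i).card = a.card := by
  rw [bumpSet, Finset.card_insert_of_notMem (by simp [h2]), Finset.card_erase_of_mem h1]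
  have := Finset.card_pos.2 ⟨i, h1⟩
  omega

/-- The bound at `i` follows from the bound at `i + 1`: passing to the next column costs a chain at
most one element, which `i + 1 ∈ a` allows. So the only threshold sensitive to `f̃_i` may be
ignored. -/
lemma mem_ladder_iff_of_ne {A : Mat} {a b : Finset ℕ+} {i : ℕ+} (h2 : i + 1 ∈ a) :
    A ∈ ladder a b ↔ (∀ k m : ℕ, k ≠ i → HasChain A 0 k m → m ≤ numGT a k) ∧
      ∀ k m : ℕ, HasChain A k 0 m → m ≤ numGT b k := by
  constructor
  · exact fun h => ⟨fun k m _ => (h k m).1, fun k m => (h k m).2⟩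
  · intro h k m
    refine ⟨fun hc => ?_, h.2 k m⟩
    by_cases hk : k = i
    · subst hk
      cases m with
      | zero => exact Nat.zero_le _
      | succ m =>
        have := h.1 _ m (by omega) hc.of_succ
        rw [numGT_succ', if_pos h2]
        omega
    · exact h.1 k m hk hc

lemma mem_ladder_iff_of_crystalF {A B : Mat} {a b : Finset ℕ+} {i : ℕ+} (h2 : i + 1 ∈ a)
    (h : crystalF (i : ℤ) A = some B) : B ∈ ladder a b ↔ A ∈ ladder a b := by
  obtain ⟨p, hp, rfl⟩ := crystalF_eq_some_iff.1 h
  rw [mem_ladder_iff_of_ne h2, mem_ladder_iff_of_ne h2]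
  refine and_congr ?_ ?_
  · refine forall₂_congr fun k m => forall_congr' fun hk => ?_
    rw [hasChain_moveRight_iff hp hk]
  · refine forall₂_congr fun k m => ?_
    rw [hasChain_moveRight_iff hp i.pos.ne]

lemma mem_ladder_iff_of_crystalF_neg {A B : Mat} {a b : Finset ℕ+} {i : ℕ+} (h2 : i + 1 ∈ b)
    (h : crystalF (-(i : ℤ)) A = some B) : B ∈ ladder a b ↔ A ∈ ladder a b := by
  have : crystalF (i : ℤ) (transpose A) = some (transpose B) := by rw [crystalF_transpose, h]; rfl
  rw [← transpose_mem_ladder_iff, mem_ladder_iff_of_crystalF h2 this, transpose_mem_ladder_iff]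

lemma ladder_subset {a b a' b' : Finset ℕ+} (h : ∀ k, numGT a k ≤ numGT a' k)
    (h' : ∀ k, numGT b k ≤ numGT b' k) : ladder a b ⊆ ladder a' b' :=
  fun _ hA k m => ⟨fun hc => ((hA k m).1 hc).trans (h k), fun hc => ((hA k m).2 hc).trans (h' k)⟩

/-- The two flags differ at the threshold `i` only. There `HasChain.of_colHeight_le` passes to the
threshold `i + 1`, or to `i - 1` with one more element; since `i ∈ a` and `i + 1 ∉ a`, either bound
gives the sharper one. -/
lemma mem_ladder_of_colHeight_le {A : Mat} {a b : Finset ℕ+} {i : ℕ+} (h1 : i ∈ a) (h2 : i + 1 ∉ a)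
    (hA : A ∈ ladder (bumpSet a i) b) (hH : ∀ k, colHeight A i k ≤ 0) : A ∈ ladder a b := by
  intro k m
  refine ⟨fun hc => ?_, (hA k m).2⟩
  by_cases hk : k = i
  · subst hk
    have e1 := numGT_succ a i
    have e2 := numGT_succ' a i
    rw [if_pos h1] at e1
    rw [if_neg h2] at e2
    have := i.pos
    rcases hc.of_colHeight_le hH with hc | hc
    · have := (hA _ _).1 hc
      rw [numGT_bumpSet h1 h2, if_neg (by omega)] at this
      omega
    · have := (hA _ _).1 hc
      rw [numGT_bumpSet h1 h2, if_neg (by omega)] at this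
      omega
  · have := (hA _ _).1 hc
    rwa [numGT_bumpSet h1 h2, if_neg hk] at this

/-- Only the threshold `0` matters. There a chain avoids row `1` or column `1`, so it obeys one of
the two bounds at `1`; equal cardinalities let either bound serve for both flags. -/
lemma mem_ladder_of_one_one {A : Mat} {a b : Finset ℕ+} (ha : 1 ∉ a) (hb : 1 ∉ b)
    (hab : a.card = b.card) (hA : A ∈ ladder (insert 1 a) (insert 1 b)) (h0 : A (1, 1) = 0) :
    A ∈ ladder a b := by
  have key : ∀ c : Finset ℕ+, ∀ k : ℕ, k ≠ 0 → numGT (insert 1 c) k = numGT c k := by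
    intro c k hk
    rw [numGT, Finset.filter_insert, if_neg (by simpa using hk), numGT]
  have key2 : ∀ c : Finset ℕ+, 1 ∉ c → numGT c 0 = c.card ∧ numGT c 1 = c.card := by
    intro c hc
    have := numGT_succ c 1
    rw [if_neg hc] at this
    have h : numGT c 0 = c.card := by simp [numGT]
    simp at this
    omega
  have key3 : ∀ m, HasChain A 0 0 m → m ≤ a.card := by
    intro m hc
    rcases hc.of_one_one h0 with hc | hc
    · have := (hA _ _).1 hc
      rw [key a 1 one_ne_zero] at this
      have := key2 a ha
      omega
    · have := (hA _ _).2 hc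
      rw [key b 1 one_ne_zero] at this
      have := key2 b hb
      omega
  intro k m
  by_cases hk : k = 0
  · subst hk
    rw [(key2 a ha).1, (key2 b hb).1, ← hab]
    exact ⟨key3 m, key3 m⟩
  · rw [← key a k hk, ← key b k hk]
    exact hA k m

lemma numGT_insert_le (a : Finset ℕ+) (x : ℕ+) (k : ℕ) : numGT a k ≤ numGT (insert x a) k :=
  Finset.card_le_card (Finset.filter_subset_filter _ (Finset.subset_insert _ _))

lemma HasChain.of_succ_row {A : Mat} {r c m : ℕ} (h : HasChain A r c (m + 1)) :
    HasChain A (r + 1) c m := by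
  simpa using h.transpose.of_succ.transpose

/-- The position `(1, 1)` is seen by the threshold `0` only, whose bound follows from the one at `1`
because `1` lies in both flags. -/
lemma mem_ladder_of_add {A B : Mat} {a b : Finset ℕ+} (ha : 1 ∈ a) (hb : 1 ∈ b)
    (h : ∀ x, x ≠ (1, 1) → (A x ≠ 0 → B x ≠ 0)) (hB : B ∈ ladder a b) : A ∈ ladder a b := by
  have h1 : ∀ k m, k ≠ 0 → HasChain A 0 k m → HasChain B 0 k m := fun k m hk hc =>
    hc.congr fun x _ h2 h3 => h x (by rintro rfl; simp at h2; omega) h3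
  have h1' : ∀ k m, k ≠ 0 → HasChain A k 0 m → HasChain B k 0 m := fun k m hk hc =>
    hc.congr fun x h2 _ h3 => h x (by rintro rfl; simp at h2; omega) h3
  intro k m
  by_cases hk : k = 0
  · subst hk
    cases m with
    | zero => simp
    | succ m =>
      refine ⟨fun hc => ?_, fun hc => ?_⟩
      · have e1 := (hB _ _).1 (h1 _ _ one_ne_zero hc.of_succ)
        have e2 := numGT_succ a 1
        rw [if_pos ha] at e2
        simp at e2
        omega
      · have e1 := (hB _ _).2 (h1' _ _ one_ne_zero hc.of_succ_row)
        have e2 := numGT_succ b 1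
        rw [if_pos hb] at e2
        simp at e2
        omega
  · exact ⟨fun hc => (hB k m).1 (h1 k m hk hc), fun hc => (hB k m).2 (h1' k m hk hc)⟩

lemma ladder_empty : ladder ∅ ∅ = {0} := by
  ext A
  rw [Set.mem_singleton_iff]
  constructor
  · intro h
    ext x
    by_contra hx
    have : HasChain A 0 0 1 := by
      refine ⟨{x}, by simp, ?_, ?_⟩
      · intro y hy
        rw [Finset.mem_singleton] at hy
        subst hy
        exact ⟨by simpa using hx, y.1.pos, y.2.pos⟩
      · intro y hy z hz hyz
        rw [Finset.mem_singleton] at hy hz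
        exact absurd (hy.trans hz.symm) hyz
    have := (h 0 1).1 this
    simp [numGT] at this
  · rintro rfl k m
    have : ∀ r c, HasChain 0 r c m → m = 0 := by
      rintro r c ⟨s, h1, h2, -⟩
      have : s = ∅ := Finset.eq_empty_of_forall_notMem fun x hx => (h2 x hx).1 rfl
      simpa [this] using h1
    exact ⟨fun h => (this _ _ h).le.trans (Nat.zero_le _),
      fun h => (this _ _ h).le.trans (Nat.zero_le _)⟩

/-! ### Demazure crystals of ladders -/

lemma opPow_succ {B : Type} (g : B → Option B) (m : ℕ) (b : B) :
    opPow g (m + 1) b = (opPow g m b).bind g := by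
  rw [opPow, Function.iterate_succ_apply']
  rfl

/-- The measure `μ` makes the descent along raising steps terminate: every element of `G'` is raised
inside `G'` until it lands in `G`. -/
lemma demazure_step {B : Type} {f : B → Option B} {G G' : Set B} (μ : B → ℕ) (h₁ : G ⊆ G')
    (h₂ : ∀ A ∈ G', ∀ B, f A = some B → B ∈ G')
    (h₃ : ∀ A ∈ G', A ∈ G ∨ ∃ B ∈ G', f B = some A ∧ μ B < μ A) :
    {b' | ∃ c ∈ G, ∃ m : ℕ, opPow f m c = some b'} = G' := by
  ext A
  constructor
  · rintro ⟨C, hC, m, hm⟩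
    induction m generalizing A with
    | zero =>
      obtain rfl : C = A := by simpa [opPow] using hm
      exact h₁ hC
    | succ m ih =>
      rw [opPow_succ, Option.bind_eq_some_iff] at hm
      obtain ⟨D, hD, hA⟩ := hm
      exact h₂ D (ih D hD) A hA
  · intro hA
    induction hn : μ A using Nat.strong_induction_on generalizing A with
    | _ n ih =>
      rcases h₃ A hA with h | ⟨B, hB, hBA, hlt⟩
      · exact ⟨A, h, 0, rfl⟩
      · obtain ⟨C, hC, m, hm⟩ := ih _ (hn ▸ hlt) B hB rfl
        exact ⟨C, hC, m + 1, by rw [opPow_succ, hm]; exact hBA⟩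

/-- The sum of all row and column indices of the units of a matrix. -/
def weightSum (A : Mat) : ℕ := A.sum fun x n => n * ((x.1 : ℕ) + (x.2 : ℕ))

lemma weightSum_add (A B : Mat) : weightSum (A + B) = weightSum A + weightSum B :=
  Finsupp.sum_add_index' (by simp) (by intros; ring)

lemma weightSum_single (x : ℕ+ × ℕ+) (n : ℕ) :
    weightSum (Finsupp.single x n) = n * ((x.1 : ℕ) + (x.2 : ℕ)) :=
  Finsupp.sum_single_index (by simp)

lemma weightSum_transpose (A : Mat) : weightSum (transpose A) = weightSum A := by
  induction A using Finsupp.induction_linear with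
  | zero => simp [weightSum, transpose]
  | add f g hf hg =>
    have : transpose (f + g) = transpose f + transpose g := by ext ⟨x, y⟩; simp
    rw [this, weightSum_add, weightSum_add, hf, hg]
  | single a n =>
    have : transpose (Finsupp.single a n) = Finsupp.single a.swap n := by
      simp [transpose]
    rw [this, weightSum_single, weightSum_single]
    simp [add_comm]

lemma weightSum_crystalF {A B : Mat} {i : ℕ+} (h : crystalF (i : ℤ) A = some B) :
    weightSum B = weightSum A + 1 := by
  obtain ⟨p, hp, rfl⟩ := crystalF_eq_some_iff.1 h
  have h1 : A = (A - Finsupp.single (p, i) 1) + Finsupp.single (p, i) 1 := by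
    ext z
    have := hp.ne_zero
    simp only [Finsupp.add_apply, Finsupp.tsub_apply, Finsupp.single_apply]
    split_ifs with h
    · subst h; omega
    · omega
  have h2 := congrArg weightSum h1
  rw [weightSum_add, weightSum_single] at h2
  rw [moveRight, weightSum_add, weightSum_single]
  simp only [PNat.add_coe, PNat.one_coe] at *
  omega

lemma weightSum_crystalF_neg {A B : Mat} {i : ℕ+} (h : crystalF (-(i : ℤ)) A = some B) :
    weightSum B = weightSum A + 1 := by
  have : crystalF (i : ℤ) (transpose A) = some (transpose B) := by rw [crystalF_transpose, h]; rfl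
  simpa [weightSum_transpose] using weightSum_crystalF this

lemma crystalF_zero (A : Mat) : crystalF 0 A = some (A + Finsupp.single (1, 1) 1) := rfl

lemma ladder_subset_bumpSet {a b : Finset ℕ+} {i : ℕ+} (h1 : i ∈ a) (h2 : i + 1 ∉ a) :
    ladder a b ⊆ ladder (bumpSet a i) b :=
  ladder_subset (fun k => by rw [numGT_bumpSet h1 h2]; omega) fun _ => le_rfl

/-- `ladder (bumpSet a i) b` is stable under raising and lowering since it contains `i + 1` in its
flag, and its elements with no raising lie in the smaller ladder. -/
lemma demazure_step_pos {a b : Finset ℕ+} {i : ℕ+} (h1 : i ∈ a) (h2 : i + 1 ∉ a) :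
    {A | ∃ C ∈ ladder a b, ∃ m : ℕ, opPow (crystalF (i : ℤ)) m C = some A} =
      ladder (bumpSet a i) b := by
  have h3 : i + 1 ∈ bumpSet a i := mem_bumpSet.2 (Or.inl rfl)
  refine demazure_step weightSum (ladder_subset_bumpSet h1 h2)
    (fun A hA B hAB => (mem_ladder_iff_of_crystalF h3 hAB).2 hA) fun A hA => ?_
  by_cases hH : ∀ k, colHeight A i k ≤ 0
  · exact Or.inl (mem_ladder_of_colHeight_le h1 h2 hA hH)
  · push Not at hH
    obtain ⟨k, hk⟩ := hH
    obtain ⟨B, hB⟩ := exists_crystalF_eq hk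
    exact Or.inr ⟨B, (mem_ladder_iff_of_crystalF h3 hB).1 hA, hB,
      by rw [weightSum_crystalF hB]; exact Nat.lt_succ_self _⟩

lemma opPow_crystalF_transpose (i : ℕ+) (m : ℕ) (A : Mat) :
    opPow (crystalF (i : ℤ)) m (transpose A) =
      (opPow (crystalF (-(i : ℤ))) m A).map transpose := by
  induction m with
  | zero => rfl
  | succ m ih =>
    rw [opPow_succ, opPow_succ, ih]
    cases opPow (crystalF (-(i : ℤ))) m A with
    | none => rfl
    | some B => exact crystalF_transpose i B

lemma demazure_step_neg {a b : Finset ℕ+} {i : ℕ+} (h1 : i ∈ b) (h2 : i + 1 ∉ b) :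
    {A | ∃ C ∈ ladder a b, ∃ m : ℕ, opPow (crystalF (-(i : ℤ))) m C = some A} =
      ladder a (bumpSet b i) := by
  ext A
  rw [← transpose_mem_ladder_iff, ← demazure_step_pos h1 h2]
  constructor
  · rintro ⟨C, hC, m, hm⟩
    exact ⟨transpose C, transpose_mem_ladder_iff.2 hC, m, by
      rw [opPow_crystalF_transpose, hm]; rfl⟩
  · rintro ⟨C, hC, m, hm⟩
    refine ⟨transpose C, transpose_mem_ladder_iff.2 hC, m, ?_⟩
    rw [← transpose_transpose C, opPow_crystalF_transpose, Option.map_eq_some_iff] at hm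
    obtain ⟨D, hD, hA⟩ := hm
    rw [hD, ← transpose_transpose D, hA, transpose_transpose]

lemma add_single_mem_ladder_iff {A : Mat} {a b : Finset ℕ+} (ha : 1 ∈ a) (hb : 1 ∈ b) (n : ℕ) :
    A + Finsupp.single (1, 1) n ∈ ladder a b ↔ A ∈ ladder a b := by
  have h : ∀ x : ℕ+ × ℕ+, x ≠ (1, 1) → (A + Finsupp.single (1, 1) n : Mat) x = A x := by
    intro x hx
    simp [Finsupp.single_apply, hx.symm]
  exact ⟨mem_ladder_of_add ha hb fun x hx h0 => by rwa [h x hx],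
    mem_ladder_of_add ha hb fun x hx h0 => by rwa [← h x hx]⟩

lemma demazure_step_zero {a b : Finset ℕ+} (h1 : 1 ∉ a) (h2 : 1 ∉ b) (hab : a.card = b.card) :
    {A | ∃ C ∈ ladder a b, ∃ m : ℕ, opPow (crystalF 0) m C = some A} =
      ladder (insert 1 a) (insert 1 b) := by
  have h3 : 1 ∈ insert 1 a := Finset.mem_insert_self _ _
  have h4 : 1 ∈ insert 1 b := Finset.mem_insert_self _ _
  refine demazure_step weightSum (ladder_subset (numGT_insert_le a 1) (numGT_insert_le b 1))
    (fun A hA B hAB => ?_) fun A hA => ?_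
  · rw [crystalF_zero, Option.some.injEq] at hAB
    rw [← hAB]
    exact (add_single_mem_ladder_iff h3 h4 1).2 hA
  · by_cases h0 : A (1, 1) = 0
    · exact Or.inl (mem_ladder_of_one_one h1 h2 hab hA h0)
    · right
      have e : A - Finsupp.single (1, 1) 1 + Finsupp.single (1, 1) 1 = A := by
        ext z
        simp only [Finsupp.add_apply, Finsupp.tsub_apply, Finsupp.single_apply]
        split_ifs with h
        · subst h; omega
        · omega
      refine ⟨A - Finsupp.single (1, 1) 1, ?_, by rw [crystalF_zero, e], ?_⟩
      · rw [← add_single_mem_ladder_iff h3 h4 1, e]; exact hA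
      · conv_rhs => rw [← e, weightSum_add, weightSum_single]
        simp

/-! ### Symmetric matrices -/

lemma mem_symMat_iff {ε : ℕ} {A : Mat} :
    A ∈ symMat ε ↔ transpose A = A ∧ ∀ i, ε ∣ A (i, i) := by
  refine and_congr_left fun _ => ⟨fun h => ?_, fun h i j => ?_⟩
  · ext ⟨i, j⟩
    rw [transpose_apply, h]
  · conv_rhs => rw [← h]
    simp

lemma foldedF_coe (ε : ℕ) (i : ℕ+) (A : Mat) :
    foldedF ε (i : ℕ) A = (crystalF (-(i : ℤ)) A).bind (crystalF (i : ℤ)) := by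
  obtain ⟨n, rfl⟩ : ∃ n : ℕ, i = n.succPNat := ⟨i.natPred, by simp⟩
  rfl

lemma foldedF_zero (ε : ℕ) (A : Mat) : foldedF ε 0 A = some (A + Finsupp.single (1, 1) ε) := by
  change opPow (crystalF 0) ε A = _
  induction ε with
  | zero => simp [opPow]
  | succ n ih =>
    rw [opPow_succ, ih]
    simp [crystalF_zero, add_assoc, ← Finsupp.single_add]

lemma foldedF_eq_some_iff {ε : ℕ} {i : ℕ+} {A B : Mat} : foldedF ε (i : ℕ) A = some B ↔
    ∃ C, crystalF (-(i : ℤ)) A = some C ∧ crystalF (i : ℤ) C = some B := by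
  rw [foldedF_coe, Option.bind_eq_some_iff]

/-- Generically `f̃_i f̃_{-i}` makes two mirror moves, which change a diagonal entry by `0` or `±2`.
In the exceptional case one unit goes from `(i, i)` to `(i + 1, i + 1)`. -/
lemma diag_of_foldedF {ε : ℕ} {i : ℕ+} {A B : Mat} (hA : transpose A = A)
    (h : foldedF ε (i : ℕ) A = some B) :
    (∀ j, B (j, j) = A (j, j) ∨ B (j, j) + 2 = A (j, j) ∨ B (j, j) = A (j, j) + 2) ∨
      (A (i + 1, i + 1) + 1 = A (i, i) ∧ B (i, i) + 1 = B (i + 1, i + 1)) := by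
  obtain ⟨C, hC, hB⟩ := foldedF_eq_some_iff.1 h
  obtain ⟨p, hp, rfl⟩ := crystalF_neg_eq_some_iff.1 hC
  have hp' : IsLastMax A i p := hA ▸ hp
  have hne := pnat_succ_ne i
  have f1 := moveDown_apply hp.ne_zero'
  by_cases hn : p = i ∧ p = i ∧ A (i + 1, i + 1) + 1 = A (i, i)
  · right
    obtain ⟨rfl, -, hn⟩ := hn
    have e1 := IsLastMax.moveDown_succ hp hp' hn
    rw [crystalF_eq_some_iff.2 ⟨_, e1, rfl⟩, Option.some.injEq] at hB
    have f2 := moveRight_apply e1.ne_zero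
    rw [hB] at f2
    refine ⟨hn, ?_⟩
    have g1 := f1 (p, p)
    have g2 := f1 (p + 1, p + 1)
    have g3 := f2 (p, p)
    have g4 := f2 (p + 1, p + 1)
    simp only [Prod.mk.injEq, hne, hne.symm, and_false, and_true, false_and, and_self, if_true,
      if_false] at g1 g2 g3 g4
    omega
  · left
    have e1 := IsLastMax.moveDown hp hp' hn
    rw [crystalF_eq_some_iff.2 ⟨_, e1, rfl⟩, Option.some.injEq] at hB
    have f2 := moveRight_apply e1.ne_zero
    rw [hB] at f2
    intro j
    have g1 := f1 (j, j)
    have g3 := f2 (j, j)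
    by_cases e2 : j = i
    · subst e2
      simp only [Prod.mk.injEq, hne, hne.symm, and_false, and_true, false_and, true_and, and_self,
        if_true, if_false] at g1 g3
      have : (j = p) = (p = j) := propext eq_comm
      simp only [this] at g1 g3
      split_ifs at g1 g3 <;> omega
    · by_cases e3 : j = i + 1
      · simp only [Prod.mk.injEq, e2, e3, hne, hne.symm, and_false, and_true, false_and, true_and,
          and_self, if_true, if_false] at g1 g3 ⊢
        split_ifs at g1 g3 <;> omega
      · simp only [Prod.mk.injEq, e2, e3, false_and, and_false, if_false] at g1 g3
        omega

/-- In the exceptional case two diagonal entries of `A`, and likewise of `B`, differ by one; so for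
`ε = 2` neither diagonal is divisible. -/
lemma dvd_diag_of_foldedF {ε : ℕ} (hε : ε = 1 ∨ ε = 2) {i : ℕ+} {A B : Mat} (hA : transpose A = A)
    (h : foldedF ε (i : ℕ) A = some B) : (∀ j, ε ∣ A (j, j)) ↔ ∀ j, ε ∣ B (j, j) := by
  rcases hε with rfl | rfl
  · simp
  · rcases diag_of_foldedF hA h with h | ⟨h1, h2⟩
    · refine forall_congr' fun j => ?_
      have := h j
      omega
    · constructor
      · intro h
        have := h i
        have := h (i + 1)
        omega
      · intro h
        have := h i
        have := h (i + 1)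
        omega

lemma crystalF_of_crystalF_neg_symm {i : ℕ+} {A B : Mat} (hA : transpose A = A)
    (h : crystalF (-(i : ℤ)) A = some B) : crystalF (i : ℤ) A = some (transpose B) := by
  conv_lhs => rw [← hA]
  rw [crystalF_transpose, h]
  rfl

/-- Transposition turns `f̃_i f̃_{-i} A` into `f̃_{-i} f̃_i A`, which is the same matrix by
commutation. -/
lemma transpose_of_foldedF {ε : ℕ} {i : ℕ+} {A B : Mat} (hA : transpose A = A)
    (h : foldedF ε (i : ℕ) A = some B) : transpose B = B := by
  obtain ⟨C, hC, hB⟩ := foldedF_eq_some_iff.1 h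
  obtain ⟨D, h1, h2⟩ := crystalF_commute hC (crystalF_of_crystalF_neg_symm hA hC)
  have h3 : crystalF (i : ℤ) C = some (transpose D) := by
    rw [← transpose_transpose C, crystalF_transpose, h2]
    rfl
  rw [hB, Option.some.injEq] at h1 h3
  rw [← h1] at h3
  exact h3.symm

lemma foldedF_mem_symMat {ε : ℕ} (hε : ε = 1 ∨ ε = 2) {i : ℕ+} {A B : Mat} (hA : A ∈ symMat ε)
    (h : foldedF ε (i : ℕ) A = some B) : B ∈ symMat ε := by
  rw [mem_symMat_iff] at hA ⊢
  exact ⟨transpose_of_foldedF hA.1 h, (dvd_diag_of_foldedF hε hA.1 h).1 hA.2⟩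

/-- Raise `A` with `ẽ_i` and the result with `ẽ_{-i}`, which is possible since `f̃_i` does not
change `ε_{-i}`. Symmetry of the outcome comes from injectivity of the operators. -/
lemma exists_foldedF_eq {ε : ℕ} (hε : ε = 1 ∨ ε = 2) {i k : ℕ+} {A : Mat} (hA : A ∈ symMat ε)
    (h : 0 < colHeight A i k) : ∃ C ∈ symMat ε, foldedF ε (i : ℕ) C = some A := by
  rw [mem_symMat_iff] at hA
  obtain ⟨B, hB⟩ := exists_crystalF_eq h
  have hB' : crystalF (-(i : ℤ)) (transpose B) = some A := by
    rw [crystalF_neg_transpose, hB]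
    exact congrArg some hA.1
  obtain ⟨l, hl⟩ : ∃ l, 0 < colHeight (transpose B) i l := by
    by_contra hcon
    push Not at hcon
    exact absurd ((colHeight_le_iff_of_crystalF_neg hB' 0).2 hcon k) h.not_ge
  obtain ⟨C', hC'⟩ := exists_crystalF_eq hl
  have hC : crystalF (-(i : ℤ)) (transpose C') = some B := by
    rw [crystalF_neg_transpose, hC']
    simp
  obtain ⟨D, hD⟩ := exists_crystalF_of_crystalF_neg hC hB
  obtain ⟨A', h1, h2⟩ := crystalF_commute hC hD
  rw [hB, Option.some.injEq] at h1
  -- Both matrices are mapped to the symmetric matrix `A` by `f̃_i`.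
  have h3 : transpose D = B := by
    apply crystalF_injective (i := i) _ hB
    rw [crystalF_transpose, h2, ← h1]
    exact congrArg some hA.1
  have h4 : transpose C' = C' := by
    apply crystalF_injective (i := i) _ hC'
    rw [hD, ← h3, transpose_transpose]
  rw [h4] at hC
  have hF : foldedF ε (i : ℕ) C' = some A := foldedF_eq_some_iff.2 ⟨B, hC, hB⟩
  exact ⟨C', mem_symMat_iff.2 ⟨h4, (dvd_diag_of_foldedF hε h4 hF).2 hA.2⟩, hF⟩

lemma weightSum_foldedF {ε : ℕ} {i : ℕ+} {A B : Mat} (h : foldedF ε (i : ℕ) A = some B) :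
    weightSum A < weightSum B := by
  obtain ⟨C, hC, hB⟩ := foldedF_eq_some_iff.1 h
  have := weightSum_crystalF_neg hC
  have := weightSum_crystalF hB
  omega

lemma foldedF_step_pos {ε : ℕ} (hε : ε = 1 ∨ ε = 2) {a : Finset ℕ+} {i : ℕ+} (h1 : i ∈ a)
    (h2 : i + 1 ∉ a) :
    {A | ∃ C ∈ symMat ε ∩ ladder a a, ∃ m : ℕ, opPow (foldedF ε (i : ℕ)) m C = some A} =
      symMat ε ∩ ladder (bumpSet a i) (bumpSet a i) := by
  have h3 : i + 1 ∈ bumpSet a i := mem_bumpSet.2 (Or.inl rfl)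
  have hle : ∀ k, numGT a k ≤ numGT (bumpSet a i) k := fun k => by
    rw [numGT_bumpSet h1 h2]; omega
  have key : ∀ {A B}, foldedF ε (i : ℕ) A = some B →
      (B ∈ ladder (bumpSet a i) (bumpSet a i) ↔ A ∈ ladder (bumpSet a i) (bumpSet a i)) := by
    intro A B h
    obtain ⟨C, hC, hB⟩ := foldedF_eq_some_iff.1 h
    rw [mem_ladder_iff_of_crystalF h3 hB, mem_ladder_iff_of_crystalF_neg h3 hC]
  refine demazure_step weightSum (Set.inter_subset_inter_right _ (ladder_subset hle hle))
    (fun A hA B hAB => ⟨foldedF_mem_symMat hε hA.1 hAB, (key hAB).2 hA.2⟩) fun A hA => ?_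
  by_cases hH : ∀ k, colHeight A i k ≤ 0
  · left
    -- By symmetry of `A` the same signature condition sharpens both flags, the second one after
    -- transposing.
    refine ⟨hA.1, mem_ladder_of_colHeight_le h1 h2 ?_ hH⟩
    have hs := (mem_symMat_iff.1 hA.1).1
    rw [← transpose_mem_ladder_iff, hs]
    refine mem_ladder_of_colHeight_le h1 h2 hA.2 hH
  · push Not at hH
    obtain ⟨k, hk⟩ := hH
    obtain ⟨B, hB, hBA⟩ := exists_foldedF_eq hε hA.1 hk
    exact Or.inr ⟨B, ⟨hB, (key hBA).1 hA.2⟩, hBA, weightSum_foldedF hBA⟩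

lemma add_single_mem_symMat_iff {ε : ℕ} {A : Mat} :
    A + Finsupp.single (1, 1) ε ∈ symMat ε ↔ A ∈ symMat ε := by
  refine and_congr ?_ ?_
  · refine forall₂_congr fun i j => ?_
    have : ((1 : ℕ+) = i ∧ (1 : ℕ+) = j) ↔ ((1 : ℕ+) = j ∧ (1 : ℕ+) = i) := and_comm
    simp only [Finsupp.add_apply, Finsupp.single_apply, Prod.mk.injEq, this, Nat.add_right_cancel_iff]
  · refine forall_congr' fun i => ?_
    simp only [Finsupp.add_apply, Finsupp.single_apply, Prod.mk.injEq]
    split_ifs <;> simp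

lemma foldedF_step_zero {ε : ℕ} (hε : ε = 1 ∨ ε = 2) {a : Finset ℕ+} (h1 : 1 ∉ a) :
    {A | ∃ C ∈ symMat ε ∩ ladder a a, ∃ m : ℕ, opPow (foldedF ε 0) m C = some A} =
      symMat ε ∩ ladder (insert 1 a) (insert 1 a) := by
  have h3 : 1 ∈ insert 1 a := Finset.mem_insert_self _ _
  refine demazure_step weightSum (Set.inter_subset_inter_right _
    (ladder_subset (numGT_insert_le a 1) (numGT_insert_le a 1))) (fun A hA B hAB => ?_)
    fun A hA => ?_
  · rw [foldedF_zero, Option.some.injEq] at hAB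
    rw [← hAB]
    exact ⟨add_single_mem_symMat_iff.2 hA.1, (add_single_mem_ladder_iff h3 h3 ε).2 hA.2⟩
  · by_cases h0 : A (1, 1) = 0
    · exact Or.inl ⟨hA.1, mem_ladder_of_one_one h1 h1 rfl hA.2 h0⟩
    · right
      have hd : ε ≤ A (1, 1) := Nat.le_of_dvd (Nat.pos_of_ne_zero h0) (hA.1.2 1)
      have e : A - Finsupp.single (1, 1) ε + Finsupp.single (1, 1) ε = A := by
        ext z
        simp only [Finsupp.add_apply, Finsupp.tsub_apply, Finsupp.single_apply]
        split_ifs with h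
        · subst h; omega
        · omega
      refine ⟨A - Finsupp.single (1, 1) ε, ⟨?_, ?_⟩, by rw [foldedF_zero, e], ?_⟩
      · rw [← add_single_mem_symMat_iff, e]; exact hA.1
      · rw [← add_single_mem_ladder_iff h3 h3 ε, e]; exact hA.2
      · conv_rhs => rw [← e, weightSum_add, weightSum_single]
        simp
        omega

/-! ### Reduced expressions -/

lemma exists_list_of_mem_closure {I G : Type} [Group G] {s : I → G} (hs : ∀ i, (s i)⁻¹ = s i)
    {g : G} (hg : g ∈ Subgroup.closure (Set.range s)) : ∃ l : List I, (l.map s).prod = g := by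
  induction hg using Subgroup.closure_induction with
  | mem x hx =>
    obtain ⟨i, rfl⟩ := hx
    exact ⟨[i], by simp⟩
  | one => exact ⟨[], rfl⟩
  | mul x y _ _ hx hy =>
    obtain ⟨l, rfl⟩ := hx
    obtain ⟨l', rfl⟩ := hy
    exact ⟨l ++ l', by simp⟩
  | inv x _ hx =>
    obtain ⟨l, rfl⟩ := hx
    exact ⟨l.reverse, by simp [List.prod_inv_reverse, hs, Function.comp_def]⟩

lemma inv_prod_map {I G : Type} [Group G] {s : I → G} (hs : ∀ i, (s i)⁻¹ = s i) (l : List I) :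
    ((l.map s).prod)⁻¹ = (l.reverse.map s).prod := by
  simp [List.prod_inv_reverse, hs, Function.comp_def]

lemma exists_isReducedExpr {I G : Type} [Group G] {s : I → G} {g : G}
    (h : ∃ l : List I, (l.map s).prod = g) : ∃ l, IsReducedExpr s l g ∧ l.length = len s g := by
  have hne : {n | ∃ l : List I, (l.map s).prod = g ∧ l.length = n}.Nonempty := by
    obtain ⟨l, hl⟩ := h
    exact ⟨_, l, hl, rfl⟩
  obtain ⟨l, hl, hlen⟩ := Nat.sInf_mem hne
  exact ⟨l, ⟨hl, fun l' hl' => hlen ▸ Nat.sInf_le ⟨l', hl', rfl⟩⟩, hlen⟩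

lemma IsReducedExpr.tail {I G : Type} [Group G] {s : I → G} {i : I} {l : List I} {g : G}
    (h : IsReducedExpr s (i :: l) g) : IsReducedExpr s l (l.map s).prod := by
  refine ⟨rfl, fun l' hl' => ?_⟩
  have := h.2 (i :: l') (by rw [← h.1, List.map_cons, List.map_cons, List.prod_cons,
    List.prod_cons, hl'])
  simpa using this

/-! ### Simple reflections -/

lemma lo_val (i : ℤ) : (lo i).1 = if 0 < i then i else i - 1 := rfl

lemma hi_val (i : ℤ) : (hi i).1 = if 0 ≤ i then i + 1 else i := rfl

lemma lo_lt_hi (i : ℤ) : lo i < hi i := by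
  rw [← Subtype.coe_lt_coe, lo_val, hi_val]
  split_ifs <;> omega

lemma le_lo_or_hi_le (i : ℤ) (x : Zx) : x ≤ lo i ∨ hi i ≤ x := by
  have := x.2
  rw [← Subtype.coe_le_coe, ← Subtype.coe_le_coe, lo_val, hi_val]
  split_ifs <;> omega

lemma simpleReflection_lo (i : ℤ) : simpleReflection i (lo i) = hi i := Equiv.swap_apply_left _ _

lemma simpleReflection_hi (i : ℤ) : simpleReflection i (hi i) = lo i := Equiv.swap_apply_right _ _

lemma simpleReflection_of_ne {i : ℤ} {x : Zx} (h1 : x ≠ lo i) (h2 : x ≠ hi i) :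
    simpleReflection i x = x := Equiv.swap_apply_of_ne_of_ne h1 h2

lemma simpleReflection_inv (i : ℤ) : (simpleReflection i)⁻¹ = simpleReflection i :=
  Equiv.swap_inv _ _

/-- No element of `ℤ^×` lies between `lo i` and `hi i`, so the transposition reverses this pair
only. -/
lemma simpleReflection_cross {i : ℤ} {x y : Zx} (h : x < y)
    (h' : simpleReflection i y < simpleReflection i x) : x = lo i ∧ y = hi i := by
  have e1 := le_lo_or_hi_le i x
  have e2 := le_lo_or_hi_le i y
  have e3 := lo_lt_hi i
  by_cases hx1 : x = lo i
  · subst hx1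
    refine ⟨rfl, ?_⟩
    by_contra hy
    rw [simpleReflection_lo, simpleReflection_of_ne h.ne' hy] at h'
    rcases e2 with e2 | e2
    · exact absurd h e2.not_gt
    · exact absurd h' e2.not_gt
  · by_cases hx2 : x = hi i
    · subst hx2
      rw [simpleReflection_hi, simpleReflection_of_ne (e3.trans h).ne' h.ne'] at h'
      exact absurd (e3.trans h) h'.not_gt
    · rw [simpleReflection_of_ne hx1 hx2] at h'
      by_cases hy1 : y = lo i
      · subst hy1
        rw [simpleReflection_lo] at h'
        exact absurd (h.trans e3) h'.not_gt
      · by_cases hy2 : y = hi i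
        · subst hy2
          rw [simpleReflection_hi] at h'
          rcases e1 with e1 | e1
          · exact absurd h' e1.not_gt
          · exact absurd h e1.not_gt
        · rw [simpleReflection_of_ne hy1 hy2] at h'
          exact absurd h h'.not_gt

/-- The exchange condition. Reading the word from the right, some letter `k` reverses the images of
`lo i` and `hi i`; at that place `s_k u = u s_i`, and the letter cancels against the new one. -/
lemma exchange {i : ℤ} (l : List ℤ)
    (h : (l.map simpleReflection).prod (hi i) < (l.map simpleReflection).prod (lo i)) :
    ∃ l' : List ℤ, (l'.map simpleReflection).prod =
      (l.map simpleReflection).prod * simpleReflection i ∧ l'.length + 1 = l.length := by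
  induction l with
  | nil => exact absurd h (lo_lt_hi i).not_gt
  | cons k l ih =>
    rw [List.map_cons, List.prod_cons] at h ⊢
    set u := (l.map simpleReflection).prod with hu
    by_cases h1 : u (hi i) < u (lo i)
    · obtain ⟨l', h2, h3⟩ := ih h1
      exact ⟨k :: l', by rw [List.map_cons, List.prod_cons, h2, mul_assoc], by simpa using h3⟩
    · have h1 : u (lo i) < u (hi i) :=
        lt_of_le_of_ne (not_lt.1 h1) fun h => (lo_lt_hi i).ne (u.injective h)
      obtain ⟨h2, h3⟩ := simpleReflection_cross h1 h
      refine ⟨l, ?_, rfl⟩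
      have : simpleReflection k = u * simpleReflection i * u⁻¹ := by
        rw [simpleReflection, ← h2, ← h3, Equiv.swap_apply_apply]
        rfl
      rw [this, ← hu]
      simp only [mul_assoc, inv_mul_cancel_left]
      rw [show simpleReflection i * simpleReflection i = 1 from Equiv.swap_mul_self _ _, mul_one]

/-! ### The folded Weyl group -/

lemma oppZx_oppZx (x : Zx) : oppZx (oppZx x) = x := Subtype.ext (neg_neg _)

lemma oppZx_injective : Function.Injective oppZx := fun x y h => by
  rw [← oppZx_oppZx x, h, oppZx_oppZx]

lemma oppZx_lt {x y : Zx} : oppZx x < oppZx y ↔ y < x := by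
  rw [← Subtype.coe_lt_coe, ← Subtype.coe_lt_coe]
  exact neg_lt_neg_iff

/-- Permutations of `ℤ^×` commuting with the negation. -/
def IsOdd (w : Equiv.Perm Zx) : Prop := ∀ x, w (oppZx x) = oppZx (w x)

lemma IsOdd.mul {u w : Equiv.Perm Zx} (hu : IsOdd u) (hw : IsOdd w) : IsOdd (u * w) := fun x => by
  rw [Equiv.Perm.mul_apply, hw, hu]
  rfl

lemma IsOdd.inv {w : Equiv.Perm Zx} (hw : IsOdd w) : IsOdd w⁻¹ := fun x => by
  rw [Equiv.Perm.inv_eq_iff_eq, hw]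
  simp

lemma lo_neg (i : ℤ) : lo (-i) = oppZx (hi i) := by
  apply Subtype.ext
  simp only [oppZx, lo_val, hi_val]
  split_ifs <;> omega

lemma hi_neg (i : ℤ) : hi (-i) = oppZx (lo i) := by
  apply Subtype.ext
  simp only [oppZx, lo_val, hi_val]
  split_ifs <;> omega

lemma simpleReflection_neg_oppZx (i : ℤ) (x : Zx) :
    simpleReflection (-i) (oppZx x) = oppZx (simpleReflection i x) := by
  by_cases h1 : x = lo i
  · subst h1
    rw [← hi_neg, simpleReflection_hi, simpleReflection_lo, lo_neg]
  · by_cases h2 : x = hi i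
    · subst h2
      rw [← lo_neg, simpleReflection_lo, simpleReflection_hi, hi_neg]
    · rw [simpleReflection_of_ne h1 h2, simpleReflection_of_ne]
      · rw [lo_neg]
        exact fun h => h2 (by rw [← oppZx_oppZx x, h, oppZx_oppZx])
      · rw [hi_neg]
        exact fun h => h1 (by rw [← oppZx_oppZx x, h, oppZx_oppZx])

lemma hatReflection_succ (n : ℕ) : hatReflection (n + 1) =
    simpleReflection ((n + 1 : ℕ) : ℤ) * simpleReflection (-((n + 1 : ℕ) : ℤ)) := by
  rw [hatReflection]
  push_cast
  rfl

lemma simpleReflection_neg_of_pos {i : ℤ} (hi' : 0 < i) {x : Zx} (hx : 0 < x.1) :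
    simpleReflection (-i) x = x := by
  apply simpleReflection_of_ne
  · rintro rfl
    rw [lo_val] at hx
    split_ifs at hx <;> omega
  · rintro rfl
    rw [hi_val] at hx
    split_ifs at hx <;> omega

lemma simpleReflection_of_neg {i : ℤ} (hi' : 0 < i) {x : Zx} (hx : x.1 < 0) :
    simpleReflection i x = x := by
  apply simpleReflection_of_ne
  · rintro rfl
    rw [lo_val] at hx
    split_ifs at hx <;> omega
  · rintro rfl
    rw [hi_val] at hx
    split_ifs at hx <;> omega

lemma simpleReflection_neg_lt_zero {i : ℤ} (hi' : 0 < i) {x : Zx} (hx : x.1 < 0) :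
    (simpleReflection (-i) x).1 < 0 := by
  by_cases h1 : x = lo (-i)
  · rw [h1, simpleReflection_lo, hi_val]
    split_ifs <;> omega
  · by_cases h2 : x = hi (-i)
    · rw [h2, simpleReflection_hi, lo_val]
      split_ifs <;> omega
    · rwa [simpleReflection_of_ne h1 h2]

lemma hatReflection_succ_of_pos (n : ℕ) {x : Zx} (hx : 0 < x.1) :
    hatReflection (n + 1) x = simpleReflection ((n + 1 : ℕ) : ℤ) x := by
  rw [hatReflection_succ, Equiv.Perm.mul_apply, simpleReflection_neg_of_pos (by positivity) hx]

lemma hatReflection_succ_of_neg (n : ℕ) {x : Zx} (hx : x.1 < 0) :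
    hatReflection (n + 1) x = simpleReflection (-((n + 1 : ℕ) : ℤ)) x := by
  rw [hatReflection_succ, Equiv.Perm.mul_apply, simpleReflection_of_neg (by positivity)]
  exact simpleReflection_neg_lt_zero (by positivity) hx

lemma isOdd_hatReflection (n : ℕ) : IsOdd (hatReflection n) := by
  intro x
  cases n with
  | zero => exact simpleReflection_neg_oppZx 0 x
  | succ n =>
    rcases lt_or_gt_of_ne x.2 with hx | hx
    · rw [hatReflection_succ_of_neg n hx, hatReflection_succ_of_pos n (by simpa [oppZx] using hx)]
      have := simpleReflection_neg_oppZx (-((n + 1 : ℕ) : ℤ)) x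
      rwa [neg_neg] at this
    · rw [hatReflection_succ_of_pos n hx, hatReflection_succ_of_neg n (by simpa [oppZx] using hx)]
      exact simpleReflection_neg_oppZx _ x

lemma hatReflection_hatReflection (n : ℕ) (x : Zx) :
    hatReflection n (hatReflection n x) = x := by
  cases n with
  | zero => exact Equiv.swap_apply_self _ _ _
  | succ n =>
    have key : ∀ x : Zx, x.1 < 0 → hatReflection (n + 1) (hatReflection (n + 1) x) = x := by
      intro x hx
      rw [hatReflection_succ_of_neg n hx, hatReflection_succ_of_neg n
        (simpleReflection_neg_lt_zero (by positivity) hx)]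
      exact Equiv.swap_apply_self _ _ _
    rcases lt_or_gt_of_ne x.2 with hx | hx
    · exact key x hx
    · have := key (oppZx x) (by simpa [oppZx] using hx)
      rw [isOdd_hatReflection, isOdd_hatReflection] at this
      exact oppZx_injective this

lemma hatReflection_inv (n : ℕ) : (hatReflection n)⁻¹ = hatReflection n :=
  inv_eq_of_mul_eq_one_left (Equiv.ext fun x => hatReflection_hatReflection n x)

lemma hatReflection_lo (n : ℕ) : hatReflection n (lo n) = hi n := by
  cases n with
  | zero => exact simpleReflection_lo 0
  | succ n =>
    rw [hatReflection_succ_of_pos, simpleReflection_lo]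
    rw [lo_val, if_pos] <;> positivity

lemma hatReflection_hi (n : ℕ) : hatReflection n (hi n) = lo n := by
  rw [← hatReflection_lo, hatReflection_hatReflection]

lemma hatReflection_of_ne {n : ℕ} {x : Zx} (h1 : x ≠ lo n) (h2 : x ≠ hi n)
    (h3 : x ≠ oppZx (lo n)) (h4 : x ≠ oppZx (hi n)) : hatReflection n x = x := by
  cases n with
  | zero => exact simpleReflection_of_ne h1 h2
  | succ n =>
    rcases lt_or_gt_of_ne x.2 with hx | hx
    · rw [hatReflection_succ_of_neg n hx, simpleReflection_of_ne]
      · rwa [lo_neg]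
      · rwa [hi_neg]
    · rw [hatReflection_succ_of_pos n hx, simpleReflection_of_ne h1 h2]

lemma hatReflection_cross {n : ℕ} {x y : Zx} (h : x < y)
    (h' : hatReflection n y < hatReflection n x) :
    (x = lo n ∧ y = hi n) ∨ (x = oppZx (hi n) ∧ y = oppZx (lo n)) := by
  cases n with
  | zero => exact Or.inl (simpleReflection_cross h h')
  | succ n =>
    rw [hatReflection_succ, Equiv.Perm.mul_apply, Equiv.Perm.mul_apply] at h'
    by_cases h1 : simpleReflection (-((n + 1 : ℕ) : ℤ)) y < simpleReflection (-((n + 1 : ℕ) : ℤ)) x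
    · right
      rw [← lo_neg, ← hi_neg]
      exact simpleReflection_cross h h1
    · left
      have h1 := lt_of_le_of_ne (not_lt.1 h1) fun h2 => h.ne ((simpleReflection _).injective h2)
      obtain ⟨h2, h3⟩ := simpleReflection_cross h1 h'
      have e : ∀ z : Zx, 0 < z.1 → ∀ x, simpleReflection (-((n + 1 : ℕ) : ℤ)) x = z → x = z := by
        intro z hz x hx
        apply (simpleReflection (-((n + 1 : ℕ) : ℤ))).injective
        rw [hx, simpleReflection_neg_of_pos (by positivity) hz]
      refine ⟨e _ ?_ _ h2, e _ ?_ _ h3⟩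
      · rw [lo_val, if_pos] <;> positivity
      · rw [hi_val, if_pos] <;> positivity

/-- Oddness of `u` carries the mirror pair of `i` to that of `k`, so matching one pair is enough. In
`hatReflection_conj'` the pair of `i` goes to the mirror pair of `k`. -/
lemma hatReflection_conj {u : Equiv.Perm Zx} (hu : IsOdd u) {i k : ℕ} (h1 : u (lo i) = lo k)
    (h2 : u (hi i) = hi k) : hatReflection k * u = u * hatReflection i := by
  ext x : 1
  rw [Equiv.Perm.mul_apply, Equiv.Perm.mul_apply]
  by_cases e1 : x = lo i
  · rw [e1, h1, hatReflection_lo, hatReflection_lo, h2]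
  by_cases e2 : x = hi i
  · rw [e2, h2, hatReflection_hi, hatReflection_hi, h1]
  by_cases e3 : x = oppZx (lo i)
  · rw [e3, hu, h1, isOdd_hatReflection, isOdd_hatReflection, hatReflection_lo, hatReflection_lo,
      hu, h2]
  by_cases e4 : x = oppZx (hi i)
  · rw [e4, hu, h2, isOdd_hatReflection, isOdd_hatReflection, hatReflection_hi, hatReflection_hi,
      hu, h1]
  rw [hatReflection_of_ne e1 e2 e3 e4, hatReflection_of_ne]
  · rw [← h1]; exact u.injective.ne e1
  · rw [← h2]; exact u.injective.ne e2
  · rw [← h1, ← hu]; exact u.injective.ne e3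
  · rw [← h2, ← hu]; exact u.injective.ne e4

lemma hatReflection_conj' {u : Equiv.Perm Zx} (hu : IsOdd u) {i k : ℕ}
    (h1 : u (lo i) = oppZx (hi k)) (h2 : u (hi i) = oppZx (lo k)) :
    hatReflection k * u = u * hatReflection i := by
  ext x : 1
  rw [Equiv.Perm.mul_apply, Equiv.Perm.mul_apply]
  by_cases e1 : x = lo i
  · rw [e1, h1, hatReflection_lo, h2, isOdd_hatReflection, hatReflection_hi]
  by_cases e2 : x = hi i
  · rw [e2, h2, hatReflection_hi, h1, isOdd_hatReflection, hatReflection_lo]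
  by_cases e3 : x = oppZx (lo i)
  · rw [e3, hu, h1, oppZx_oppZx, hatReflection_hi, isOdd_hatReflection, hatReflection_lo, hu, h2,
      oppZx_oppZx]
  by_cases e4 : x = oppZx (hi i)
  · rw [e4, hu, h2, oppZx_oppZx, hatReflection_lo, isOdd_hatReflection, hatReflection_hi, hu, h1,
      oppZx_oppZx]
  rw [hatReflection_of_ne e1 e2 e3 e4, hatReflection_of_ne]
  · rw [← oppZx_oppZx (lo k), ← h2, ← hu]; exact u.injective.ne e4
  · rw [← oppZx_oppZx (hi k), ← h1, ← hu]; exact u.injective.ne e3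
  · rw [← h2]; exact u.injective.ne e2
  · rw [← h1]; exact u.injective.ne e1

lemma isOdd_prod (l : List ℕ) : IsOdd (l.map hatReflection).prod := by
  induction l with
  | nil => exact fun x => rfl
  | cons k l ih =>
    rw [List.map_cons, List.prod_cons]
    exact (isOdd_hatReflection k).mul ih

/-- As for `exchange`; `ŝ_k` can reverse two mirror pairs, and each case has its conjugation lemma.
-/
lemma hat_exchange {i : ℕ} (l : List ℕ)
    (h : (l.map hatReflection).prod (hi i) < (l.map hatReflection).prod (lo i)) :
    ∃ l' : List ℕ, (l'.map hatReflection).prod =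
      (l.map hatReflection).prod * hatReflection i ∧ l'.length + 1 = l.length := by
  induction l with
  | nil => exact absurd h (lo_lt_hi i).not_gt
  | cons k l ih =>
    rw [List.map_cons, List.prod_cons] at h ⊢
    set u := (l.map hatReflection).prod with hu
    by_cases h1 : u (hi i) < u (lo i)
    · obtain ⟨l', h2, h3⟩ := ih h1
      exact ⟨k :: l', by rw [List.map_cons, List.prod_cons, h2, mul_assoc], by simpa using h3⟩
    · have h1 : u (lo i) < u (hi i) :=
        lt_of_le_of_ne (not_lt.1 h1) fun h => (lo_lt_hi i).ne (u.injective h)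
      refine ⟨l, ?_, rfl⟩
      have hc : hatReflection k * u = u * hatReflection i := by
        rcases hatReflection_cross h1 h with ⟨h2, h3⟩ | ⟨h2, h3⟩
        · exact hatReflection_conj (isOdd_prod l) h2 h3
        · exact hatReflection_conj' (isOdd_prod l) h2 h3
      rw [hc, mul_assoc, ← hu]
      nth_rewrite 1 [← hatReflection_inv]
      simp

lemma perm_apply_inv (u : Equiv.Perm Zx) (x : Zx) : u (u⁻¹ x) = x := by simp

lemma act_sigma_comm {w : Equiv.Perm Zx} (hw : IsOdd w) (μ : HDual) :
    act w (sigma μ) = sigma (act w μ) := by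
  funext x
  simp only [act, sigma, hw.inv x]

/-- It suffices to test the commutation with `σ` on the weights `ε_i`: there it compares the
positions of the single nonzero coordinate. -/
lemma isOdd_of_mem_hatW {w : Equiv.Perm Zx} (hw : w ∈ hatW) : IsOdd w := by
  have h : IsOdd w⁻¹ := by
    intro y
    have h1 := congrFun (hw.2 (epsWt (w⁻¹ (oppZx y)))
      (AddSubgroup.subset_closure (Or.inl ⟨_, rfl⟩))) y
    simp only [act, sigma, epsWt, Pi.single_eq_same] at h1
    by_contra hne
    rw [Pi.single_eq_of_ne] at h1
    · simp at h1
    · exact fun h => hne h.symm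
  simpa using h.inv

lemma hatReflection_mem_weylGroup (n : ℕ) : hatReflection n ∈ weylGroup := by
  have h : ∀ i, simpleReflection i ∈ weylGroup := fun i => Subgroup.subset_closure ⟨i, rfl⟩
  cases n with
  | zero => exact h 0
  | succ n => rw [hatReflection_succ]; exact weylGroup.mul_mem (h _) (h _)

lemma hatReflection_mem_hatW (n : ℕ) : hatReflection n ∈ hatW :=
  ⟨hatReflection_mem_weylGroup n, fun μ _ => act_sigma_comm (isOdd_hatReflection n) μ⟩

lemma exists_support_bound {w : Equiv.Perm Zx} (hw : w ∈ weylGroup) :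
    ∃ N : ℕ, ∀ x : Zx, N < x.1.natAbs → w x = x := by
  induction hw using Subgroup.closure_induction with
  | mem x hx =>
    obtain ⟨i, rfl⟩ := hx
    refine ⟨i.natAbs + 1, fun x hx => simpleReflection_of_ne ?_ ?_⟩
    · rintro rfl
      rw [lo_val] at hx
      split_ifs at hx <;> omega
    · rintro rfl
      rw [hi_val] at hx
      split_ifs at hx <;> omega
  | one => exact ⟨0, fun _ _ => rfl⟩
  | mul x y _ _ hx hy =>
    obtain ⟨N, hN⟩ := hx
    obtain ⟨M, hM⟩ := hy
    refine ⟨N + M, fun z hz => ?_⟩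
    rw [Equiv.Perm.mul_apply, hM z (by omega), hN z (by omega)]
  | inv x _ hx =>
    obtain ⟨N, hN⟩ := hx
    exact ⟨N, fun z hz => by rw [Equiv.Perm.inv_eq_iff_eq, hN z hz]⟩

/-- The positive element `i` of `ℤ^×`. -/
def posZx (i : ℕ+) : Zx := ⟨(i : ℤ), by have := i.pos; omega⟩

lemma oppZx_posZx (i : ℕ+) : oppZx (posZx i) = negZx i := rfl

/-- Generators move `y` upwards one place at a time, past the gap at `0`, until it reaches `M`. -/
lemma exists_hat_moving (M : ℕ+) (n : ℕ) : ∀ y : Zx, y.1 ≤ M → -(M : ℤ) ≤ y.1 →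
    (M : ℤ) - y.1 = n → ∃ g ∈ Subgroup.closure (Set.range hatReflection),
      g y = posZx M ∧ ∀ x : Zx, (M : ℕ) < x.1.natAbs → g x = x := by
  induction n using Nat.strong_induction_on with
  | _ n ih =>
    intro y h1 h2 h3
    rcases eq_or_ne y (posZx M) with rfl | hy
    · exact ⟨1, Subgroup.one_mem _, rfl, fun _ _ => rfl⟩
    have hlt : y.1 < M := lt_of_le_of_ne h1 fun h => hy (Subtype.ext h)
    have hy0 := y.2
    -- The generator that exchanges `y` with its successor in `ℤ^×`: `k = y` if `y > 0`, and `k = -y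
    -- - 1` if `y < 0`, which is `ŝ_0` for `y = -1`.
    obtain ⟨k, hk, hk2⟩ : ∃ k : ℕ, (k : ℤ) < M ∧ (y = lo k ∨ y = oppZx (hi k)) := by
      rcases lt_or_gt_of_ne hy0 with h | h
      · refine ⟨(-y.1 - 1).toNat, by omega, Or.inr (Subtype.ext ?_)⟩
        simp only [oppZx, hi_val]
        split_ifs <;> omega
      · refine ⟨y.1.toNat, by omega, Or.inl (Subtype.ext ?_)⟩
        rw [lo_val]
        split_ifs <;> omega
    have hfix : ∀ x : Zx, (M : ℕ) < x.1.natAbs → hatReflection k x = x := by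
      intro x hx
      apply hatReflection_of_ne <;> rintro rfl <;> simp only [oppZx, lo_val, hi_val] at hx <;>
        split_ifs at hx <;> omega
    have hstep : y.1 < (hatReflection k y).1 ∧ (hatReflection k y).1 ≤ M := by
      rcases hk2 with rfl | rfl
      · rw [hatReflection_lo]
        simp only [lo_val, hi_val]
        split_ifs <;> omega
      · rw [isOdd_hatReflection, hatReflection_hi]
        simp only [oppZx, lo_val, hi_val]
        split_ifs <;> omega
    obtain ⟨g, hg, hg1, hg2⟩ := ih ((M : ℤ) - (hatReflection k y).1).toNat (by omega)
      (hatReflection k y) hstep.2 (by omega) (by omega)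
    exact ⟨g * hatReflection k, Subgroup.mul_mem _ hg (Subgroup.subset_closure ⟨k, rfl⟩), hg1,
      fun x hx => by rw [Equiv.Perm.mul_apply, hfix x hx, hg2 x hx]⟩

lemma isOdd_of_mem_closure {g : Equiv.Perm Zx}
    (hg : g ∈ Subgroup.closure (Set.range hatReflection)) : IsOdd g := by
  obtain ⟨l, rfl⟩ := exists_list_of_mem_closure hatReflection_inv hg
  exact isOdd_prod l

/-- Induction on the support: composing with a product of generators that brings the image of the
largest index back also fixes its negative, by oddness. Hence `Ŵ` is generated by the `ŝ_i`. -/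
lemma mem_closure_of_isOdd (N : ℕ) : ∀ w : Equiv.Perm Zx, IsOdd w →
    (∀ x : Zx, N < x.1.natAbs → w x = x) → w ∈ Subgroup.closure (Set.range hatReflection) := by
  induction N with
  | zero =>
    intro w _ h
    have : w = 1 := Equiv.ext fun x => h x (by have := x.2; omega)
    rw [this]
    exact Subgroup.one_mem _
  | succ N ih =>
    intro w hw h
    have hb : (w (posZx N.succPNat)).1.natAbs ≤ N + 1 := by
      by_contra hcon
      have h1 := h _ (not_le.1 hcon)
      have h2 := w.injective h1
      rw [h2] at hcon
      simp [posZx] at hcon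
      omega
    obtain ⟨g, hg, hg1, hg2⟩ := exists_hat_moving N.succPNat _ (w (posZx N.succPNat))
      (by rw [Nat.succPNat_coe]; omega) (by rw [Nat.succPNat_coe]; omega)
      (Int.toNat_of_nonneg (by rw [Nat.succPNat_coe]; omega)).symm
    have hgo := isOdd_of_mem_closure hg
    have hgw := ih (g * w) (hgo.mul hw) ?_
    · have := Subgroup.mul_mem _ (Subgroup.inv_mem _ hg) hgw
      simpa using this
    · intro x hx
      rw [Equiv.Perm.mul_apply]
      by_cases hx1 : x = posZx N.succPNat
      · rw [hx1, hg1]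
      · by_cases hx2 : x = negZx N.succPNat
        · rw [hx2, ← oppZx_posZx, hw, hgo, hg1]
        · have : N + 1 < x.1.natAbs := by
            have e1 : x.1 ≠ (N + 1 : ℕ) := fun h => hx1 (Subtype.ext (by simpa [posZx] using h))
            have e2 : x.1 ≠ -(N + 1 : ℕ) := fun h => hx2 (Subtype.ext (by simpa [negZx] using h))
            omega
          rw [h x this, hg2 x (by simpa using this)]

lemma exists_hat_list {w : Equiv.Perm Zx} (hw : w ∈ hatW) :
    ∃ l : List ℕ, (l.map hatReflection).prod = w := by
  obtain ⟨N, hN⟩ := exists_support_bound hw.1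
  exact exists_list_of_mem_closure hatReflection_inv
    (mem_closure_of_isOdd N w (isOdd_of_mem_hatW hw) hN)

/-! ### Minimal coset representatives -/

/-- Permutations that are increasing on the positive and on the negative integers. -/
def IsGrassmannian (w : Equiv.Perm Zx) : Prop :=
  ∀ x y : Zx, 0 < x.1 * y.1 → x < y → w x < w y

/-- For positive index `ŝ_i` preserves signs, and `Λ_0` depends on the sign only. -/
lemma act_hatReflection_Lambda0 (n : ℕ) (ε : ℕ) :
    act (hatReflection (n + 1)) (ε • Lambda0) = ε • Lambda0 := by
  funext x
  rw [act, hatReflection_inv]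
  have h : ∀ x : Zx, x.1 < 0 → (hatReflection (n + 1) x).1 < 0 := fun x hx => by
    rw [hatReflection_succ_of_neg n hx]
    exact simpleReflection_neg_lt_zero (by positivity) hx
  have h' : (hatReflection (n + 1) x).1 < 0 ↔ x.1 < 0 :=
    ⟨fun hx => by simpa [hatReflection_hatReflection] using h _ hx, h x⟩
  simp only [Pi.smul_apply, Lambda0, h']

/-- A descent at a positive index would, by `hat_exchange`, give a shorter element of the same coset
of the stabilizer. -/
lemma lt_of_mem_hatWCosetReps {ε : ℕ} {w : Equiv.Perm Zx} (hw : w ∈ hatWCosetReps ε) (n : ℕ) :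
    w (posZx n.succPNat) < w (posZx (n + 1).succPNat) := by
  have e1 : lo ((n + 1 : ℕ) : ℤ) = posZx n.succPNat := by
    apply Subtype.ext
    rw [lo_val, if_pos (by positivity)]
    rfl
  have e2 : hi ((n + 1 : ℕ) : ℤ) = posZx (n + 1).succPNat := by
    apply Subtype.ext
    rw [hi_val, if_pos (by positivity)]
    rfl
  rw [← e1, ← e2]
  by_contra hcon
  have hcon := lt_of_le_of_ne (not_lt.1 hcon) fun h => (lo_lt_hi _).ne' (w.injective h)
  obtain ⟨l, hl, hlen⟩ := exists_isReducedExpr (exists_hat_list hw.1)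
  rw [← hl.1] at hcon
  obtain ⟨l', h1, h2⟩ := hat_exchange l hcon
  rw [hl.1] at h1
  have h3 := hw.2 _ (hatReflection_mem_hatW (n + 1)) (act_hatReflection_Lambda0 n ε)
  have h4 : len hatReflection (w * hatReflection (n + 1)) ≤ l'.length :=
    Nat.sInf_le ⟨l', h1, rfl⟩
  omega

lemma exists_posZx {x : Zx} (hx : 0 < x.1) : ∃ i, x = posZx i :=
  ⟨⟨x.1.toNat, by omega⟩, Subtype.ext (by simp [posZx]; omega)⟩

lemma exists_negZx {x : Zx} (hx : x.1 < 0) : ∃ i, x = negZx i :=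
  ⟨⟨(-x.1).toNat, by omega⟩, Subtype.ext (by simp [negZx]; omega)⟩

lemma posZx_lt {i j : ℕ+} : posZx i < posZx j ↔ i < j := by
  rw [← Subtype.coe_lt_coe]
  simp [posZx]

lemma strictMono_of_mem_hatWCosetReps {ε : ℕ} {w : Equiv.Perm Zx} (hw : w ∈ hatWCosetReps ε) :
    StrictMono fun i : ℕ+ => w (posZx i) := by
  have h := strictMono_nat_of_lt_succ (f := fun n : ℕ => w (posZx n.succPNat))
    (lt_of_mem_hatWCosetReps hw)
  intro i j hij
  have := h (a := i.natPred) (b := j.natPred) (by simpa using hij)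
  simpa using this

lemma isGrassmannian_of_strictMono {w : Equiv.Perm Zx} (hw : IsOdd w)
    (h : StrictMono fun i : ℕ+ => w (posZx i)) : IsGrassmannian w := by
  intro x y hxy hlt
  rcases lt_or_gt_of_ne x.2 with hx | hx
  · obtain ⟨i, rfl⟩ := exists_negZx hx
    obtain ⟨j, rfl⟩ := exists_negZx (neg_of_mul_pos_right hxy hx.le)
    rw [← oppZx_posZx, ← oppZx_posZx, oppZx_lt, posZx_lt] at hlt
    rw [← oppZx_posZx, ← oppZx_posZx, hw, hw, oppZx_lt]
    exact h hlt
  · obtain ⟨i, rfl⟩ := exists_posZx hx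
    obtain ⟨j, rfl⟩ := exists_posZx (pos_of_mul_pos_right hxy hx.le)
    exact h (posZx_lt.1 hlt)

/-! ### Demazure crystals along reduced words. -/

/-- The finite sets `a`, `b` record the values of `w` that have the sign opposite to that of the
argument. -/
def Describes (w : Equiv.Perm Zx) (a b : Finset ℕ+) : Prop :=
  (∀ j, j ∈ a ↔ (w⁻¹ (posZx j)).1 < 0) ∧ ∀ j, j ∈ b ↔ 0 < (w⁻¹ (negZx j)).1

lemma describes_one : Describes 1 ∅ ∅ := by
  constructor <;> intro j <;> have := j.pos <;> simp [posZx, negZx]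

lemma lo_coe (i : ℕ+) : lo (i : ℤ) = posZx i :=
  Subtype.ext (by rw [lo_val, if_pos (by simp)]; rfl)

lemma hi_coe (i : ℕ+) : hi (i : ℤ) = posZx (i + 1) :=
  Subtype.ext (by rw [hi_val, if_pos (by simp)]; simp [posZx])

lemma posZx_injective : Function.Injective posZx := fun i j h => by
  have := congrArg Subtype.val h
  simpa [posZx] using this

lemma negZx_injective : Function.Injective negZx := fun i j h => by
  have := congrArg Subtype.val h
  simpa [negZx] using this

lemma posZx_ne_negZx (i j : ℕ+) : posZx i ≠ negZx j := fun h => by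
  have := congrArg Subtype.val h
  have h1 := i.pos
  have h2 := j.pos
  simp only [posZx, negZx] at this
  omega

lemma lo_neg_coe (i : ℕ+) : lo (-(i : ℤ)) = negZx (i + 1) := by
  rw [lo_neg, hi_coe, oppZx_posZx]

lemma hi_neg_coe (i : ℕ+) : hi (-(i : ℤ)) = negZx i := by
  rw [hi_neg, lo_coe, oppZx_posZx]

lemma lo_zero : lo 0 = negZx 1 := rfl

lemma hi_zero : hi 0 = posZx 1 := rfl

lemma inv_mul_apply (u w : Equiv.Perm Zx) (x : Zx) : (u * w)⁻¹ x = w⁻¹ (u⁻¹ x) := by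
  rw [mul_inv_rev]; rfl

lemma mem_bumpSet_iff_of_swap {a : Finset ℕ+} {i : ℕ+} {P Q : ℕ+ → Prop}
    (ha : ∀ j, j ∈ a ↔ P j) (h1 : Q i ↔ P (i + 1)) (h2 : Q (i + 1) ↔ P i)
    (h3 : ∀ j, j ≠ i → j ≠ i + 1 → (Q j ↔ P j)) (hi1 : i ∈ a) (hi2 : i + 1 ∉ a) (j : ℕ+) :
    j ∈ bumpSet a i ↔ Q j := by
  have hne := pnat_succ_ne i
  rw [mem_bumpSet]
  rw [ha] at hi1 hi2
  by_cases e1 : j = i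
  · subst e1
    simp [h1, hi2, hne.symm]
  · by_cases e2 : j = i + 1
    · subst e2
      simp [h2, hi1]
    · rw [h3 j e1 e2, ha]
      simp [e1, e2]

/-- With `w = s_i u`, reducedness and monotonicity force `lo i` and `hi i` to be values of `u` at a
negative and a positive argument. This makes `i` a legitimate step for the sets of `u`, and the
matching `demazure_step` lemma applies. -/
theorem demazureSet_eq_ladder (l : List ℤ) : ∀ w, IsReducedExpr simpleReflection l w →
    IsGrassmannian w → ∃ a b, Describes w a b ∧ a.card = b.card ∧
      demazureSet crystalF 0 l = ladder a b := by
  induction l with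
  | nil =>
    rintro w ⟨rfl, -⟩ -
    exact ⟨∅, ∅, describes_one, rfl, ladder_empty.symm⟩
  | cons i l ih =>
    intro w hred hG
    set u := (l.map simpleReflection).prod with hu
    have hw : w = simpleReflection i * u := by rw [← hred.1, List.map_cons, List.prod_cons]
    -- Otherwise the exchange condition for the reversed word of `u` would shorten the word of `w`.
    have hlt : u⁻¹ (lo i) < u⁻¹ (hi i) := by
      by_contra hcon
      have hcon := lt_of_le_of_ne (not_lt.1 hcon) fun h => (lo_lt_hi i).ne' ((u⁻¹).injective h)
      rw [hu, inv_prod_map simpleReflection_inv] at hcon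
      obtain ⟨l', h1, h2⟩ := exchange _ hcon
      have h3 := hred.2 l'.reverse ?_
      · simp at h2 h3
        omega
      · rw [← inv_prod_map simpleReflection_inv, h1, ← inv_prod_map simpleReflection_inv, ← hu, hw,
          mul_inv_rev, inv_inv, simpleReflection_inv]
    have hw1 : w (u⁻¹ (lo i)) = hi i := by
      rw [hw, Equiv.Perm.mul_apply, perm_apply_inv, simpleReflection_lo]
    have hw2 : w (u⁻¹ (hi i)) = lo i := by
      rw [hw, Equiv.Perm.mul_apply, perm_apply_inv, simpleReflection_hi]
    -- With equal signs, `w` would have to preserve the order of these two arguments, but it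
    -- reverses it.
    have hsign : (u⁻¹ (lo i)).1 < 0 ∧ 0 < (u⁻¹ (hi i)).1 := by
      have h1 : ¬ 0 < (u⁻¹ (lo i)).1 * (u⁻¹ (hi i)).1 := by
        intro h
        have := hG _ _ h hlt
        rw [hw1, hw2] at this
        exact this.not_gt (lo_lt_hi i)
      have h2 := (u⁻¹ (lo i)).2
      have h3 := (u⁻¹ (hi i)).2
      rw [← Subtype.coe_lt_coe] at hlt
      constructor
      · by_contra h
        exact h1 (mul_pos (by omega) (by omega))
      · by_contra h
        exact h1 (mul_pos_of_neg_of_neg (by omega) (by omega))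
    -- Going from `w` to `u` reverses one pair of values only, and `u` has that pair in increasing
    -- order by `hlt`.
    have hG' : IsGrassmannian u := by
      intro x y hxy hlt'
      have h1 := hG x y hxy hlt'
      have hux : ∀ z, u z = simpleReflection i (w z) := by
        intro z
        rw [hw, Equiv.Perm.mul_apply, simpleReflection, Equiv.swap_apply_self]
      by_contra hcon
      have hcon := lt_of_le_of_ne (not_lt.1 hcon) fun h => hlt'.ne' (u.injective h)
      rw [hux, hux] at hcon
      obtain ⟨h2, h3⟩ := simpleReflection_cross h1 hcon
      rw [← hw2] at h2
      rw [← hw1] at h3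
      rw [w.injective h2, w.injective h3] at hlt'
      exact hlt.not_gt hlt'
    obtain ⟨a, b, ⟨ha, hb⟩, hab, hset⟩ := ih u hred.tail hG'
    have hinv : ∀ x, w⁻¹ x = u⁻¹ (simpleReflection i x) := by
      intro x
      rw [hw, inv_mul_apply, simpleReflection_inv]
    have hset' : demazureSet crystalF 0 (i :: l) =
        {A | ∃ C ∈ ladder a b, ∃ m : ℕ, opPow (crystalF i) m C = some A} := by
      rw [← hset]; rfl
    rw [hset']
    have hnp : ∀ x : Zx, ¬ x.1 < 0 ↔ 0 < x.1 := fun x => by have := x.2; omega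
    rcases lt_trichotomy i 0 with hi0 | rfl | hi0
    · obtain ⟨k, rfl⟩ : ∃ k : ℕ+, i = -(k : ℤ) :=
        ⟨⟨(-i).toNat, by omega⟩, by simp; omega⟩
      rw [lo_neg_coe, hi_neg_coe] at hsign
      have h1 : k ∈ b := (hb k).2 hsign.2
      have h2 : k + 1 ∉ b := fun h => by have := (hb _).1 h; omega
      refine ⟨a, bumpSet b k, ⟨fun j => ?_, ?_⟩, ?_, demazure_step_neg h1 h2⟩
      · rw [hinv, simpleReflection_of_ne, ha]
        · rw [lo_neg_coe]; exact posZx_ne_negZx _ _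
        · rw [hi_neg_coe]; exact posZx_ne_negZx _ _
      · refine mem_bumpSet_iff_of_swap hb ?_ ?_ ?_ h1 h2
        · rw [hinv, ← hi_neg_coe, simpleReflection_hi, lo_neg_coe]
        · rw [hinv, ← lo_neg_coe, simpleReflection_lo, hi_neg_coe]
        · intro j e1 e2
          rw [hinv, simpleReflection_of_ne]
          · rw [lo_neg_coe]; exact negZx_injective.ne e2
          · rw [hi_neg_coe]; exact negZx_injective.ne e1
      · rw [card_bumpSet h1 h2, hab]
    · rw [lo_zero, hi_zero] at hsign
      have h1 : 1 ∉ a := fun h => by have := (ha _).1 h; omega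
      have h2 : 1 ∉ b := fun h => by have := (hb _).1 h; omega
      refine ⟨insert 1 a, insert 1 b, ⟨fun j => ?_, fun j => ?_⟩, ?_, demazure_step_zero h1 h2 hab⟩
      · by_cases e1 : j = 1
        · subst e1
          rw [hinv, ← hi_zero, simpleReflection_hi, lo_zero]
          simpa using hsign.1
        · rw [hinv, simpleReflection_of_ne, ← ha]
          · simp [e1]
          · rw [lo_zero]; exact posZx_ne_negZx _ _
          · rw [hi_zero]; exact posZx_injective.ne e1
      · by_cases e1 : j = 1
        · subst e1
          rw [hinv, ← lo_zero, simpleReflection_lo, hi_zero]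
          simpa using hsign.2
        · rw [hinv, simpleReflection_of_ne, ← hb]
          · simp [e1]
          · rw [lo_zero]; exact negZx_injective.ne e1
          · rw [hi_zero]; exact (posZx_ne_negZx _ _).symm
      · rw [Finset.card_insert_of_notMem h1, Finset.card_insert_of_notMem h2, hab]
    · obtain ⟨k, rfl⟩ : ∃ k : ℕ+, i = (k : ℤ) :=
        ⟨⟨i.toNat, by omega⟩, by simp; omega⟩
      rw [lo_coe, hi_coe] at hsign
      have h1 : k ∈ a := (ha k).2 hsign.1
      have h2 : k + 1 ∉ a := fun h => by have := (ha _).1 h; omega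
      refine ⟨bumpSet a k, b, ⟨?_, fun j => ?_⟩, ?_, demazure_step_pos h1 h2⟩
      · refine mem_bumpSet_iff_of_swap ha ?_ ?_ ?_ h1 h2
        · rw [hinv, ← lo_coe, simpleReflection_lo, hi_coe]
        · rw [hinv, ← hi_coe, simpleReflection_hi, lo_coe]
        · intro j e1 e2
          rw [hinv, simpleReflection_of_ne]
          · rw [lo_coe]; exact posZx_injective.ne e1
          · rw [hi_coe]; exact posZx_injective.ne e2
      · rw [hinv, simpleReflection_of_ne, hb]
        · rw [lo_coe]; exact (posZx_ne_negZx _ _).symm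
        · rw [hi_coe]; exact (posZx_ne_negZx _ _).symm
      · rw [card_bumpSet h1 h2, hab]

lemma describes_of_isOdd {w : Equiv.Perm Zx} (hw : IsOdd w) {a : Finset ℕ+}
    (ha : ∀ j, j ∈ a ↔ (w⁻¹ (posZx j)).1 < 0) : Describes w a a := by
  refine ⟨ha, fun j => ?_⟩
  rw [ha, ← oppZx_posZx, hw.inv]
  simp [oppZx]

/-- The same induction in `Ŵ`. Oddness makes the two sets equal, so a single `a` has to be followed.
-/
theorem demazureSet_foldedF_eq {ε : ℕ} (hε : ε = 1 ∨ ε = 2) (l : List ℕ) :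
    ∀ w, IsReducedExpr hatReflection l w → IsGrassmannian w → ∃ a, Describes w a a ∧
      demazureSet (foldedF ε) 0 l = symMat ε ∩ ladder a a := by
  induction l with
  | nil =>
    rintro w ⟨rfl, -⟩ -
    refine ⟨∅, describes_one, ?_⟩
    rw [ladder_empty, Set.inter_eq_right.2]
    · rfl
    · rintro _ rfl
      exact ⟨fun _ _ => rfl, fun _ => dvd_zero _⟩
  | cons i l ih =>
    intro w hred hG
    set u := (l.map hatReflection).prod with hu
    have hodd : IsOdd u := isOdd_prod l
    have hw : w = hatReflection i * u := by rw [← hred.1, List.map_cons, List.prod_cons]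
    have hwodd : IsOdd w := hw ▸ (isOdd_hatReflection i).mul hodd
    have hlt : u⁻¹ (lo i) < u⁻¹ (hi i) := by
      by_contra hcon
      have hcon := lt_of_le_of_ne (not_lt.1 hcon) fun h => (lo_lt_hi i).ne' ((u⁻¹).injective h)
      rw [hu, inv_prod_map hatReflection_inv] at hcon
      obtain ⟨l', h1, h2⟩ := hat_exchange _ hcon
      have h3 := hred.2 l'.reverse ?_
      · simp at h2 h3
        omega
      · rw [← inv_prod_map hatReflection_inv, h1, ← inv_prod_map hatReflection_inv, ← hu, hw,
          mul_inv_rev, inv_inv, hatReflection_inv]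
    have hw1 : w (u⁻¹ (lo i)) = hi i := by
      rw [hw, Equiv.Perm.mul_apply, perm_apply_inv, hatReflection_lo]
    have hw2 : w (u⁻¹ (hi i)) = lo i := by
      rw [hw, Equiv.Perm.mul_apply, perm_apply_inv, hatReflection_hi]
    have hsign : (u⁻¹ (lo i)).1 < 0 ∧ 0 < (u⁻¹ (hi i)).1 := by
      have h1 : ¬ 0 < (u⁻¹ (lo i)).1 * (u⁻¹ (hi i)).1 := by
        intro h
        have := hG _ _ h hlt
        rw [hw1, hw2] at this
        exact this.not_gt (lo_lt_hi i)
      have h2 := (u⁻¹ (lo i)).2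
      have h3 := (u⁻¹ (hi i)).2
      rw [← Subtype.coe_lt_coe] at hlt
      constructor
      · by_contra h
        exact h1 (mul_pos (by omega) (by omega))
      · by_contra h
        exact h1 (mul_pos_of_neg_of_neg (by omega) (by omega))
    have hG' : IsGrassmannian u := by
      intro x y hxy hlt'
      have h1 := hG x y hxy hlt'
      have hux : ∀ z, u z = hatReflection i (w z) := by
        intro z
        rw [hw, Equiv.Perm.mul_apply, hatReflection_hatReflection]
      by_contra hcon
      have hcon := lt_of_le_of_ne (not_lt.1 hcon) fun h => hlt'.ne' (u.injective h)
      rw [hux, hux] at hcon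
      rcases hatReflection_cross h1 hcon with ⟨h2, h3⟩ | ⟨h2, h3⟩
      · rw [← hw2] at h2
        rw [← hw1] at h3
        rw [w.injective h2, w.injective h3] at hlt'
        exact hlt.not_gt hlt'
      · rw [← hw1, ← hwodd] at h2
        rw [← hw2, ← hwodd] at h3
        rw [w.injective h2, w.injective h3, oppZx_lt] at hlt'
        exact hlt.not_gt hlt'
    obtain ⟨a, ⟨ha, -⟩, hset⟩ := ih u hred.tail hG'
    have hinv : ∀ x, w⁻¹ x = u⁻¹ (hatReflection i x) := by
      intro x
      rw [hw, inv_mul_apply, hatReflection_inv]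
    have hset' : demazureSet (foldedF ε) 0 (i :: l) =
        {A | ∃ C ∈ symMat ε ∩ ladder a a, ∃ m : ℕ, opPow (foldedF ε i) m C = some A} := by
      rw [← hset]; rfl
    rw [hset']
    rcases Nat.eq_zero_or_pos i with rfl | hi0
    · rw [Nat.cast_zero, lo_zero, hi_zero] at hsign
      have h1 : 1 ∉ a := fun h => by have := (ha _).1 h; omega
      refine ⟨insert 1 a, describes_of_isOdd hwodd fun j => ?_, foldedF_step_zero hε h1⟩
      by_cases e1 : j = 1
      · subst e1
        have : hatReflection 0 (posZx 1) = negZx 1 := hatReflection_hi 0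
        rw [hinv, this]
        simpa using hsign.1
      · have : hatReflection 0 (posZx j) = posZx j := by
          refine simpleReflection_of_ne ?_ ?_
          · rw [lo_zero]; exact posZx_ne_negZx _ _
          · rw [hi_zero]; exact posZx_injective.ne e1
        rw [hinv, this, ← ha]
        simp [e1]
    · obtain ⟨k, rfl⟩ : ∃ k : ℕ+, i = (k : ℕ) := ⟨⟨i, hi0⟩, rfl⟩
      rw [lo_coe, hi_coe] at hsign
      have h1 : k ∈ a := (ha k).2 hsign.1
      have h2 : k + 1 ∉ a := fun h => by have := (ha _).1 h; omega
      refine ⟨bumpSet a k, describes_of_isOdd hwodd ?_, foldedF_step_pos hε h1 h2⟩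
      refine mem_bumpSet_iff_of_swap ha ?_ ?_ ?_ h1 h2
      · rw [hinv, ← lo_coe, hatReflection_lo, hi_coe]
      · rw [hinv, ← hi_coe, hatReflection_hi, lo_coe]
      · intro j e1 e2
        rw [hinv, hatReflection_of_ne]
        · rw [lo_coe]; exact posZx_injective.ne e1
        · rw [hi_coe]; exact posZx_injective.ne e2
        · rw [lo_coe, oppZx_posZx]; exact posZx_ne_negZx _ _
        · rw [hi_coe, oppZx_posZx]; exact posZx_ne_negZx _ _

/-! ### Shape and flag of a coset representative. -/

lemma le_ncard_iff_of_isLowerSet {S : Set ℕ+} (hS : IsLowerSet S) (hfin : S.Finite) (k : ℕ+) :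
    (k : ℕ) ≤ S.ncard ↔ k ∈ S := by
  classical
  have hex : ∃ m, m ∉ S := hfin.exists_notMem
  obtain ⟨m, hm, hmin⟩ : ∃ m, m ∉ S ∧ ∀ j, j < m → j ∈ S :=
    ⟨PNat.find hex, PNat.find_spec hex, fun j hj => not_not.1 (PNat.find_min hex hj)⟩
  have h : S = (Finset.Ico 1 m : Finset ℕ+) := by
    ext j
    rw [Finset.mem_coe, Finset.mem_Ico]
    exact ⟨fun hj => ⟨one_le, lt_of_not_ge fun h => hm (hS h hj)⟩, fun hj => hmin j hj.2⟩
  rw [h, Set.ncard_coe_finset, PNat.card_Ico, Finset.mem_coe, Finset.mem_Ico, ← PNat.coe_lt_coe]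
  have := k.pos
  have := m.pos
  have : ((1 : ℕ+) : ℕ) = 1 := rfl
  have : 1 ≤ k := one_le
  simp only [this, true_and]
  omega

section Flag

variable {w : Equiv.Perm Zx}

lemma exists_posZx_or_negZx (x : Zx) : ∃ i, x = posZx i ∨ x = negZx i := by
  rcases lt_or_gt_of_ne x.2 with hx | hx
  · obtain ⟨i, rfl⟩ := exists_negZx hx
    exact ⟨i, Or.inr rfl⟩
  · obtain ⟨i, rfl⟩ := exists_posZx hx
    exact ⟨i, Or.inl rfl⟩

lemma apply_negZx (hw : IsOdd w) (i : ℕ+) : (w (negZx i)).1 = -(w (posZx i)).1 := by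
  rw [← oppZx_posZx, hw]
  rfl

lemma val_injective : Function.Injective fun i : ℕ+ => (w (posZx i)).1 := fun _ _ h =>
  posZx_injective (w.injective (Subtype.ext h))

lemma apply_posZx_ne_neg (hw : IsOdd w) (i j : ℕ+) : (w (posZx i)).1 ≠ -(w (posZx j)).1 := by
  rw [← apply_negZx hw]
  exact fun h => posZx_ne_negZx i j (w.injective (Subtype.ext h))

lemma finite_val_lt (hm : StrictMono fun i : ℕ+ => w (posZx i)) (c : ℤ) :
    {i : ℕ+ | (w (posZx i)).1 < c}.Finite := by
  have hz : StrictMono fun n : ℕ => (w (posZx n.succPNat)).1 := fun i j hij =>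
    hm (Nat.succPNat_lt_succPNat.2 hij)
  have h : ∀ n : ℕ, (w (posZx (0 : ℕ).succPNat)).1 + n ≤ (w (posZx n.succPNat)).1 := by
    intro n
    induction n with
    | zero => simp
    | succ n ih =>
      have : (w (posZx n.succPNat)).1 < (w (posZx (n + 1).succPNat)).1 := hz (Nat.lt_succ_self n)
      push_cast
      omega
  refine Set.Finite.subset (Finset.Iic (c - (w (posZx (0 : ℕ).succPNat)).1).toNat.succPNat).finite_toSet
    fun i hi => ?_
  have h1 := h i.natPred
  rw [PNat.succPNat_natPred] at h1
  simp only [Set.mem_ofPred_eq] at hi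
  simp only [Finset.coe_Iic, Set.mem_Iic, ← PNat.coe_le_coe, Nat.succPNat_coe]
  have := PNat.natPred_add_one i
  omega

lemma isLowerSet_val_lt (hm : StrictMono fun i : ℕ+ => w (posZx i)) (c : ℤ) :
    IsLowerSet {i : ℕ+ | (w (posZx i)).1 < c} := fun _ _ hij hi =>
  lt_of_le_of_lt (Subtype.coe_le_coe.2 (hm.monotone hij)) hi

/-- Values at negative arguments do not contribute: if `w⁻¹ j = -k` exceeds `-i`, then `k < i`, so
`j = -w(k)` is larger than `-w(i)`. -/
lemma shape_eq (hw : IsOdd w) (hm : StrictMono fun i : ℕ+ => w (posZx i)) (i : ℕ+) :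
    shape w i = {k : ℕ+ | (w (posZx k)).1 < -(w (posZx i)).1}.ncard := by
  rw [shape, ← Set.ncard_image_of_injective _ (f := fun k : ℕ+ => w (posZx k)) hm.injective]
  congr 1
  ext j
  simp only [diagram, Set.mem_ofPred_eq, Set.mem_image]
  rw [← Subtype.coe_lt_coe (x := j), apply_negZx hw]
  constructor
  · rintro ⟨h1, h2⟩
    obtain ⟨k, hk | hk⟩ := exists_posZx_or_negZx (w⁻¹ j)
    · have hj : w (posZx k) = j := by rw [← hk, perm_apply_inv]
      exact ⟨k, by rwa [hj], hj⟩
    · rw [hk, ← oppZx_posZx, ← oppZx_posZx, oppZx_lt, posZx_lt] at h1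
      have hj : w (negZx k) = j := by rw [← hk, perm_apply_inv]
      rw [← hj, apply_negZx hw] at h2
      have : (w (posZx k)).1 < (w (posZx i)).1 := hm h1
      omega
  · rintro ⟨k, h1, rfl⟩
    refine ⟨?_, h1⟩
    rw [show w⁻¹ (w (posZx k)) = posZx k by simp, ← Subtype.coe_lt_coe]
    have h1 := k.pos
    have h2 := i.pos
    simp only [negZx, posZx]
    omega

lemma le_shape_iff (hw : IsOdd w) (hm : StrictMono fun i : ℕ+ => w (posZx i)) (k i : ℕ+) :
    (k : ℕ) ≤ shape w i ↔ (w (posZx k)).1 < -(w (posZx i)).1 := by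
  rw [shape_eq hw hm, le_ncard_iff_of_isLowerSet (isLowerSet_val_lt hm _) (finite_val_lt hm _)]
  rfl

/-- The box `(i, k)` lies in the diagram if and only if `w(i) + w(k) < 0`, a symmetric condition. -/
lemma shapeConj_eq (hw : IsOdd w) (hm : StrictMono fun i : ℕ+ => w (posZx i)) (k : ℕ+) :
    shapeConj w k = shape w k := by
  rw [shape_eq hw hm, shapeConj]
  congr 1
  ext i
  rw [Set.mem_ofPred_eq, le_shape_iff hw hm, Set.mem_ofPred_eq]
  omega

lemma diagLen_eq (hw : IsOdd w) (hm : StrictMono fun i : ℕ+ => w (posZx i)) :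
    diagLen w = {k : ℕ+ | (w (posZx k)).1 < 0}.ncard := by
  rw [diagLen]
  congr 1
  ext i
  rw [Set.mem_ofPred_eq, le_shape_iff hw hm, Set.mem_ofPred_eq]
  omega

/-- Let `w(k) = -c`. The indices `i` with `w(i) < c` are the `k` ones with `w(i) ≤ -c` and the `c -
1` ones with `|w(i)| < c`; so the `k`-th column has `k + c - 1` boxes. -/
lemma frobAlpha_eq (hw : IsOdd w) (hm : StrictMono fun i : ℕ+ => w (posZx i)) {k : ℕ+}
    (hk : (w (posZx k)).1 < 0) : (frobAlpha w k : ℤ) = -(w (posZx k)).1 := by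
  obtain ⟨c, hc⟩ : ∃ c : ℕ, (w (posZx k)).1 = -(c : ℤ) := ⟨(-(w (posZx k)).1).toNat, by omega⟩
  -- By oddness each positive integer is the absolute value of exactly one `w(i)`, `i ≥ 1`.
  have himg : (fun i : ℕ+ => (w (posZx i)).1.natAbs) '' {i | (w (posZx i)).1.natAbs < c} =
      (Finset.Ioo 0 c : Finset ℕ) := by
    ext v
    simp only [Set.mem_image, Set.mem_ofPred_eq, Finset.coe_Ioo, Set.mem_Ioo]
    constructor
    · rintro ⟨i, h1, rfl⟩
      exact ⟨Int.natAbs_pos.2 (w (posZx i)).2, h1⟩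
    · rintro ⟨h1, h2⟩
      let x : Zx := ⟨(v : ℤ), by omega⟩
      obtain ⟨i, hi | hi⟩ := exists_posZx_or_negZx (w⁻¹ x)
      · have : w (posZx i) = x := by rw [← hi, perm_apply_inv]
        have : (w (posZx i)).1.natAbs = v := by rw [this]; rfl
        exact ⟨i, by omega, this⟩
      · have : w (negZx i) = x := by rw [← hi, perm_apply_inv]
        have h3 := apply_negZx hw i
        rw [this] at h3
        have : x.1 = v := rfl
        exact ⟨i, by omega, by omega⟩
  have hinj : Set.InjOn (fun i : ℕ+ => (w (posZx i)).1.natAbs) {i | (w (posZx i)).1.natAbs < c} := by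
    intro i _ j _ hij
    rcases Int.natAbs_eq_natAbs_iff.1 hij with h | h
    · exact val_injective h
    · exact absurd h (apply_posZx_ne_neg hw i j)
  have h2 : {i | (w (posZx i)).1.natAbs < c}.ncard = c - 1 := by
    rw [← hinj.ncard_image, himg, Set.ncard_coe_finset, Nat.card_Ioo]
    omega
  have hunion : {i : ℕ+ | (w (posZx i)).1 < -(w (posZx k)).1} =
      {i | (w (posZx i)).1 < -(c : ℤ) + 1} ∪ {i | (w (posZx i)).1.natAbs < c} := by
    ext i
    have := apply_posZx_ne_neg hw i k
    simp only [Set.mem_ofPred_eq, Set.mem_union]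
    omega
  have hdisj : Disjoint {i : ℕ+ | (w (posZx i)).1 < -(c : ℤ) + 1}
      {i | (w (posZx i)).1.natAbs < c} := by
    rw [Set.disjoint_left]
    intro i h1 h2
    simp only [Set.mem_ofPred_eq] at h1 h2
    omega
  have h1 : {i : ℕ+ | (w (posZx i)).1 < -(c : ℤ) + 1}.ncard = k := by
    have h := le_ncard_iff_of_isLowerSet (isLowerSet_val_lt hm (-(c : ℤ) + 1))
      (finite_val_lt hm _)
    have e1 := (h k).2 (by simp only [Set.mem_ofPred_eq]; omega)
    have e2 := (h (k + 1)).not.2 (by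
      have : (w (posZx k)).1 < (w (posZx (k + 1))).1 := hm (pnat_lt_succ k)
      simp only [Set.mem_ofPred_eq]; omega)
    simp only [PNat.add_coe, PNat.one_coe] at e2
    omega
  have hfin : {i : ℕ+ | (w (posZx i)).1.natAbs < c}.Finite := by
    refine Set.Finite.of_finite_image ?_ hinj
    rw [himg]
    exact Finset.finite_toSet _
  rw [frobAlpha, shapeConj_eq hw hm, shape_eq hw hm, hunion,
    Set.ncard_union_eq hdisj (finite_val_lt hm _) hfin, h1, h2]
  omega

variable {a : Finset ℕ+}

lemma Describes.mem_iff (ha : Describes w a a) (j : ℕ+) : j ∈ a ↔ ∃ k, w (posZx k) = negZx j := by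
  rw [ha.2]
  constructor
  · intro h
    obtain ⟨k, hk⟩ := exists_posZx h
    exact ⟨k, by rw [← hk, perm_apply_inv]⟩
  · rintro ⟨k, hk⟩
    rw [← hk, show w⁻¹ (w (posZx k)) = posZx k by simp]
    simp [posZx]

/-- The elements of `a` are the numbers `-w(j)` for `j ≥ 1` with `w(j) < 0`. -/
lemma numGT_eq_ncard (ha : Describes w a a) (k : ℕ) :
    numGT a k = {j : ℕ+ | (w (posZx j)).1 < -(k : ℤ)}.ncard := by
  have hinj : Set.InjOn (fun j : ℕ+ => (-(w (posZx j)).1).toNat.toPNat')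
      {j : ℕ+ | (w (posZx j)).1 < -(k : ℤ)} := by
    intro i hi j hj hij
    simp only [Set.mem_ofPred_eq] at hi hj
    have h := congrArg PNat.val hij
    simp only [Nat.toPNat'_coe] at h
    apply val_injective (w := w)
    simp only
    split_ifs at h <;> omega
  rw [← hinj.ncard_image, numGT, ← Set.ncard_coe_finset]
  congr 1
  ext x
  simp only [Finset.coe_filter, Set.mem_ofPred_eq, Set.mem_image, ha.mem_iff]
  constructor
  · rintro ⟨⟨j, hj⟩, hx⟩
    have hv : (w (posZx j)).1 = -(x : ℤ) := by rw [hj]; rfl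
    refine ⟨j, by omega, ?_⟩
    apply PNat.coe_injective
    rw [Nat.toPNat'_coe, hv]
    have := x.pos
    split_ifs <;> omega
  · rintro ⟨j, hj, rfl⟩
    refine ⟨⟨j, Subtype.ext ?_⟩, ?_⟩
    · simp only [negZx, Nat.toPNat'_coe]
      split_ifs <;> push_cast <;> omega
    · rw [Nat.toPNat'_coe]
      split_ifs <;> omega

lemma numGT_zero (a : Finset ℕ+) : numGT a 0 = a.card := by simp [numGT]

lemma length_flag (hw : IsOdd w) (hm : StrictMono fun i : ℕ+ => w (posZx i))
    (ha : Describes w a a) : (flag w).length = a.card := by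
  rw [flag, List.length_reverse, List.length_map, List.length_range, diagLen_eq hw hm,
    ← numGT_zero, numGT_eq_ncard ha]
  simp

/-- The numbers `-w(1) > -w(2) > ⋯` enumerate `a` decreasingly, so the flag and `numGT a` describe
each other. -/
lemma lt_flag_iff (hw : IsOdd w) (hm : StrictMono fun i : ℕ+ => w (posZx i))
    (ha : Describes w a a) {r : ℕ} (hr : r < (flag w).length) (k : ℕ) :
    k < (flag w).getD ((flag w).length - (r + 1)) 0 ↔ r < numGT a k := by
  have hd : (flag w).length = diagLen w := by simp [flag]
  -- With `r` counted from `0`, the reversal turns position `d - (r + 1)` into position `r` of the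
  -- list of the `α`'s, that is `α_{r+1}`.
  have h1 : (flag w).getD ((flag w).length - (r + 1)) 0 = frobAlpha w r.succPNat := by
    rw [List.getD_eq_getElem _ _ (by omega)]
    simp only [flag, List.getElem_reverse, List.getElem_map, List.getElem_range, List.length_reverse,
      List.length_map, List.length_range]
    congr 2
    omega
  have h2 : (w (posZx r.succPNat)).1 < 0 := by
    have := (le_ncard_iff_of_isLowerSet (isLowerSet_val_lt hm 0) (finite_val_lt hm _)
      r.succPNat).1 (by rw [← diagLen_eq hw hm, Nat.succPNat_coe]; omega)
    exact this
  have h3 := frobAlpha_eq hw hm h2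
  have h4 := le_ncard_iff_of_isLowerSet (isLowerSet_val_lt hm (-(k : ℤ))) (finite_val_lt hm _)
    r.succPNat
  rw [← numGT_eq_ncard ha, Nat.succPNat_coe, Nat.succ_le_iff] at h4
  rw [h1, h4, Set.mem_ofPred_eq]
  omega

end Flag

/-! ### Column insertion -/

/-- The number of entries of a column greater than `k`. -/
def colGT (c : List ℕ+) (k : ℕ) : ℕ := c.countP fun x : ℕ+ => k < (x : ℕ)

/-- The tableau `𝐏(l_rev)`. -/
def tab (l : List ℕ+) : Filling := l.foldr (fun a T => insertFilling T a) []

lemma insertWord_reverse (l : List ℕ+) : insertWord l.reverse = tab l := by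
  rw [insertWord, List.foldl_reverse]
  rfl

lemma tab_cons (a : ℕ+) (l : List ℕ+) : tab (a :: l) = insertFilling (tab l) a := rfl

lemma insertFilling_top {a : ℕ+} {c : List ℕ+} (h : ∀ x ∈ c, a < x) (T : Filling) :
    insertFilling (c :: T) a = (a :: c) :: T := by
  have : c.filter (fun x => x ≤ a) = [] := by
    rw [List.filter_eq_nil_iff]
    intro x hx
    simpa using h x hx
  rw [insertFilling, this]
  rfl

lemma insertFilling_bump {a a' : ℕ+} {u v : List ℕ+} (hc : (u ++ a' :: v).Pairwise (· < ·))
    (ha : a' ≤ a) (hv : ∀ x ∈ v, a < x) (T : Filling) :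
    insertFilling ((u ++ a' :: v) :: T) a = (u ++ a :: v) :: insertFilling T a' := by
  rw [List.pairwise_append, List.pairwise_cons] at hc
  obtain ⟨-, ⟨h1, -⟩, h2⟩ := hc
  have h2 : ∀ x ∈ u, x < a' := fun x hx => h2 x hx a' List.mem_cons_self
  have hmax : ((u ++ a' :: v).filter fun x => x ≤ a).max? = some a' := by
    rw [List.max?_eq_some_iff]
    refine ⟨by simp [ha], fun x hx => ?_⟩
    simp only [List.mem_filter, List.mem_append, List.mem_cons, decide_eq_true_eq] at hx
    rcases hx with ⟨hx | rfl | hx, hxa⟩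
    · exact (h2 x hx).le
    · exact le_rfl
    · exact absurd hxa (hv x hx).not_ge
  have hmap : (u ++ a' :: v).map (fun x => if x = a' then a else x) = u ++ a :: v := by
    rw [List.map_append, List.map_cons, if_pos rfl]
    congr 1
    · refine (List.map_congr_left fun x hx => ?_).trans (List.map_id u)
      rw [if_neg (h2 x hx).ne]; rfl
    · congr 1
      refine (List.map_congr_left fun x hx => ?_).trans (List.map_id v)
      rw [if_neg (h1 x hx).ne']; rfl
  rw [insertFilling, hmax]
  simp only [hmap]

lemma column_cases {c : List ℕ+} (hc : c.Pairwise (· < ·)) (a : ℕ+) :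
    (∀ x ∈ c, a < x) ∨ ∃ u a' v, c = u ++ a' :: v ∧ a' ≤ a ∧ ∀ x ∈ v, a < x := by
  induction c with
  | nil => simp
  | cons b c ih =>
    rw [List.pairwise_cons] at hc
    by_cases hb : a < b
    · left
      intro x hx
      rcases List.mem_cons.1 hx with rfl | hx
      · exact hb
      · exact hb.trans (hc.1 x hx)
    · right
      rcases ih hc.2 with h | ⟨u, a', v, rfl, h1, h2⟩
      · exact ⟨[], b, c, rfl, not_lt.1 hb, h⟩
      · exact ⟨b :: u, a', v, rfl, h1, h2⟩

lemma colGT_append (u v : List ℕ+) (k : ℕ) : colGT (u ++ v) k = colGT u k + colGT v k :=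
  List.countP_append

lemma colGT_cons (a : ℕ+) (u : List ℕ+) (k : ℕ) :
    colGT (a :: u) k = colGT u k + if k < (a : ℕ) then 1 else 0 := by
  rw [colGT, List.countP_cons]
  simp [colGT]

@[simp] lemma colGT_nil (k : ℕ) : colGT [] k = 0 := rfl

lemma colGT_zero (c : List ℕ+) : colGT c 0 = c.length := by
  rw [colGT, List.countP_eq_length]
  intro x _
  simp

lemma colGT_anti (c : List ℕ+) {k m : ℕ} (h : k ≤ m) : colGT c m ≤ colGT c k :=
  List.countP_mono_left fun x _ hx => by
    simp only [decide_eq_true_eq] at hx ⊢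
    omega

lemma colGT_eq_of_forall {c : List ℕ+} {k m : ℕ} (h : k ≤ m)
    (hc : ∀ x ∈ c, k < (x : ℕ) → m < (x : ℕ)) : colGT c k = colGT c m :=
  le_antisymm (List.countP_mono_left fun x hx h => by simpa using hc x hx (by simpa using h))
    (colGT_anti c h)

lemma colGT_lt_of_mem {c : List ℕ+} {b : ℕ+} (hb : b ∈ c) {k : ℕ} (h : k < b) :
    colGT c b < colGT c k := by
  obtain ⟨u, v, rfl⟩ := List.append_of_mem hb
  have h1 := colGT_anti u h.le
  have h2 := colGT_anti v h.le
  simp only [colGT_append, colGT_cons, h, if_true, lt_irrefl, if_false]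
  omega

/-- In a strict column the entries greater than `k` are the bottom ones. Thus `colGT` encodes the
column, and comparisons of bottom-aligned columns become inequalities between counting functions. -/
lemma lt_reverse_getElem_iff {c : List ℕ+} (hc : c.Pairwise (· < ·)) {r : ℕ} (hr : r < c.length)
    (k : ℕ) : k < ((c.reverse[r]'(by simpa using hr) : ℕ+) : ℕ) ↔ r < colGT c k := by
  induction c generalizing r with
  | nil => simp at hr
  | cons b c ih =>
    rw [List.pairwise_cons] at hc
    rw [colGT_cons]
    by_cases h : r < c.length
    · have : (b :: c).reverse[r]'(by simp; omega) = c.reverse[r]'(by simpa using h) := by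
        simp [h]
      rw [this, ih hc.2 h]
      split_ifs with hk
      · have : colGT c k = c.length := by
          rw [colGT, List.countP_eq_length]
          intro x hx
          simpa using hk.trans (PNat.coe_lt_coe _ _ |>.2 (hc.1 x hx))
        omega
      · omega
    · obtain rfl : r = c.length := by simp at hr; omega
      have : (b :: c).reverse[c.length]'(by simp) = b := by simp
      rw [this]
      have h1 : colGT c k ≤ c.length := List.countP_le_length
      constructor
      · intro hk
        rw [if_pos hk]
        have : colGT c k = c.length := by
          rw [colGT, List.countP_eq_length]
          intro x hx
          simpa using hk.trans (PNat.coe_lt_coe _ _ |>.2 (hc.1 x hx))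
        omega
      · intro h
        by_contra hk
        rw [if_neg hk] at h
        omega

/-- A filling with strict columns whose entries to the left are at most those to the right. -/
structure IsTableau (T : Filling) : Prop where
  strict : ∀ c ∈ T, c.Pairwise (· < ·)
  ne_nil : ∀ c ∈ T, c ≠ []
  dominates : T.Pairwise fun c d => ∀ k, colGT d k ≤ colGT c k

lemma insertFilling_strict {T : Filling} (hT : ∀ c ∈ T, c.Pairwise (· < ·)) (a : ℕ+) :
    ∀ c ∈ insertFilling T a, c.Pairwise (· < ·) := by
  induction T generalizing a with
  | nil => simp [insertFilling]
  | cons c T ih =>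
    have hc := hT c List.mem_cons_self
    have hT' : ∀ c ∈ T, c.Pairwise (· < ·) := fun d hd => hT d (List.mem_cons_of_mem _ hd)
    rcases column_cases hc a with h | ⟨u, a', v, rfl, h1, h2⟩
    · rw [insertFilling_top h]
      intro d hd
      rcases List.mem_cons.1 hd with rfl | hd
      · exact List.pairwise_cons.2 ⟨h, hc⟩
      · exact hT' d hd
    · rw [insertFilling_bump hc h1 h2]
      intro d hd
      rcases List.mem_cons.1 hd with rfl | hd
      · rw [List.pairwise_append, List.pairwise_cons] at hc ⊢
        refine ⟨hc.1, ⟨h2, hc.2.1.2⟩, fun x hx y hy => ?_⟩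
        rcases List.mem_cons.1 hy with rfl | hy
        · exact (hc.2.2 x hx a' List.mem_cons_self).trans_le h1
        · exact hc.2.2 x hx y (List.mem_cons_of_mem _ hy)
      · exact ih hT' a' d hd

lemma insertFilling_ne_nil {T : Filling} (hT : ∀ c ∈ T, c.Pairwise (· < ·))
    (hT2 : ∀ c ∈ T, c ≠ []) (a : ℕ+) : ∀ c ∈ insertFilling T a, c ≠ [] := by
  induction T generalizing a with
  | nil => simp [insertFilling]
  | cons c T ih =>
    have hc := hT c List.mem_cons_self
    have hT' : ∀ c ∈ T, c.Pairwise (· < ·) := fun d hd => hT d (List.mem_cons_of_mem _ hd)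
    have hT2' : ∀ c ∈ T, c ≠ [] := fun d hd => hT2 d (List.mem_cons_of_mem _ hd)
    rcases column_cases hc a with h | ⟨u, a', v, rfl, h1, h2⟩
    · rw [insertFilling_top h]
      intro d hd
      rcases List.mem_cons.1 hd with rfl | hd
      · simp
      · exact hT2' d hd
    · rw [insertFilling_bump hc h1 h2]
      intro d hd
      rcases List.mem_cons.1 hd with rfl | hd
      · simp
      · exact ih hT' hT2' a' d hd

/-- The right-most column evolves independently of the others; in terms of `colGT` its rule is the
recursion defining `chainLen`. -/
lemma insertFilling_eq_cons {T : Filling} (hT : ∀ c ∈ T, c.Pairwise (· < ·)) (a : ℕ+) :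
    ∃ c S, insertFilling T a = c :: S ∧ ∀ k, colGT c k =
      if k < a then max (colGT (T.headD []) k) (1 + colGT (T.headD []) a)
        else colGT (T.headD []) k := by
  cases T with
  | nil =>
    refine ⟨[a], [], rfl, fun k => ?_⟩
    simp only [colGT_cons, List.headD_nil, colGT_nil]
    split_ifs <;> omega
  | cons c T =>
    have hc := hT c List.mem_cons_self
    rw [List.headD_cons]
    rcases column_cases hc a with h | ⟨u, a', v, rfl, h1, h2⟩
    · refine ⟨_, _, insertFilling_top h T, fun k => ?_⟩
      rw [colGT_cons]
      split_ifs with hk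
      · rw [colGT_eq_of_forall hk.le fun x hx _ => PNat.coe_lt_coe _ _ |>.2 (h x hx)]
        omega
      · rfl
    · refine ⟨_, _, insertFilling_bump hc h1 h2 T, fun k => ?_⟩
      rw [List.pairwise_append] at hc
      have hu : ∀ x ∈ u, x < a' := fun x hx => hc.2.2 x hx a' List.mem_cons_self
      have h1' := PNat.coe_le_coe _ _ |>.2 h1
      split_ifs with hk
      · have e1 : colGT u a = 0 := by
          rw [colGT, List.countP_eq_zero]
          intro x hx
          have := PNat.coe_lt_coe _ _ |>.2 (hu x hx)
          simp
          exact ((hu x hx).trans_le h1).le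
        have e2 : colGT v k = colGT v a :=
          colGT_eq_of_forall hk.le fun x hx _ => PNat.coe_lt_coe _ _ |>.2 (h2 x hx)
        simp only [colGT_append, colGT_cons, e1, e2, hk, if_true, h1'.not_gt, if_false]
        by_cases hk2 : k < (a' : ℕ)
        · rw [if_pos hk2]; omega
        · have e3 : colGT u k = 0 := by
            rw [colGT, List.countP_eq_zero]
            intro x hx
            have := PNat.coe_lt_coe _ _ |>.2 (hu x hx)
            simp
            omega
          rw [if_neg hk2]; omega
      · have hk2 : ¬ k < (a' : ℕ) := by omega
        simp only [colGT_append, colGT_cons, hk, hk2, if_false]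

lemma isTableau_insertFilling {T : Filling} (hT : IsTableau T) (a : ℕ+) :
    IsTableau (insertFilling T a) := by
  refine ⟨insertFilling_strict hT.strict a, insertFilling_ne_nil hT.strict hT.ne_nil a, ?_⟩
  induction T generalizing a with
  | nil => simp [insertFilling]
  | cons c T ih =>
    have hc := hT.strict c List.mem_cons_self
    have hd := List.pairwise_cons.1 hT.dominates
    have hT' : IsTableau T := ⟨fun d hd => hT.strict d (List.mem_cons_of_mem _ hd),
      fun d hd => hT.ne_nil d (List.mem_cons_of_mem _ hd), hd.2⟩
    rcases column_cases hc a with h | ⟨u, b, v, rfl, h1, h2⟩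
    · rw [insertFilling_top h, List.pairwise_cons]
      refine ⟨fun d hdT k => (hd.1 d hdT k).trans ?_, hd.2⟩
      rw [colGT_cons]
      exact Nat.le_add_right _ _
    · rw [insertFilling_bump hc h1 h2]
      have ih := ih hT' b
      obtain ⟨d, S, hS, hd'⟩ := insertFilling_eq_cons hT'.strict b
      rw [hS] at ih ⊢
      have h1' := PNat.coe_le_coe _ _ |>.2 h1
      have hle : ∀ k, colGT (u ++ b :: v) k ≤ colGT (u ++ a :: v) k := by
        intro k
        simp only [colGT_append, colGT_cons]
        split_ifs <;> omega
      have hhead : ∀ k, colGT (T.headD []) k ≤ colGT (u ++ b :: v) k := by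
        cases T with
        | nil => simp
        | cons e T => exact hd.1 e List.mem_cons_self
      have hkey : ∀ k, colGT d k ≤ colGT (u ++ a :: v) k := by
        intro k
        rw [hd']
        refine le_trans ?_ (hle k)
        split_ifs with hk
        -- The bumped letter `b` is an entry of the old column greater than `k`, so raising the
        -- threshold from `k` to `b` loses at least one entry; this absorbs the `1`.
        · refine max_le (hhead k) ?_
          have := colGT_lt_of_mem (c := u ++ b :: v) (b := b) (by simp) hk
          have := hhead b
          omega
        · exact hhead k
      rw [List.pairwise_cons]
      refine ⟨fun e he k => ?_, ih⟩
      rcases List.mem_cons.1 he with rfl | he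
      · exact hkey k
      · exact ((List.pairwise_cons.1 ih).1 e he k).trans (hkey k)

lemma isTableau_tab (l : List ℕ+) : IsTableau (tab l) := by
  induction l with
  | nil => exact ⟨by simp [tab], by simp [tab], by simp [tab]⟩
  | cons a l ih => exact isTableau_insertFilling ih a

/-! ### The right-most column and the lengths of chains. -/

/-- The maximal length of a strictly increasing subsequence with letters greater than `k`. -/
def chainLen : List ℕ+ → ℕ → ℕ
  | [], _ => 0
  | a :: l, k => if k < a then max (chainLen l k) (1 + chainLen l a) else chainLen l k

/-- Schensted's theorem in the form needed, refined by the threshold `k`. -/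
lemma colGT_head_tab (l : List ℕ+) (k : ℕ) : colGT ((tab l).headD []) k = chainLen l k := by
  induction l generalizing k with
  | nil => rfl
  | cons a l ih =>
    obtain ⟨c, S, h, hc⟩ := insertFilling_eq_cons (isTableau_tab l).strict a
    rw [tab_cons, h, List.headD_cons, hc, chainLen, ih, ih]

/-- In the order `OmegaLE'` a later pair with larger second component has larger first component,
since equal rows are read with decreasing columns. So increasing subsequences are chains. -/
lemma le_chainLen_iff {L : List (ℕ+ × ℕ+)} (hL : L.Pairwise OmegaLE') (k m : ℕ) :
    m ≤ chainLen (L.map Prod.snd) k ↔ ∃ s : Finset (ℕ+ × ℕ+), m ≤ s.card ∧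
      (∀ x ∈ s, x ∈ L ∧ k < (x.2 : ℕ)) ∧
      ∀ x ∈ s, ∀ y ∈ s, x ≠ y → (x.1 < y.1 ∧ x.2 < y.2) ∨ (y.1 < x.1 ∧ y.2 < x.2) := by
  classical
  induction L generalizing k m with
  | nil =>
    rw [List.map_nil, chainLen, Nat.le_zero]
    constructor
    · rintro rfl
      exact ⟨∅, by simp, by simp, by simp⟩
    · rintro ⟨s, h1, h2, -⟩
      have : s = ∅ := Finset.eq_empty_of_forall_notMem fun x hx => by simpa using (h2 x hx).1
      simpa [this] using h1
  | cons z L ih =>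
    rw [List.pairwise_cons] at hL
    have ih := fun k m => ih hL.2 k m
    rw [List.map_cons, chainLen]
    constructor
    · intro hm
      have hor : m ≤ chainLen (L.map Prod.snd) k ∨
          (k < (z.2 : ℕ) ∧ m - 1 ≤ chainLen (L.map Prod.snd) z.2) := by
        split_ifs at hm with hk
        · rcases le_max_iff.1 hm with h | h
          · exact Or.inl h
          · exact Or.inr ⟨hk, by omega⟩
        · exact Or.inl hm
      rcases hor with h | ⟨hk, h⟩
      · obtain ⟨s, h1, h2, h3⟩ := (ih _ _).1 h
        exact ⟨s, h1, fun x hx => ⟨List.mem_cons_of_mem _ (h2 x hx).1, (h2 x hx).2⟩, h3⟩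
      · obtain ⟨s, h1, h2, h3⟩ := (ih _ _).1 h
        have hz : ∀ y ∈ s, z.1 < y.1 ∧ z.2 < y.2 := by
          intro y hy
          have h4 := PNat.coe_lt_coe _ _ |>.1 (h2 y hy).2
          rcases hL.1 y (h2 y hy).1 with h | h
          · exact ⟨h, h4⟩
          · exact absurd h4 h.2.not_gt
        have hzs : z ∉ s := fun h => lt_irrefl _ (hz z h).1
        refine ⟨insert z s, ?_, ?_, ?_⟩
        · rw [Finset.card_insert_of_notMem hzs]; omega
        · intro x hx
          rcases Finset.mem_insert.1 hx with rfl | hx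
          · exact ⟨List.mem_cons_self, hk⟩
          · exact ⟨List.mem_cons_of_mem _ (h2 x hx).1, hk.trans (h2 x hx).2⟩
        · intro x hx y hy hxy
          rcases Finset.mem_insert.1 hx with rfl | hx' <;> rcases Finset.mem_insert.1 hy with rfl | hy'
          · exact absurd rfl hxy
          · exact Or.inl (hz y hy')
          · exact Or.inr (hz x hx')
          · exact h3 x hx' y hy' hxy
    · rintro ⟨s, h1, h2, h3⟩
      by_cases hz : z ∈ s
      · have hk := (h2 z hz).2
        have h4 : m - 1 ≤ chainLen (L.map Prod.snd) z.2 := by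
          refine (ih _ _).2 ⟨s.erase z, ?_, fun y hy => ?_, fun x hx y hy => ?_⟩
          · rw [Finset.card_erase_of_mem hz]; omega
          · rw [Finset.mem_erase] at hy
            have hyL : y ∈ L := by
              rcases List.mem_cons.1 (h2 y hy.2).1 with h | h
              · exact absurd h hy.1
              · exact h
            refine ⟨hyL, PNat.coe_lt_coe _ _ |>.2 ?_⟩
            rcases h3 y hy.2 z hz hy.1 with h | h
            · rcases hL.1 y hyL with h' | h'
              · exact absurd h.1 h'.not_gt
              · exact absurd h.1 h'.1.not_gt
            · exact h.2
          · exact h3 x (Finset.mem_of_mem_erase hx) y (Finset.mem_of_mem_erase hy)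
        rw [if_pos hk]
        exact le_max_of_le_right (by omega)
      · have h4 : m ≤ chainLen (L.map Prod.snd) k := by
          refine (ih _ _).2 ⟨s, h1, fun y hy => ⟨?_, (h2 y hy).2⟩, h3⟩
          rcases List.mem_cons.1 (h2 y hy).1 with rfl | h
          · exact absurd hy hz
          · exact h
        split_ifs
        · exact le_max_of_le_left h4
        · exact h4

lemma hasChain_iff (A : Mat) (k m : ℕ) :
    HasChain A 0 k m ↔ m ≤ colGT ((tab (lWord A)).headD []) k := by
  rw [colGT_head_tab, lWord, le_chainLen_iff (biword'_pairwise A), HasChain]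
  simp only [mem_biword', PNat.pos, true_and]

/-- For symmetric `A` the row bounds repeat the column bounds, which the right-most column encodes.
-/
lemma mem_ladder_iff_tab {A : Mat} (hA : transpose A = A) {a : Finset ℕ+} :
    A ∈ ladder a a ↔ ∀ k, colGT ((tab (lWord A)).headD []) k ≤ numGT a k := by
  have h : ∀ k m, HasChain A k 0 m ↔ HasChain A 0 k m := fun k m =>
    ⟨fun h => by simpa [hA] using h.transpose, fun h => by simpa [hA] using h.transpose⟩
  constructor
  · exact fun hl k => (hl k _).1 ((hasChain_iff A k _).2 le_rfl)
  · intro hk k m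
    rw [h]
    exact ⟨fun hc => ((hasChain_iff A k m).1 hc).trans (hk k),
      fun hc => ((hasChain_iff A k m).1 hc).trans (hk k)⟩

/-! ### Inserting the columns of a tableau -/

/-- The letters of `s`, inserted from the bottom up, replace the entries of `d₂` one by one, and
these enter the next columns in the same order. -/
lemma foldr_insertFilling_column {s d₂ : List ℕ+} (h : List.Forall₂ (· ≤ ·) d₂ s)
    (hs : s.Pairwise (· < ·)) (d₁ : List ℕ+) (hd : (d₁ ++ d₂).Pairwise (· < ·)) (R : Filling) :
    s.foldr (fun a T => insertFilling T a) ((d₁ ++ d₂) :: R) =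
      (d₁ ++ s) :: d₂.foldr (fun a T => insertFilling T a) R := by
  induction h generalizing d₁ with
  | nil => rfl
  | @cons b a d₂ s hba h ih =>
    rw [List.pairwise_cons] at hs
    have ih := ih hs.2 (d₁ ++ [b]) (by simpa using hd)
    simp only [List.append_assoc, List.cons_append, List.nil_append] at ih
    rw [List.foldr_cons, ih, insertFilling_bump _ hba hs.1, List.foldr_cons]
    rw [List.pairwise_append, List.pairwise_cons] at hd ⊢
    refine ⟨hd.1, ⟨fun x hx => hba.trans_lt (hs.1 x hx), hs.2⟩, fun x hx y hy => ?_⟩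
    have hxb := hd.2.2 x hx b List.mem_cons_self
    rcases List.mem_cons.1 hy with rfl | hy
    · exact hxb
    · exact hxb.trans_le (hba.trans (hs.1 y hy).le)

lemma foldr_insertFilling_top {c s : List ℕ+} (h : (c ++ s).Pairwise (· < ·)) (R : Filling) :
    c.foldr (fun a T => insertFilling T a) (s :: R) = (c ++ s) :: R := by
  induction c with
  | nil => rfl
  | cons a c ih =>
    rw [List.cons_append, List.pairwise_cons] at h
    rw [List.foldr_cons, ih h.2, insertFilling_top h.1]
    rfl

lemma IsTableau.tail {c : List ℕ+} {T : Filling} (hT : IsTableau (c :: T)) : IsTableau T :=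
  ⟨fun d hd => hT.strict d (List.mem_cons_of_mem _ hd),
    fun d hd => hT.ne_nil d (List.mem_cons_of_mem _ hd), (List.pairwise_cons.1 hT.dominates).2⟩

/-- Dominance means that `d` is bounded entrywise by the bottom part of `c` of the same length. -/
lemma exists_forall₂_of_colGT_le {c d : List ℕ+} (hc : c.Pairwise (· < ·))
    (hd : d.Pairwise (· < ·)) (h : ∀ k, colGT d k ≤ colGT c k) :
    ∃ c₀ s, c = c₀ ++ s ∧ List.Forall₂ (· ≤ ·) d s := by
  have hlen : d.length ≤ c.length := by simpa [colGT_zero] using h 0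
  refine ⟨c.take (c.length - d.length), c.drop (c.length - d.length), by simp, ?_⟩
  rw [List.forall₂_iff_get]
  refine ⟨by simp; omega, fun i h1 h2 => ?_⟩
  by_contra hcon
  simp only [List.get_eq_getElem, List.getElem_drop, not_le] at hcon
  rw [← PNat.coe_lt_coe] at hcon
  have e1 := lt_reverse_getElem_iff hd (r := d.length - 1 - i) (by omega)
    (((c)[c.length - d.length + i]'(by omega) : ℕ+) : ℕ)
  have e2 := lt_reverse_getElem_iff hc (r := d.length - 1 - i) (by omega)
    (((c)[c.length - d.length + i]'(by omega) : ℕ+) : ℕ)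
  simp only [List.getElem_reverse] at e1 e2
  have i1 : d.length - 1 - (d.length - 1 - i) = i := by omega
  have i2 : c.length - 1 - (d.length - 1 - i) = c.length - d.length + i := by omega
  simp only [i1] at e1
  simp only [i2, lt_self_iff_false, false_iff] at e2
  exact e2 ((e1.1 hcon).trans_le (h _))

/-- Reading a tableau column by column and inserting recovers it: the bottom part of a new column
pushes the previous first column whole to the left, where the same happens again, and the rest is
put on top. -/
lemma tab_flatten {T : Filling} (hT : IsTableau T) : tab T.flatten = T := by
  induction T with
  | nil => rfl
  | cons c T ih =>
    have ih := ih hT.tail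
    have hc := hT.strict c List.mem_cons_self
    rw [tab] at ih ⊢
    rw [List.flatten_cons, List.foldr_append, ih]
    clear ih
    cases T with
    | nil =>
      obtain ⟨c₀, x, rfl⟩ := (List.eq_nil_or_concat' c).resolve_left
        (hT.ne_nil c List.mem_cons_self)
      rw [List.foldr_append]
      exact foldr_insertFilling_top hc []
    | cons d T =>
      have key : ∀ (R : Filling) (c d : List ℕ+), IsTableau (c :: d :: R) →
          c.foldr (fun a T => insertFilling T a) (d :: R) = c :: d :: R := by
        intro R
        induction R with
        | nil =>
          intro c d h
          have hc := h.strict c List.mem_cons_self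
          have hd := h.strict d (by simp)
          obtain ⟨c₀, s, rfl, hs⟩ := exists_forall₂_of_colGT_le hc hd
            ((List.pairwise_cons.1 h.dominates).1 d List.mem_cons_self)
          -- The expelled column meets no further column: its bottom letter starts a new one, and
          -- the others go on top.
          obtain ⟨d₀, x, rfl⟩ := (List.eq_nil_or_concat' d).resolve_left (h.ne_nil d (by simp))
          have h1 := foldr_insertFilling_column hs (List.pairwise_append.1 hc).2.1 [] hd []
          rw [List.nil_append, List.nil_append] at h1
          rw [List.foldr_append, h1, foldr_insertFilling_top hc, List.foldr_append]
          congr 1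
          exact foldr_insertFilling_top hd []
        | cons e R ih =>
          intro c d h
          have hc := h.strict c List.mem_cons_self
          have hd := h.strict d (by simp)
          obtain ⟨c₀, s, rfl, hs⟩ := exists_forall₂_of_colGT_le hc hd
            ((List.pairwise_cons.1 h.dominates).1 d List.mem_cons_self)
          have h1 := foldr_insertFilling_column hs (List.pairwise_append.1 hc).2.1 [] hd (e :: R)
          rw [List.nil_append, List.nil_append] at h1
          rw [List.foldr_append, h1, foldr_insertFilling_top hc, ih d e h.tail]
      exact key T c d hT

/-! ### Knuth equivalence -/

/-- Knuth equivalence of words, read along the columns of tableaux of anti-normal shape. -/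
inductive Knuth : List ℕ+ → List ℕ+ → Prop
  | left (p s : List ℕ+) {a x y : ℕ+} (h₁ : x < y) (h₂ : y ≤ a) :
      Knuth (p ++ a :: x :: y :: s) (p ++ x :: a :: y :: s)
  | right (p s : List ℕ+) {a b y : ℕ+} (h₁ : b ≤ a) (h₂ : a < y) :
      Knuth (p ++ a :: b :: y :: s) (p ++ a :: y :: b :: s)
  | refl (l : List ℕ+) : Knuth l l
  | symm {l m : List ℕ+} : Knuth l m → Knuth m l
  | trans {l m n : List ℕ+} : Knuth l m → Knuth m n → Knuth l n

namespace Knuth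

lemma append_left {l m : List ℕ+} (h : Knuth l m) (p : List ℕ+) : Knuth (p ++ l) (p ++ m) := by
  induction h with
  | left q s h₁ h₂ => simpa only [List.append_assoc, List.cons_append] using left (p ++ q) s h₁ h₂
  | right q s h₁ h₂ => simpa only [List.append_assoc, List.cons_append] using right (p ++ q) s h₁ h₂
  | refl l => exact refl _
  | symm _ ih => exact ih.symm
  | trans _ _ ih₁ ih₂ => exact ih₁.trans ih₂

lemma append_right {l m : List ℕ+} (h : Knuth l m) (s : List ℕ+) : Knuth (l ++ s) (m ++ s) := by
  induction h with
  | left q t h₁ h₂ => simpa only [List.append_assoc, List.cons_append] using left q (t ++ s) h₁ h₂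
  | right q t h₁ h₂ => simpa only [List.append_assoc, List.cons_append] using right q (t ++ s) h₁ h₂
  | refl l => exact refl _
  | symm _ ih => exact ih.symm
  | trans _ _ ih₁ ih₂ => exact ih₁.trans ih₂

lemma cons {l m : List ℕ+} (h : Knuth l m) (a : ℕ+) : Knuth (a :: l) (a :: m) :=
  h.append_left [a]

lemma perm {l m : List ℕ+} (h : Knuth l m) : l.Perm m := by
  induction h with
  | left p s h₁ h₂ => exact (List.Perm.swap _ _ _).append_left p
  | right p s h₁ h₂ => exact ((List.Perm.swap _ _ _).cons _).append_left p
  | refl l => exact List.Perm.refl _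
  | symm _ ih => exact ih.symm
  | trans _ _ ih₁ ih₂ => exact ih₁.trans ih₂

end Knuth

lemma height_eq_of_perm {l m : List ℕ+} (h : l.Perm m) (i : ℕ+) : height i l = height i m := by
  induction h with
  | nil => rfl
  | cons a _ ih => rw [height_cons, height_cons i a, ih]
  | swap a b l => rw [height_cons, height_cons, height_cons i a (b :: l), height_cons i b l]; ring
  | trans _ _ ih₁ ih₂ => exact ih₁.trans ih₂

/-- A finite check: only the order of the three letters and their coincidences with `i` and `i + 1`
matter. -/
lemma knuth_letters_left (i : ℕ+) {a x y : ℕ+} (h₁ : x < y) (h₂ : y ≤ a) :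
    wordEps i [a, x, y] = wordEps i [x, a, y] ∧
      Option.Rel Knuth (wordF i [a, x, y]) (wordF i [x, a, y]) := by
  have hlt : i < i + 1 := pnat_lt_succ i
  have hi : i + 1 ≠ i := hlt.ne'
  have hi' : i ≠ i + 1 := hlt.ne
  have hle : ∀ z : ℕ+, i < z → i + 1 ≤ z := fun z hz => PNat.add_one_le_iff.2 hz
  have L : ∀ {a x y : ℕ+}, x < y → y ≤ a → Knuth [a, x, y] [x, a, y] := fun h h' => .left [] [] h h'
  have R : ∀ {a b y : ℕ+}, b ≤ a → a < y → Knuth [a, b, y] [a, y, b] := fun h h' => .right [] [] h h'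
  have S := fun {l m} => @Knuth.symm l m
  have Q := Knuth.refl
  by_cases a1 : a = i <;> by_cases a2 : a = i + 1 <;> by_cases x1 : x = i <;>
    by_cases x2 : x = i + 1 <;> by_cases y1 : y = i <;> by_cases y2 : y = i + 1 <;>
    simp [wordF, wordEps, letterF, letterPhi, letterEps, a1, a2, x1, x2, y1, y2, hi, hi'] <;>
    grind

lemma knuth_letters_right (i : ℕ+) {a b y : ℕ+} (h₁ : b ≤ a) (h₂ : a < y) :
    wordEps i [a, b, y] = wordEps i [a, y, b] ∧
      Option.Rel Knuth (wordF i [a, b, y]) (wordF i [a, y, b]) := by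
  have hlt : i < i + 1 := pnat_lt_succ i
  have hi : i + 1 ≠ i := hlt.ne'
  have hi' : i ≠ i + 1 := hlt.ne
  have hle : ∀ z : ℕ+, i < z → i + 1 ≤ z := fun z hz => PNat.add_one_le_iff.2 hz
  have L : ∀ {a x y : ℕ+}, x < y → y ≤ a → Knuth [a, x, y] [x, a, y] := fun h h' => .left [] [] h h'
  have R : ∀ {a b y : ℕ+}, b ≤ a → a < y → Knuth [a, b, y] [a, y, b] := fun h h' => .right [] [] h h'
  have S := fun {l m} => @Knuth.symm l m
  have Q := Knuth.refl
  by_cases a1 : a = i <;> by_cases a2 : a = i + 1 <;> by_cases x1 : b = i <;>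
    by_cases x2 : b = i + 1 <;> by_cases y1 : y = i <;> by_cases y2 : y = i + 1 <;>
    simp [wordF, wordEps, letterF, letterPhi, letterEps, a1, a2, x1, x2, y1, y2, hi, hi'] <;>
    grind

/-- The tensor product rule sees the middle factor only through its height and `ε_i`, which agree
for the two words, so `f̃_i` acts in the same factor of both. -/
lemma option_rel_knuth_context {t u : List ℕ+} (i : ℕ+) (hE : wordEps i t = wordEps i u)
    (hF : Option.Rel Knuth (wordF i t) (wordF i u)) (ht : Knuth t u) (p s : List ℕ+) :
    wordEps i (p ++ (t ++ s)) = wordEps i (p ++ (u ++ s)) ∧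
      Option.Rel Knuth (wordF i (p ++ (t ++ s))) (wordF i (p ++ (u ++ s))) := by
  have hh := height_eq_of_perm ht.perm i
  have e1 : wordEps i (t ++ s) = wordEps i (u ++ s) := by
    rw [wordEps_append, wordEps_append, hE, hh]
  have e2 : Option.Rel Knuth (wordF i (t ++ s)) (wordF i (u ++ s)) := by
    rw [wordF_append, wordF_append, hE, hh]
    split_ifs
    · generalize wordF i t = t' at hF
      generalize wordF i u = u' at hF
      cases hF with
      | none => exact .none
      | some h => exact .some (h.append_right s)
    · cases wordF i s with
      | none => exact .none
      | some v => exact .some (ht.append_right v)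
  refine ⟨by rw [wordEps_append i p, wordEps_append i p, e1], ?_⟩
  rw [wordF_append i p, wordF_append i p, e1]
  split_ifs
  · cases wordF i p with
    | none => exact .none
    | some v => exact .some ((ht.append_right s).append_left v)
  · generalize wordF i (t ++ s) = t' at e2
    generalize wordF i (u ++ s) = u' at e2
    cases e2 with
    | none => exact .none
    | some h => exact .some (h.append_left p)

lemma Knuth.crystal {l m : List ℕ+} (h : Knuth l m) (i : ℕ+) :
    wordEps i l = wordEps i m ∧ Option.Rel Knuth (wordF i l) (wordF i m) := by
  induction h with
  | left p s h₁ h₂ =>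
    obtain ⟨hE, hF⟩ := knuth_letters_left i h₁ h₂
    exact option_rel_knuth_context i hE hF (Knuth.left [] [] h₁ h₂) p s
  | right p s h₁ h₂ =>
    obtain ⟨hE, hF⟩ := knuth_letters_right i h₁ h₂
    exact option_rel_knuth_context i hE hF (Knuth.right [] [] h₁ h₂) p s
  | refl l =>
    refine ⟨rfl, ?_⟩
    cases wordF i l with
    | none => exact .none
    | some v => exact .some (.refl v)
  | @symm l m _ ih =>
    refine ⟨ih.1.symm, ?_⟩
    have := ih.2
    generalize wordF i l = t' at this
    generalize wordF i m = u' at this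
    cases this with
    | none => exact .none
    | some h => exact .some h.symm
  | @trans l m n _ _ ih₁ ih₂ =>
    refine ⟨ih₁.1.trans ih₂.1, ?_⟩
    have h1 := ih₁.2
    have h2 := ih₂.2
    generalize wordF i l = t' at h1
    generalize wordF i m = u' at h1 h2
    generalize wordF i n = v' at h2
    cases h1 with
    | none => cases h2; exact .none
    | some h => cases h2 with | some h' => exact .some (h.trans h')

lemma Knuth.wordEps_eq {l m : List ℕ+} (h : Knuth l m) (i : ℕ+) : wordEps i l = wordEps i m :=
  (h.crystal i).1

lemma Knuth.exists_wordF {l l' m : List ℕ+} (h : Knuth l m) {i : ℕ+} (hl : wordF i l = some l') :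
    ∃ m', wordF i m = some m' ∧ Knuth l' m' := by
  have := (h.crystal i).2
  rw [hl] at this
  generalize wordF i m = u at this
  cases this with
  | some h => exact ⟨_, rfl, h⟩

/-! ### Insertion and Knuth equivalence -/

/-- The inserted letter `a` travels down to its place by moves of type `left`, and the expelled `a'`
goes on to the bottom by moves of type `right`. -/
lemma knuth_bump {a a' : ℕ+} {u v : List ℕ+} (hc : (u ++ a' :: v).Pairwise (· < ·))
    (ha : a' ≤ a) (hv : ∀ x ∈ v, a < x) :
    Knuth (a :: (u ++ a' :: v)) (u ++ a :: v ++ [a']) := by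
  induction u with
  | nil =>
    rw [List.nil_append, List.nil_append] at *
    replace hc := (List.pairwise_cons.1 hc).2
    induction v generalizing a with
    | nil => exact .refl _
    | cons y v ih =>
      rw [List.pairwise_cons] at hc
      have hay := hv y List.mem_cons_self
      exact (Knuth.right [] v ha hay).trans ((ih (ha.trans hay.le) hc.1 hc.2).cons a)
  | cons x u ih =>
    rw [List.cons_append, List.pairwise_cons] at hc
    refine Knuth.trans ?_ ((ih hc.2).cons x)
    cases u with
    | nil => exact Knuth.left [] v (hc.1 a' List.mem_cons_self) ha
    | cons y u =>
      refine Knuth.left [] (u ++ a' :: v) (hc.1 y List.mem_cons_self) ?_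
      exact ((List.pairwise_cons.1 hc.2).1 a' (by simp)).le.trans ha

lemma knuth_insertFilling {T : Filling} (hT : ∀ c ∈ T, c.Pairwise (· < ·)) (a : ℕ+) :
    Knuth (a :: T.flatten) (insertFilling T a).flatten := by
  induction T generalizing a with
  | nil => exact .refl _
  | cons c T ih =>
    have hc := hT c List.mem_cons_self
    have ih := ih fun d hd => hT d (List.mem_cons_of_mem _ hd)
    rcases column_cases hc a with h | ⟨u, a', v, rfl, h1, h2⟩
    · rw [insertFilling_top h]
      exact .refl _
    · rw [insertFilling_bump hc h1 h2, List.flatten_cons, List.flatten_cons]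
      refine ((knuth_bump hc h1 h2).append_right T.flatten).trans ?_
      rw [List.append_assoc]
      exact (ih a').append_left _

lemma knuth_tab (l : List ℕ+) : Knuth l (tab l).flatten := by
  induction l with
  | nil => exact .refl _
  | cons a l ih => exact (ih.cons a).trans (knuth_insertFilling (isTableau_tab l).strict a)

lemma insertFilling_replace {a b : ℕ+} {u v : List ℕ+} (hu : ∀ x ∈ u, x < b) (hb : b ≤ a)
    (hv : ∀ x ∈ v, a < x) (hvs : v.Pairwise (· < ·)) (hus : u.Pairwise (· < ·)) (T : Filling) :
    insertFilling ((u ++ b :: v) :: T) a = (u ++ a :: v) :: insertFilling T b := by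
  refine insertFilling_bump ?_ hb hv T
  rw [List.pairwise_append, List.pairwise_cons]
  refine ⟨hus, ⟨fun x hx => hb.trans_lt (hv x hx), hvs⟩, fun x hx y hy => ?_⟩
  rcases List.mem_cons.1 hy with rfl | hy
  · exact hu x hx
  · exact (hu x hx).trans (hb.trans_lt (hv y hy))

lemma column_cases_cons {b : ℕ+} {c : List ℕ+} (hc : (b :: c).Pairwise (· < ·)) {a : ℕ+}
    (h : b ≤ a) : ∃ u a' v, b :: c = u ++ a' :: v ∧ a' ≤ a ∧ b ≤ a' ∧ ∀ x ∈ v, a < x := by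
  rcases column_cases hc a with h' | ⟨u, a', v, he, h1, h2⟩
  · exact absurd (h' b List.mem_cons_self) h.not_gt
  · refine ⟨u, a', v, he, h1, ?_, h2⟩
    have hm : a' ∈ b :: c := by simp [he]
    rcases List.mem_cons.1 hm with rfl | hm
    · exact le_rfl
    · exact ((List.pairwise_cons.1 hc).1 a' hm).le

lemma insertFilling_comm_of_lt {c : List ℕ+} (hc : c.Pairwise (· < ·)) {a x y : ℕ+}
    (hx : ∀ z ∈ c, x < z) (hxa : x < a) (hy : y ∈ c) (hya : y ≤ a) (T : Filling) :
    insertFilling (insertFilling (c :: T) x) a = insertFilling (insertFilling (c :: T) a) x := by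
  rcases column_cases hc a with h | ⟨u, a', v, rfl, h1, h2⟩
  · exact absurd (h y hy) hya.not_gt
  · have e1 : insertFilling ((x :: (u ++ a' :: v)) :: T) a =
        (x :: (u ++ a :: v)) :: insertFilling T a' := by
      have := insertFilling_bump (u := x :: u) (List.pairwise_cons.2 ⟨hx, hc⟩) h1 h2 T
      simpa only [List.cons_append] using this
    have e2 : insertFilling ((u ++ a :: v) :: insertFilling T a') x =
        (x :: (u ++ a :: v)) :: insertFilling T a' := by
      refine insertFilling_top (fun z hz => ?_) _
      simp only [List.mem_append, List.mem_cons] at hz hx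
      grind
    rw [insertFilling_top hx, insertFilling_bump hc h1 h2, e1, e2]

/-- Induction on the columns. In the first column the two orders of insertion leave the same
entries, and the letters sent to the next column either coincide or are again related by an
elementary Knuth move; the type of the move may change, so both are treated together. -/
lemma insertFilling_knuth {T : Filling} (hT : ∀ c ∈ T, c.Pairwise (· < ·)) :
    (∀ {a x y : ℕ+}, x < y → y ≤ a → insertFilling (insertFilling (insertFilling T y) x) a =
      insertFilling (insertFilling (insertFilling T y) a) x) ∧
    ∀ {a b y : ℕ+}, b ≤ a → a < y → insertFilling (insertFilling (insertFilling T y) b) a =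
      insertFilling (insertFilling (insertFilling T b) y) a := by
  induction T with
  | nil =>
    constructor
    · intro a x y h1 h2
      exact insertFilling_comm_of_lt (c := [y]) (y := y) (by simp) (by simpa using h1)
        (h1.trans_le h2) (by simp) h2 []
    · intro a b y h1 h2
      have e1 : insertFilling [[y]] b = [[b, y]] := insertFilling_top (by simpa using h1.trans_lt h2) []
      have e2 : insertFilling [[b, y]] a = [a, y] :: insertFilling [] b :=
        insertFilling_replace (u := []) (v := [y]) (by simp) h1 (by simpa) (by simp) (by simp) []
      have e3 : insertFilling [[b]] y = [y] :: insertFilling [] b :=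
        insertFilling_replace (u := []) (v := []) (by simp) (h1.trans h2.le) (by simp) (by simp)
          (by simp) []
      have e4 : insertFilling ([y] :: insertFilling [] b) a = [a, y] :: insertFilling [] b :=
        insertFilling_top (by simpa) _
      change insertFilling (insertFilling [[y]] b) a = insertFilling (insertFilling [[b]] y) a
      rw [e1, e2, e3, e4]
  | cons c T ih =>
    have hc := hT c List.mem_cons_self
    obtain ⟨ihl, ihr⟩ := ih fun d hd => hT d (List.mem_cons_of_mem _ hd)
    constructor
    · intro a x y hxy hya
      rcases column_cases hc y with h | ⟨u, y', v, rfl, hy', hv⟩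
      · rw [insertFilling_top h]
        refine insertFilling_comm_of_lt (List.pairwise_cons.2 ⟨h, hc⟩) ?_ (hxy.trans_le hya)
          List.mem_cons_self hya T
        intro z hz
        rcases List.mem_cons.1 hz with rfl | hz
        · exact hxy
        · exact hxy.trans (h z hz)
      · rw [insertFilling_bump hc hy' hv]
        simp only [List.pairwise_append, List.pairwise_cons, List.mem_cons] at hc
        obtain ⟨hus, ⟨-, hvs⟩, huv⟩ := hc
        have huy : ∀ z ∈ u, z < y' := fun z hz => huv z hz y' (Or.inl rfl)
        have hc1 : (u ++ y :: v).Pairwise (· < ·) := by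
          simp only [List.pairwise_append, List.pairwise_cons, List.mem_cons]
          exact ⟨hus, ⟨hv, hvs⟩, by grind⟩
        rcases column_cases hus x with hx | ⟨u₁, x', u₂, rfl, hx', hu₂⟩
        · refine insertFilling_comm_of_lt hc1 ?_ (hxy.trans_le hya) (y := y) (by simp) hya _
          simp only [List.mem_append, List.mem_cons]
          grind
        · obtain ⟨p, a', q, hpq, ha', hya', hq⟩ :=
            column_cases_cons (List.pairwise_append.1 hc1).2.1 hya
          have hpq' : ∀ z, z ∈ p ++ a' :: q → y ≤ z := by
            rw [← hpq]
            intro z hz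
            rcases List.mem_cons.1 hz with rfl | hz
            · exact le_rfl
            · exact (hv z hz).le
          rw [hpq] at hc1 ⊢
          simp only [List.pairwise_append, List.pairwise_cons, List.mem_append, List.mem_cons]
            at hc1 huy hus hpq'
          have e1 : insertFilling ((u₁ ++ x' :: u₂ ++ (p ++ a' :: q)) :: insertFilling T y') x =
              (u₁ ++ x :: (u₂ ++ (p ++ a' :: q))) :: insertFilling (insertFilling T y') x' := by
            rw [List.append_assoc, List.cons_append, insertFilling_replace _ hx']
            all_goals
              try simp only [List.pairwise_append, List.pairwise_cons, List.mem_append, List.mem_cons]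
              grind
          have e2 : insertFilling ((u₁ ++ x :: (u₂ ++ (p ++ a' :: q))) ::
              insertFilling (insertFilling T y') x') a = (u₁ ++ x :: (u₂ ++ (p ++ a :: q))) ::
              insertFilling (insertFilling (insertFilling T y') x') a' := by
            have := insertFilling_replace (u := u₁ ++ x :: (u₂ ++ p)) (b := a') (v := q) (a := a)
            simp only [List.append_assoc, List.cons_append] at this
            rw [this _ ha' hq]
            all_goals
              try simp only [List.pairwise_append, List.pairwise_cons, List.mem_append, List.mem_cons]
              grind
          have e3 : insertFilling ((u₁ ++ x' :: u₂ ++ (p ++ a' :: q)) :: insertFilling T y') a =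
              (u₁ ++ x' :: (u₂ ++ (p ++ a :: q))) :: insertFilling (insertFilling T y') a' := by
            have := insertFilling_replace (u := u₁ ++ x' :: (u₂ ++ p)) (b := a') (v := q) (a := a)
            simp only [List.append_assoc, List.cons_append] at this ⊢
            rw [this _ ha' hq]
            all_goals
              try simp only [List.pairwise_append, List.pairwise_cons, List.mem_append, List.mem_cons]
              grind
          have e4 : insertFilling ((u₁ ++ x' :: (u₂ ++ (p ++ a :: q))) ::
              insertFilling (insertFilling T y') a') x = (u₁ ++ x :: (u₂ ++ (p ++ a :: q))) ::
              insertFilling (insertFilling (insertFilling T y') a') x' := by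
            rw [insertFilling_replace _ hx']
            all_goals
              try simp only [List.pairwise_append, List.pairwise_cons, List.mem_append, List.mem_cons]
              grind
          -- The expelled letters are `y', x', a'` and `y', a', x'`, with `x' < y' ≤ a'`.
          rw [e1, e2, e3, e4, ihl (by grind) (hy'.trans hya')]
    · intro a b y hba hay
      rcases column_cases hc y with h | ⟨u, y', v, rfl, hy', hv⟩
      · have hby := hba.trans_lt hay
        have e1 : insertFilling ((y :: c) :: T) b = (b :: y :: c) :: T := by
          refine insertFilling_top ?_ T
          simp only [List.mem_cons]
          grind
        have e2 : insertFilling ((b :: y :: c) :: T) a = (a :: y :: c) :: insertFilling T b := by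
          refine insertFilling_replace (u := []) (by simp) hba ?_ ?_ (by simp) T
          · simp only [List.mem_cons]
            grind
          · exact List.pairwise_cons.2 ⟨h, hc⟩
        have e3 : insertFilling (c :: T) b = (b :: c) :: T :=
          insertFilling_top (fun z hz => hby.trans (h z hz)) T
        have e4 : insertFilling ((b :: c) :: T) y = (y :: c) :: insertFilling T b :=
          insertFilling_replace (u := []) (by simp) hby.le h hc (by simp) T
        have e5 : insertFilling ((y :: c) :: insertFilling T b) a =
            (a :: y :: c) :: insertFilling T b := by
          refine insertFilling_top ?_ _
          simp only [List.mem_cons]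
          grind
        rw [insertFilling_top h, e1, e2, e3, e4, e5]
      · rw [insertFilling_bump hc hy' hv]
        simp only [List.pairwise_append, List.pairwise_cons, List.mem_cons] at hc
        obtain ⟨hus, ⟨hyv, hvs⟩, huv⟩ := hc
        have huy : ∀ z ∈ u, z < y' := fun z hz => huv z hz y' (Or.inl rfl)
        by_cases hb : y' ≤ b
        · rcases List.eq_nil_or_concat' u with rfl | ⟨u₁, z, rfl⟩
          · have e1 : insertFilling (([] ++ y :: v) :: insertFilling T y') b =
                (b :: y :: v) :: insertFilling T y' := by
              refine insertFilling_top ?_ _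
              simp only [List.nil_append, List.mem_cons]
              grind
            have e2 : insertFilling ((b :: y :: v) :: insertFilling T y') a =
                (a :: y :: v) :: insertFilling (insertFilling T y') b := by
              refine insertFilling_replace (u := []) (by simp) hba ?_ ?_ (by simp) _
              · simp only [List.mem_cons]
                grind
              · exact List.pairwise_cons.2 ⟨hv, hvs⟩
            have e3 : insertFilling (([] ++ y' :: v) :: T) b = (b :: v) :: insertFilling T y' :=
              insertFilling_replace (u := []) (by simp) hb (by grind) hvs (by simp) T
            have e4 : insertFilling ((b :: v) :: insertFilling T y') y =
                (y :: v) :: insertFilling (insertFilling T y') b :=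
              insertFilling_replace (u := []) (by simp) (hba.trans hay.le) hv hvs (by simp) _
            have e5 : insertFilling ((y :: v) :: insertFilling (insertFilling T y') b) a =
                (a :: y :: v) :: insertFilling (insertFilling T y') b := by
              refine insertFilling_top ?_ _
              simp only [List.mem_cons]
              grind
            rw [e1, e2, e3, e4, e5]
          · simp only [List.pairwise_append, List.pairwise_cons, List.mem_append, List.mem_cons]
              at hus huy huv
            have hzy : z < y' := huy z (by simp)
            simp only [List.append_assoc, List.cons_append, List.nil_append]
            have e1 : insertFilling ((u₁ ++ z :: y :: v) :: insertFilling T y') b =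
                (u₁ ++ b :: y :: v) :: insertFilling (insertFilling T y') z := by
              rw [insertFilling_replace _ (by grind)]
              all_goals
                try simp only [List.pairwise_cons, List.mem_cons]
                grind
            have e2 : insertFilling ((u₁ ++ b :: y :: v) ::
                insertFilling (insertFilling T y') z) a = (u₁ ++ a :: y :: v) ::
                insertFilling (insertFilling (insertFilling T y') z) b := by
              rw [insertFilling_replace _ (by grind)]
              all_goals
                try simp only [List.pairwise_cons, List.mem_cons]
                grind
            have e3 : insertFilling ((u₁ ++ z :: y' :: v) :: T) b =
                (u₁ ++ z :: b :: v) :: insertFilling T y' := by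
              have := insertFilling_replace (u := u₁ ++ [z]) (b := y') (v := v) (a := b)
              simp only [List.append_assoc, List.cons_append, List.nil_append] at this
              rw [this _ hb]
              all_goals
                try simp only [List.pairwise_append, List.pairwise_cons, List.mem_append, List.mem_cons]
                grind
            have e4 : insertFilling ((u₁ ++ z :: b :: v) :: insertFilling T y') y =
                (u₁ ++ z :: y :: v) :: insertFilling (insertFilling T y') b := by
              have := insertFilling_replace (u := u₁ ++ [z]) (b := b) (v := v) (a := y)
              simp only [List.append_assoc, List.cons_append, List.nil_append] at this
              rw [this _ (by grind)]
              all_goals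
                try simp only [List.pairwise_append, List.pairwise_cons, List.mem_append, List.mem_cons]
                grind
            have e5 : insertFilling ((u₁ ++ z :: y :: v) ::
                insertFilling (insertFilling T y') b) a = (u₁ ++ a :: y :: v) ::
                insertFilling (insertFilling (insertFilling T y') b) z := by
              rw [insertFilling_replace _ (by grind)]
              all_goals
                try simp only [List.pairwise_cons, List.mem_cons]
                grind
            -- Here the type changes: the expelled letters are `y', z, b` and `y', b, z` with `z <
            -- y' ≤ b`, a move of type `left`.
            rw [e1, e2, e3, e4, e5, ihl hzy hb]
        · rw [not_le] at hb
          rcases column_cases hus b with hbu | ⟨u₁, b', u₂, rfl, hb', hu₂⟩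
          · have e1 : insertFilling ((u ++ y :: v) :: insertFilling T y') b =
                (b :: (u ++ y :: v)) :: insertFilling T y' := by
              refine insertFilling_top ?_ _
              simp only [List.mem_append, List.mem_cons]
              grind
            have e3 : insertFilling ((u ++ y' :: v) :: T) b = (b :: (u ++ y' :: v)) :: T := by
              refine insertFilling_top ?_ _
              simp only [List.mem_append, List.mem_cons]
              grind
            have e4 : insertFilling ((b :: (u ++ y' :: v)) :: T) y =
                (b :: (u ++ y :: v)) :: insertFilling T y' := by
              have := insertFilling_replace (u := b :: u) (b := y') (v := v) (a := y)
              simp only [List.cons_append] at this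
              rw [this _ hy']
              all_goals
                try simp only [List.pairwise_cons, List.mem_cons]
                grind
            rw [e1, e3, e4]
          · simp only [List.pairwise_append, List.pairwise_cons, List.mem_append, List.mem_cons]
              at hus huy huv
            simp only [List.append_assoc, List.cons_append]
            have hbu₂ : (b :: u₂).Pairwise (· < ·) := List.pairwise_cons.2 ⟨hu₂, hus.2.1.2⟩
            obtain ⟨p, a', q, hpq, ha', hba', hq⟩ := column_cases_cons hbu₂ hba
            have hpq' : ∀ z, z ∈ p ++ a' :: q → b ≤ z ∧ z < y' := by
              rw [← hpq]
              simp only [List.mem_cons]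
              grind
            have hpq2 : ∀ l, b :: (u₂ ++ l) = p ++ a' :: (q ++ l) := fun l => by
              rw [← List.cons_append, hpq, List.append_assoc, List.cons_append]
            have e1 : insertFilling ((u₁ ++ b' :: (u₂ ++ y :: v)) :: insertFilling T y') b =
                (u₁ ++ b :: (u₂ ++ y :: v)) :: insertFilling (insertFilling T y') b' := by
              rw [insertFilling_replace _ hb']
              all_goals
                try simp only [List.pairwise_append, List.pairwise_cons, List.mem_append, List.mem_cons]
                grind
            have e2 : ∀ R, insertFilling ((u₁ ++ b :: (u₂ ++ y :: v)) :: R) a =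
                (u₁ ++ (p ++ a :: (q ++ y :: v))) :: insertFilling R a' := by
              intro R
              rw [hpq] at hbu₂
              simp only [List.pairwise_append, List.pairwise_cons, List.mem_append, List.mem_cons]
                at hbu₂ hpq'
              have := insertFilling_replace (u := u₁ ++ p) (b := a') (v := q ++ y :: v) (a := a)
              simp only [List.append_assoc] at this
              rw [hpq2, this _ ha']
              all_goals
                try simp only [List.pairwise_append, List.pairwise_cons, List.mem_append, List.mem_cons]
                grind
            have e3 : insertFilling ((u₁ ++ b' :: (u₂ ++ y' :: v)) :: T) b =
                (u₁ ++ b :: (u₂ ++ y' :: v)) :: insertFilling T b' := by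
              rw [insertFilling_replace _ hb']
              all_goals
                try simp only [List.pairwise_append, List.pairwise_cons, List.mem_append, List.mem_cons]
                grind
            have e4 : insertFilling ((u₁ ++ b :: (u₂ ++ y' :: v)) :: insertFilling T b') y =
                (u₁ ++ b :: (u₂ ++ y :: v)) :: insertFilling (insertFilling T b') y' := by
              have := insertFilling_replace (u := u₁ ++ b :: u₂) (b := y') (v := v) (a := y)
              simp only [List.append_assoc, List.cons_append] at this
              rw [this _ hy']
              all_goals
                try simp only [List.pairwise_append, List.pairwise_cons, List.mem_append, List.mem_cons]
                grind
            rw [e1, e2, e3, e4, e2, ihr (hb'.trans hba') (hpq' a' (by simp)).2]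

lemma Knuth.tab_eq {l m : List ℕ+} (h : Knuth l m) : tab l = tab m := by
  induction h with
  | left p s h₁ h₂ =>
    simp only [tab, List.foldr_append, List.foldr_cons]
    congr 1
    exact (insertFilling_knuth (isTableau_tab s).strict).1 h₁ h₂
  | right p s h₁ h₂ =>
    simp only [tab, List.foldr_append, List.foldr_cons]
    congr 1
    exact (insertFilling_knuth (isTableau_tab s).strict).2 h₁ h₂
  | refl l => rfl
  | symm _ ih => exact ih.symm
  | trans _ _ ih₁ ih₂ => exact ih₁.trans ih₂

/-- Every word is Knuth equivalent to the reading word of its tableau, and the tableau is invariant.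
-/
lemma tab_eq_iff_knuth {l m : List ℕ+} : tab l = tab m ↔ Knuth l m :=
  ⟨fun h => (knuth_tab l).trans (h ▸ (knuth_tab m).symm), Knuth.tab_eq⟩

/-! ### Crystal operators on tableaux -/

lemma exists_flatten_split {α : Type*} {T : List (List α)} {p q : List α} {i : α}
    (h : T.flatten = p ++ i :: q) :
    ∃ A u v B, T = A ++ (u ++ i :: v) :: B ∧ p = A.flatten ++ u ∧ q = v ++ B.flatten := by
  induction T generalizing p with
  | nil => simp at h
  | cons c T ih =>
    rw [List.flatten_cons, List.append_eq_append_iff] at h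
    have key : ∀ p', T.flatten = p' ++ i :: q → p = c ++ p' →
        ∃ A u v B, c :: T = A ++ (u ++ i :: v) :: B ∧ p = A.flatten ++ u ∧ q = v ++ B.flatten := by
      rintro p' hp rfl
      obtain ⟨A, u, v, B, rfl, rfl, rfl⟩ := ih hp
      exact ⟨c :: A, u, v, B, rfl, by simp, rfl⟩
    rcases h with ⟨p', h1, h2⟩ | ⟨c', h1, h2⟩
    · exact key p' h2 h1
    · cases c' with
      | nil => exact key [] (by simpa using h2.symm) (by simpa using h1.symm)
      | cons j v =>
        rw [List.cons_append, List.cons.injEq] at h2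
        obtain ⟨rfl, rfl⟩ := h2
        exact ⟨[], p, v, T, by simp [h1], by simp, rfl⟩

lemma count_succ_eq_zero_of_wordEps {i : ℕ+} {c : List ℕ+} (hc : c.Pairwise (· < ·))
    (hi : ∀ x ∈ c, i < x) {w : List ℕ+} (h : wordEps i (c ++ w) = 0) : i + 1 ∉ c := by
  intro hm
  obtain ⟨u, v, rfl⟩ := List.append_of_mem hm
  have hu : u = [] := by
    rw [List.pairwise_append] at hc
    rw [List.eq_nil_iff_forall_not_mem]
    intro x hx
    have h1 := hc.2.2 x hx (i + 1) List.mem_cons_self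
    have h2 := hi x (by simp [hx])
    exact absurd h1 (not_lt.2 (PNat.add_one_le_iff.2 h2))
  subst hu
  have := height_le_wordEps_of_prefix (i := i) (w := [] ++ (i + 1) :: v ++ w) (u := [i + 1])
    ⟨v ++ w, by simp⟩
  rw [h, height_cons, if_pos rfl, if_neg (pnat_succ_ne i), height_nil] at this
  omega

lemma height_eq_zero {i : ℕ+} {w : List ℕ+} (h : i ∉ w) (h' : i + 1 ∉ w) : height i w = 0 := by
  rw [height, List.count_eq_zero_of_not_mem h, List.count_eq_zero_of_not_mem h']
  rfl

lemma mem_of_colGT_lt {c : List ℕ+} {i : ℕ+} (h : colGT c i < colGT c ((i : ℕ) - 1)) : i ∈ c := by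
  by_contra hi
  refine h.ne' (colGT_eq_of_forall (Nat.sub_le _ _) fun x hx hlt => ?_)
  have : (x : ℕ) ≠ i := fun h => hi (PNat.coe_injective h ▸ hx)
  omega

/-- Here `d` is the column left of `c` in which `f̃_i` raises an entry. Dominance could fail only at
the threshold `i`; then `c` would contain `i` but not `i + 1`. -/
lemma colGT_le_colGT_raise {c d A₀ u v : List ℕ+} {i : ℕ+} (hc : c.Pairwise (· < ·))
    (hd : d = u ++ i :: v) (hds : d.Pairwise (· < ·)) (hi : i + 1 ∉ v)
    (hcd : ∀ k, colGT d k ≤ colGT c k)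
    (hw : ∀ w, w <+: A₀ ++ c ++ u → height i w ≤ height i (A₀ ++ c ++ u)) (k : ℕ) :
    colGT (u ++ (i + 1) :: v) k ≤ colGT c k := by
  subst hd
  have hrep : colGT (u ++ (i + 1) :: v) k = colGT (u ++ i :: v) k + if k = i then 1 else 0 := by
    simp only [colGT_append, colGT_cons, PNat.add_coe, PNat.one_coe]
    grind
  rw [hrep]
  split_ifs with hk
  swap
  · exact hcd k
  subst hk
  by_contra hcon
  have h1 := hcd i
  have hid : i ∈ u ++ i :: v := by simp
  have hpos := i.pos
  have h2 := colGT_lt_of_mem hid (k := (i : ℕ) - 1) (by omega)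
  have h3 := hcd ((i : ℕ) - 1)
  have hic : i ∈ c := mem_of_colGT_lt (by omega)
  rw [List.pairwise_append, List.pairwise_cons] at hds
  have h4 : colGT (u ++ i :: v) i = colGT (u ++ i :: v) ((i + 1 : ℕ+) : ℕ) := by
    refine colGT_eq_of_forall (by simp) fun x hx hlt => ?_
    have hlt' : i < x := hlt
    have hxv : x ∈ v := by
      simp only [List.mem_append, List.mem_cons] at hx
      rcases hx with hx | rfl | hx
      · exact absurd (hds.2.2 x hx i List.mem_cons_self) hlt'.not_gt
      · exact absurd hlt' (lt_irrefl _)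
      · exact hx
    exact PNat.coe_lt_coe _ _ |>.2
      (lt_of_le_of_ne (PNat.add_one_le_iff.2 hlt') (fun h => hi (h ▸ hxv)))
  have h5 := hcd ((i + 1 : ℕ+) : ℕ)
  have hic' : i + 1 ∉ c := fun hm => by
    have := colGT_lt_of_mem hm (k := (i : ℕ)) (by simp)
    omega
  obtain ⟨c₁, c₂, rfl⟩ := List.append_of_mem hic
  rw [List.pairwise_append, List.pairwise_cons] at hc
  -- Stopping before the letter `i` of `c` would give a prefix higher by one, as neither `c₂` nor
  -- `u` contributes.
  have h6 := hw (A₀ ++ c₁) ⟨i :: c₂ ++ u, by simp⟩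
  have h7 : height i u = 0 := height_eq_zero
    (fun h => lt_irrefl _ (hds.2.2 i h i List.mem_cons_self))
    (fun h => (pnat_lt_succ i).not_gt (hds.2.2 _ h i List.mem_cons_self))
  have h8 : height i c₂ = 0 := height_eq_zero (fun h => lt_irrefl _ (hc.2.1.1 i h))
    (fun h => hic' (by simp [h]))
  simp only [height_append, height_cons i i, if_pos, h7, h8, (pnat_succ_ne i).symm, if_false] at h6
  omega

/-- `f̃_i` acts on tableaux through their reading words and preserves the shape. The column to the
left of the altered entry causes no problem, as entries only grow; the one to the right is the
content of `colGT_le_colGT_raise`. -/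
lemma exists_isTableau_of_wordF_flatten {T : Filling} (hT : IsTableau T) {i : ℕ+} {m : List ℕ+}
    (h : wordF i T.flatten = some m) :
    ∃ S, IsTableau S ∧ S.map List.length = T.map List.length ∧ S.flatten = m := by
  obtain ⟨p, q, hpq, rfl, hp, hq⟩ := wordF_eq_some h
  obtain ⟨A, u, v, B, rfl, rfl, rfl⟩ := exists_flatten_split hpq
  have hd : (u ++ i :: v).Pairwise (· < ·) := hT.strict _ (by simp)
  have hds := hd
  rw [List.pairwise_append, List.pairwise_cons] at hds
  have hi : i + 1 ∉ v := count_succ_eq_zero_of_wordEps hds.2.1.2 hds.2.1.1 hq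
  have hdom := hT.dominates
  rw [List.pairwise_append, List.pairwise_cons] at hdom
  refine ⟨A ++ (u ++ (i + 1) :: v) :: B, ⟨?_, ?_, ?_⟩, by simp, by simp⟩
  · intro c hc
    have hT' := hT.strict c
    simp only [List.mem_append, List.mem_cons] at hc hT'
    rcases hc with hc | rfl | hc
    · exact hT' (Or.inl hc)
    · rw [List.pairwise_append, List.pairwise_cons]
      refine ⟨hds.1, ⟨fun x hx => ?_, hds.2.1.2⟩, fun x hx y hy => ?_⟩
      · exact lt_of_le_of_ne (PNat.add_one_le_iff.2 (hds.2.1.1 x hx)) (fun h => hi (h ▸ hx))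
      · have hxi := hds.2.2 x hx i List.mem_cons_self
        rcases List.mem_cons.1 hy with rfl | hy
        · exact hxi.trans (pnat_lt_succ i)
        · exact hxi.trans (hds.2.1.1 y hy)
    · exact hT' (Or.inr (Or.inr hc))
  · intro c hc
    have hT' := hT.ne_nil c
    simp only [List.mem_append, List.mem_cons] at hc hT'
    rcases hc with hc | rfl | hc
    · exact hT' (Or.inl hc)
    · simp
    · exact hT' (Or.inr (Or.inr hc))
  · rw [List.pairwise_append, List.pairwise_cons]
    refine ⟨hdom.1, ⟨fun e he k => (hdom.2.1.1 e he k).trans ?_, hdom.2.1.2⟩, ?_⟩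
    · simp only [colGT_append, colGT_cons, PNat.add_coe, PNat.one_coe]
      grind
    intro e he f hf k
    rcases List.mem_cons.1 hf with rfl | hf
    swap
    · exact hdom.2.2 e he f (List.mem_cons_of_mem _ hf) k
    obtain ⟨A₀, c, rfl⟩ := (List.eq_nil_or_concat' A).resolve_left (List.ne_nil_of_mem he)
    have hcd := hdom.2.2 c (by simp) _ List.mem_cons_self
    have hc := hT.strict c (by simp)
    have hkey : colGT (u ++ (i + 1) :: v) k ≤ colGT c k := by
      refine colGT_le_colGT_raise (A₀ := A₀.flatten) hc rfl hd hi hcd (fun w hw => ?_) k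
      simp only [List.flatten_append, List.flatten_cons, List.flatten_nil, List.append_nil] at hp
      rw [hp]
      refine height_le_wordEps_of_prefix (hw.trans ⟨i :: v ++ B.flatten, ?_⟩)
      simp
    rcases List.mem_append.1 he with he | he
    · exact hkey.trans ((List.pairwise_append.1 hdom.1).2.2 e he c (by simp) k)
    · rw [List.mem_singleton.1 he]
      exact hkey

lemma map_length_tab_of_wordF {i : ℕ+} {l l' : List ℕ+} (h : wordF i l = some l') :
    (tab l').map List.length = (tab l).map List.length := by
  obtain ⟨m, hm, hK⟩ := (knuth_tab l).exists_wordF h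
  obtain ⟨S, hS, hlen, rfl⟩ := exists_isTableau_of_wordF_flatten (isTableau_tab l) hm
  rw [hK.tab_eq, tab_flatten hS, hlen]

lemma tab_eq_of_wordF {i : ℕ+} {l l' m m' : List ℕ+} (hl : wordF i l = some l')
    (hm : wordF i m = some m') (h : tab l = tab m) : tab l' = tab m' := by
  obtain ⟨n, hn, hK⟩ := (tab_eq_iff_knuth.1 h).exists_wordF hl
  rw [hm, Option.some.injEq] at hn
  subst hn
  exact hK.tab_eq

lemma exists_wordF_of_tab_eq {i : ℕ+} {l l' m : List ℕ+} (hl : wordF i l = some l')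
    (h : tab l = tab m) : ∃ m', wordF i m = some m' ∧ tab l' = tab m' := by
  obtain ⟨m', hm, hK⟩ := (tab_eq_iff_knuth.1 h).exists_wordF hl
  exact ⟨m', hm, hK.tab_eq⟩

lemma wordEps_flatten_tab (i : ℕ+) (l : List ℕ+) : wordEps i (tab l).flatten = wordEps i l :=
  ((knuth_tab l).wordEps_eq i).symm

/-! ### Highest weight tableaux -/

/-- The column with entries `1, …, n`. -/
def stdCol (n : ℕ) : List ℕ+ := (List.range n).map Nat.succPNat

lemma stdCol_succ (n : ℕ) : stdCol (n + 1) = stdCol n ++ [n.succPNat] := by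
  simp [stdCol, List.range_succ]

lemma mem_stdCol {n : ℕ} {x : ℕ+} : x ∈ stdCol n ↔ (x : ℕ) ≤ n := by
  simp only [stdCol, List.mem_map, List.mem_range]
  constructor
  · rintro ⟨m, hm, rfl⟩
    simpa using hm
  · intro h
    have := x.pos
    exact ⟨x.natPred, by rw [PNat.natPred]; omega, by simp⟩

lemma count_stdCol (n : ℕ) (i : ℕ+) : (stdCol n).count i = if (i : ℕ) ≤ n then 1 else 0 := by
  split_ifs with h
  · refine List.count_eq_one_of_mem ?_ (mem_stdCol.2 h)
    exact List.nodup_range.map Nat.succPNat_injective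
  · exact List.count_eq_zero_of_not_mem fun hm => h (mem_stdCol.1 hm)

lemma count_flatten_map_stdCol (L : List ℕ) (i : ℕ+) :
    (L.map stdCol).flatten.count i = L.countP ((i : ℕ) ≤ ·) := by
  induction L with
  | nil => rfl
  | cons n L ih =>
    rw [List.map_cons, List.flatten_cons, List.count_append, ih, count_stdCol, List.countP_cons]
    simp only [decide_eq_true_eq]
    omega

lemma mem_of_le_of_closed {c : List ℕ+} (hc : ∀ y, y + 1 ∈ c → y ∈ c) {x z : ℕ+} (hx : x ∈ c)
    (hz : z ≤ x) : z ∈ c := by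
  induction x using PNat.recOn with
  | one => exact (show z = 1 from le_antisymm hz one_le) ▸ hx
  | succ x ih =>
    rcases hz.eq_or_lt with rfl | h
    · exact hx
    · exact ih (hc x hx) (PNat.lt_add_one_iff.1 h)

lemma eq_stdCol_of_closed {c : List ℕ+} (hc : ∀ y, y + 1 ∈ c → y ∈ c)
    (hs : c.Pairwise (· < ·)) : c = stdCol c.length := by
  induction c using List.reverseRecOn with
  | nil => rfl
  | append_singleton c x ih =>
    rw [List.pairwise_append] at hs
    have hlt : ∀ z ∈ c, z < x := fun z hz => hs.2.2 z hz x (by simp)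
    have hcl : ∀ y, y + 1 ∈ c → y ∈ c := fun y hy => by
      have h1 := hc y (by simp [hy])
      rw [List.mem_append, List.mem_singleton] at h1
      refine h1.resolve_right ?_
      rintro rfl
      exact absurd (hlt _ hy) (pnat_lt_succ y).not_gt
    have ih := ih hcl hs.1
    rw [List.length_append, List.length_singleton, stdCol_succ, ← ih]
    congr 2
    apply PNat.coe_injective
    rw [Nat.succPNat_coe]
    have h1 : ∀ z, z ∈ c ↔ (z : ℕ) ≤ c.length := fun z => by
      conv_lhs => rw [ih]
      exact mem_stdCol
    have h2 : ¬ (x : ℕ) ≤ c.length := fun h => lt_irrefl _ (hlt x ((h1 x).2 h))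
    by_cases hx : x = 1
    · subst hx
      simp only [PNat.one_coe] at h2 ⊢
      omega
    · obtain ⟨y, rfl⟩ := PNat.exists_eq_succ_of_ne_one hx
      have := hc y (by simp)
      rw [List.mem_append, List.mem_singleton] at this
      have := (h1 y).1 (this.resolve_right (pnat_lt_succ y).ne)
      rw [PNat.add_coe, PNat.one_coe] at h2 ⊢
      omega

lemma height_nonneg_of_column {e : List ℕ+} (he : e.Pairwise (· < ·)) {y : ℕ+}
    (h : y ∈ e → y + 1 ∈ e) : 0 ≤ height y e := by
  have hn : e.Nodup := he.imp fun h => h.ne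
  rw [height]
  by_cases hy : y ∈ e
  · rw [List.count_eq_one_of_mem hn hy, List.count_eq_one_of_mem hn (h hy)]
    simp
  · rw [List.count_eq_zero_of_not_mem hy]
    simp

lemma height_flatten_nonneg {A : Filling} {y : ℕ+} (h : ∀ e ∈ A, 0 ≤ height y e) :
    0 ≤ height y A.flatten := by
  induction A with
  | nil => simp
  | cons e A ih =>
    rw [List.flatten_cons, height_append]
    exact add_nonneg (h e List.mem_cons_self) (ih fun d hd => h d (List.mem_cons_of_mem _ hd))

/-- Induction on the columns from the right. If `c` contains `y + 1` but not `y`, dominance and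
closedness make all earlier columns contain `y + 1`, hence contribute nonnegative height; the prefix
ending at `y + 1` in `c` then has positive height. -/
lemma closed_of_wordEps_eq_zero {T : Filling} (hT : IsTableau T)
    (hY : ∀ i, wordEps i T.flatten = 0) (n : ℕ) : ∀ A c B, A.length = n → T = A ++ c :: B →
    ∀ y, y + 1 ∈ c → y ∈ c := by
  induction n using Nat.strong_induction_on with
  | _ n ih =>
    rintro A c B rfl rfl y hy
    by_contra hyc
    have hdom := hT.dominates
    rw [List.pairwise_append] at hdom
    have hA : 0 ≤ height y A.flatten := by
      refine height_flatten_nonneg fun e he => height_nonneg_of_column (hT.strict e (by simp [he]))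
        fun _ => ?_
      obtain ⟨A₁, A₂, rfl⟩ := List.append_of_mem he
      have hcl := ih A₁.length (by simp) A₁ e (A₂ ++ c :: B) rfl (by simp)
      have h1 : 0 < colGT e y := by
        refine lt_of_lt_of_le ?_ (hdom.2.2 e (by simp) c (by simp) y)
        rw [colGT, List.countP_pos_iff]
        exact ⟨y + 1, hy, by simp⟩
      rw [colGT, List.countP_pos_iff] at h1
      obtain ⟨x, hx, hxy⟩ := h1
      exact mem_of_le_of_closed hcl hx (PNat.add_one_le_iff.2 (by simpa using hxy))
    obtain ⟨u, v, rfl⟩ := List.append_of_mem hy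
    have hs := hT.strict (u ++ (y + 1) :: v) (by simp)
    rw [List.pairwise_append] at hs
    have hu : height y u = 0 := height_eq_zero (fun h => hyc (by simp [h]))
      (fun h => lt_irrefl _ (hs.2.2 _ h _ List.mem_cons_self))
    have h2 := height_le_wordEps_of_prefix (i := y) (u := A.flatten ++ (u ++ [y + 1]))
      (w := (A ++ (u ++ (y + 1) :: v) :: B).flatten) ⟨v ++ B.flatten, by simp⟩
    rw [hY, height_append, height_append, hu, height_cons, if_pos rfl,
      if_neg (pnat_succ_ne y), height_nil] at h2
    omega

lemma eq_map_stdCol_of_wordEps_eq_zero {T : Filling} (hT : IsTableau T)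
    (hY : ∀ i, wordEps i T.flatten = 0) : T = (T.map List.length).map stdCol := by
  rw [List.map_map]
  refine (List.map_id T).symm.trans (List.map_congr_left fun c hc => ?_)
  obtain ⟨A, B, h⟩ := List.append_of_mem hc
  exact eq_stdCol_of_closed (closed_of_wordEps_eq_zero hT hY _ A c B rfl h) (hT.strict c hc)

lemma count_add_countP (L : List ℕ) (n : ℕ) :
    L.count n + L.countP (n + 1 ≤ ·) = L.countP (n ≤ ·) := by
  induction L with
  | nil => rfl
  | cons m L ih =>
    simp only [List.count_cons, List.countP_cons, decide_eq_true_eq, beq_iff_eq]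
    split_ifs <;> omega

/-- A partition is determined by its conjugate. -/
lemma eq_of_countP_eq {L M : List ℕ} (hL : L.Pairwise (· ≥ ·)) (hM : M.Pairwise (· ≥ ·))
    (hL0 : 0 ∉ L) (hM0 : 0 ∉ M)
    (h : ∀ i : ℕ+, L.countP ((i : ℕ) ≤ ·) = M.countP ((i : ℕ) ≤ ·)) : L = M := by
  refine List.Perm.eq_of_pairwise (fun a b _ _ h1 h2 => le_antisymm h2 h1) hL hM ?_
  rw [List.perm_iff_count]
  intro n
  cases n with
  | zero => rw [List.count_eq_zero_of_not_mem hL0, List.count_eq_zero_of_not_mem hM0]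
  | succ n =>
    have e1 := h n.succPNat
    have e2 := h (n + 1).succPNat
    rw [Nat.succPNat_coe] at e1 e2
    have := count_add_countP L (n + 1)
    have := count_add_countP M (n + 1)
    simp only [Nat.succ_eq_add_one] at e1 e2
    omega

lemma IsTableau.lengths_pairwise {T : Filling} (hT : IsTableau T) :
    (T.map List.length).Pairwise (· ≥ ·) := by
  rw [List.pairwise_map]
  exact hT.dominates.imp fun h => by simpa [colGT_zero] using h 0

lemma IsTableau.zero_notMem_lengths {T : Filling} (hT : IsTableau T) :
    0 ∉ T.map List.length := by
  intro h
  obtain ⟨c, hc, h0⟩ := List.mem_map.1 h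
  exact hT.ne_nil c hc (List.length_eq_zero_iff.1 h0)

lemma tab_eq_map_stdCol {l : List ℕ+} (h : ∀ i, wordEps i l = 0) :
    tab l = ((tab l).map List.length).map stdCol :=
  eq_map_stdCol_of_wordEps_eq_zero (isTableau_tab l) fun i => by rw [wordEps_flatten_tab, h]

lemma count_eq_countP_lengths {l : List ℕ+} (h : ∀ i, wordEps i l = 0) (i : ℕ+) :
    l.count i = ((tab l).map List.length).countP ((i : ℕ) ≤ ·) := by
  rw [(knuth_tab l).perm.count_eq, ← count_flatten_map_stdCol, ← tab_eq_map_stdCol h]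

/-- The tableau of a highest weight word has columns `1, …, n`; its shape is the conjugate of the
content of the word. -/
lemma tab_eq_of_wordEps_eq_zero {l m : List ℕ+} (hl : ∀ i, wordEps i l = 0)
    (hm : ∀ i, wordEps i m = 0) (h : ∀ i, l.count i = m.count i) : tab l = tab m := by
  rw [tab_eq_map_stdCol hl, tab_eq_map_stdCol hm]
  congr 1
  refine eq_of_countP_eq (isTableau_tab l).lengths_pairwise (isTableau_tab m).lengths_pairwise
    (isTableau_tab l).zero_notMem_lengths (isTableau_tab m).zero_notMem_lengths fun i => ?_
  rw [← count_eq_countP_lengths hl, ← count_eq_countP_lengths hm, h]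

/-! ### The insertion tableau along the two commuting crystal structures -/

lemma count_lWord_of_crystalF_neg {A B : Mat} {j : ℕ+} (h : crystalF (-(j : ℤ)) A = some B)
    (c : ℕ+) : (lWord A).count c = (lWord B).count c := by
  have hcoe : ∀ A : Mat, ((lWord A : List ℕ+) : Multiset ℕ+) =
      (Finsupp.toMultiset A).map Prod.snd := fun A => by
    rw [← coe_biword', Multiset.map_coe]; rfl
  obtain ⟨q, hq, rfl⟩ := crystalF_neg_eq_some_iff.1 h
  have h1 : A = (A - Finsupp.single (j, q) 1) + Finsupp.single (j, q) 1 := by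
    refine (tsub_add_cancel_of_le ?_).symm
    rw [Finsupp.single_le_iff]
    have := hq.ne_zero
    rw [transpose_apply] at this
    omega
  rw [← Multiset.coe_count, ← Multiset.coe_count, hcoe, hcoe, moveDown]
  conv_lhs => rw [h1]
  simp only [map_add, Multiset.map_add, Finsupp.toMultiset_single, one_smul,
    Multiset.map_singleton]

/-- Raising with the commuting operators `ẽ_i` reduces to highest weight words, whose tableau
depends on the content only; and `f̃_{-j}` moves units within a column, so it keeps the content of
the word `𝐥`. -/
lemma tab_lWord_of_crystalF_neg {A B : Mat} {j : ℕ+} (h : crystalF (-(j : ℤ)) A = some B) :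
    tab (lWord A) = tab (lWord B) := by
  induction hn : weightSum A using Nat.strong_induction_on generalizing A B with
  | _ n ih =>
    subst hn
    by_cases hpos : ∃ i k, 0 < colHeight A i k
    · obtain ⟨i, k, hik⟩ := hpos
      obtain ⟨A', hA'⟩ := exists_crystalF_eq hik
      have h1 : crystalF (-(i : ℤ)) (transpose A') = some (transpose A) := by
        rw [crystalF_neg_transpose, hA']; rfl
      have h2 : crystalF (j : ℤ) (transpose A) = some (transpose B) := by
        rw [crystalF_transpose, h]; rfl
      obtain ⟨C, hC⟩ := exists_crystalF_of_crystalF_neg h1 h2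
      have hB' : crystalF (-(j : ℤ)) A' = some (transpose C) := by
        rw [crystalF_neg, hC]; rfl
      obtain ⟨D, hD1, hD2⟩ := crystalF_commute hB' hA'
      rw [h, Option.some.injEq] at hD2
      subst hD2
      have hlt := weightSum_crystalF hA'
      exact tab_eq_of_wordF (wordF_lWord_of_crystalF hA') (wordF_lWord_of_crystalF hD1)
        (ih _ (by omega) hB' rfl)
    · push Not at hpos
      refine tab_eq_of_wordEps_eq_zero (fun i => wordEps_lWord_eq_zero (hpos i))
        (fun i => wordEps_lWord_eq_zero ?_) (count_lWord_of_crystalF_neg h)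
      exact (colHeight_le_iff_of_crystalF_neg h 0).2 (hpos i)

/-- By induction the entries of column `i` above row `r ≤ i` vanish, so `colHeight A i r ≤ 0` leaves
no room for a unit at `(r, i + 1)`. -/
lemma eq_zero_of_lt_of_colHeight {A : Mat} (h : ∀ i k, colHeight A i k ≤ 0) (r : ℕ+) :
    ∀ c, r < c → A (r, c) = 0 := by
  induction r using PNat.strongInductionOn with
  | _ r ih =>
    intro c hc
    obtain ⟨i, rfl⟩ := PNat.exists_eq_succ_of_ne_one (n := c) (by
      rintro rfl
      exact absurd hc not_lt_one)
    have h1 := h i r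
    rw [colHeight, Finset.sum_eq_zero (s := Finset.Iio r) fun x hx => ?_] at h1
    · have h2 := Finset.single_le_sum (f := fun x => (A (x, i + 1) : ℤ)) (s := Finset.Iic r)
        (fun _ _ => Nat.cast_nonneg _) (Finset.mem_Iic.2 le_rfl)
      omega
    · rw [Finset.mem_Iio] at hx
      rw [ih x hx i (hx.trans_le (PNat.lt_add_one_iff.1 hc))]
      rfl

lemma count_lWord_of_diag {A : Mat} (h : ∀ i j, i ≠ j → A (i, j) = 0) (c : ℕ+) :
    (lWord A).count c = A (c, c) := by
  have h1 := countP_toMultiset A {c} c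
  rw [Finset.sum_singleton, ← coe_biword', Multiset.coe_countP] at h1
  rw [← h1, lWord, List.count, List.countP_map]
  refine List.countP_congr fun x hx => ?_
  have hx := mem_biword'.1 hx
  have : x.1 = x.2 := by
    by_contra hne
    exact hx (h x.1 x.2 hne)
  simp [this]

/-- The number of columns of length at least `i` is the length of row `i`. Folded raising keeps the
shape and ends at a diagonal matrix, where that length is the entry `A (i, i)`. -/
lemma dvd_countP_lengths {ε : ℕ} (hε : ε = 1 ∨ ε = 2) {A : Mat} (hA : A ∈ symMat ε) (i : ℕ+) :
    ε ∣ ((tab (lWord A)).map List.length).countP ((i : ℕ) ≤ ·) := by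
  induction hn : weightSum A using Nat.strong_induction_on generalizing A with
  | _ n ih =>
    subst hn
    by_cases hpos : ∃ i k, 0 < colHeight A i k
    · obtain ⟨j, k, hjk⟩ := hpos
      obtain ⟨C, hC, hCA⟩ := exists_foldedF_eq hε hA hjk
      have := ih _ (weightSum_foldedF hCA) hC rfl
      obtain ⟨D, hD1, hD2⟩ := foldedF_eq_some_iff.1 hCA
      rwa [map_length_tab_of_wordF (wordF_lWord_of_crystalF hD2), ← tab_lWord_of_crystalF_neg hD1]
    · push Not at hpos
      have hz := eq_zero_of_lt_of_colHeight hpos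
      have hdiag : ∀ i j, i ≠ j → A (i, j) = 0 := fun i j hij => by
        rcases lt_or_gt_of_ne hij with h | h
        · exact hz i j h
        · rw [hA.1]
          exact hz j i h
      rw [← count_eq_countP_lengths (fun i => wordEps_lWord_eq_zero (hpos i)),
        count_lWord_of_diag hdiag]
      exact hA.2 i

/-- The diagonal matrix with given entries. -/
noncomputable def diagMat (n : ℕ+ →₀ ℕ) : Mat := n.mapDomain fun i => (i, i)

lemma diagMat_apply (n : ℕ+ →₀ ℕ) (i j : ℕ+) : diagMat n (i, j) = if i = j then n j else 0 := by
  split_ifs with h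
  · subst h
    exact Finsupp.mapDomain_apply (fun a b h => (Prod.mk.inj h).1) n i
  · refine Finsupp.mapDomain_of_notMem_range _ _ ?_
    rintro ⟨k, hk⟩
    exact h ((Prod.mk.inj hk).1.symm.trans (Prod.mk.inj hk).2)

lemma colHeight_diagMat_le {n : ℕ+ →₀ ℕ} (h : ∀ i, n (i + 1) ≤ n i) (i k : ℕ+) :
    colHeight (diagMat n) i k ≤ 0 := by
  have := h i
  simp only [colHeight, diagMat_apply, Nat.cast_ite, Nat.cast_zero, Finset.sum_ite_eq',
    Finset.mem_Iic, Finset.mem_Iio]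
  simp only [PNat.add_one_le_iff]
  split_ifs <;> omega

/-- Surjectivity: raise `u` to a highest weight word, realise that by a diagonal matrix, and follow
the lowering steps with the folded operators, whose factor `f̃_{-i}` does not affect the tableau. -/
lemma exists_symMat_tab_eq {ε : ℕ} (hε : ε = 1 ∨ ε = 2) {u : List ℕ+}
    (hu : ∀ i : ℕ+, ε ∣ ((tab u).map List.length).countP ((i : ℕ) ≤ ·)) :
    ∃ A ∈ symMat ε, tab (lWord A) = tab u := by
  induction hn : (u.map PNat.val).sum using Nat.strong_induction_on generalizing u with
  | _ n ih =>
    subst hn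
    by_cases hpos : ∃ i, 0 < wordEps i u
    · obtain ⟨i, hi⟩ := hpos
      obtain ⟨v, hv⟩ := exists_wordF_eq hi
      have hlt : (v.map PNat.val).sum < (u.map PNat.val).sum := by
        obtain ⟨p, q, rfl, rfl, -⟩ := wordF_eq_some hv
        simp
      obtain ⟨A, hA, hAv⟩ := ih _ hlt (by rwa [← map_length_tab_of_wordF hv]) rfl
      obtain ⟨m, hm, hmu⟩ := exists_wordF_of_tab_eq hv hAv.symm
      have hB : crystalF (i : ℤ) A = some (matOfWords (kWord A) m) := by
        rw [crystalF_coe, hm]; rfl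
      set B := matOfWords (kWord A) m
      have hBm : lWord B = m := by
        have := wordF_lWord_of_crystalF hB
        rw [hm, Option.some.injEq] at this
        exact this.symm
      have hD : crystalF (-(i : ℤ)) A = some (transpose B) := by
        rw [crystalF_neg, (mem_symMat_iff.1 hA).1, hB]; rfl
      obtain ⟨E, hE1, hE2⟩ := crystalF_commute hD hB
      refine ⟨E, foldedF_mem_symMat hε hA (foldedF_eq_some_iff.2 ⟨_, hD, hE1⟩), ?_⟩
      rw [← tab_lWord_of_crystalF_neg hE2, hBm, hmu]
    · push Not at hpos
      have h0 : ∀ i, wordEps i u = 0 := fun i => le_antisymm (hpos i) (wordEps_nonneg i u)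
      -- The content of `u`. It is weakly decreasing since the height of `u` is at most `wordEps i u
      -- = 0`, so the diagonal matrix has a highest weight word with the same content.
      let n : ℕ+ →₀ ℕ := Multiset.toFinsupp (u : Multiset ℕ+)
      have hn : ∀ i, n i = u.count i := fun i => by simp [n]
      have hdiag : ∀ i j, i ≠ j → diagMat n (i, j) = 0 := fun i j hij => by
        rw [diagMat_apply, if_neg hij]
      refine ⟨diagMat n, ⟨fun i j => ?_, fun i => ?_⟩, ?_⟩
      · by_cases hij : i = j
        · rw [hij]
        · rw [hdiag i j hij, hdiag j i (Ne.symm hij)]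
      · rw [diagMat_apply, if_pos rfl, hn, count_eq_countP_lengths h0]
        exact hu i
      · refine tab_eq_of_wordEps_eq_zero (fun i => wordEps_lWord_eq_zero
          (colHeight_diagMat_le (fun i => ?_) i)) h0 fun i => ?_
        · have := height_le_wordEps i u
          rw [h0, height] at this
          rw [hn, hn]
          omega
        · rw [count_lWord_of_diag hdiag, diagMat_apply, if_pos rfl, hn]

/-! ### Semistandard tableaux of anti-normal shape -/

lemma exists_getElem?_of_lt {α : Type*} {l : List α} {r : ℕ} (h : r < l.length) :
    ∃ a, l[r]? = some a := ⟨_, List.getElem?_eq_getElem h⟩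

lemma lt_iff_of_reverse_getElem? {c : List ℕ+} (hc : c.Pairwise (· < ·)) {r : ℕ} {a : ℕ+}
    (h : c.reverse[r]? = some a) (k : ℕ) : k < (a : ℕ) ↔ r < colGT c k := by
  obtain ⟨hr, rfl⟩ := List.getElem?_eq_some_iff.1 h
  exact lt_reverse_getElem_iff hc (by simpa using hr) k

lemma colGT_le_length (c : List ℕ+) (k : ℕ) : colGT c k ≤ c.length := List.countP_le_length

lemma exists_reverse_getElem? {c : List ℕ+} {r k : ℕ} (h : r < colGT c k) :
    ∃ a, c.reverse[r]? = some a :=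
  exists_getElem?_of_lt (by simpa using h.trans_le (colGT_le_length c k))

lemma colGT_le_iff {c d : List ℕ+} (hc : c.Pairwise (· < ·)) (hd : d.Pairwise (· < ·)) :
    (∀ k, colGT d k ≤ colGT c k) ↔ d.length ≤ c.length ∧
      ∀ (r : ℕ) (a b : ℕ+), c.reverse[r]? = some a → d.reverse[r]? = some b → b ≤ a := by
  constructor
  · intro h
    refine ⟨by simpa [colGT_zero] using h 0, fun r a b ha hb => ?_⟩
    by_contra hab
    rw [not_le, ← PNat.coe_lt_coe, lt_iff_of_reverse_getElem? hd hb] at hab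
    exact lt_irrefl _ ((lt_iff_of_reverse_getElem? hc ha a).2 (hab.trans_le (h a)))
  · rintro ⟨hlen, h⟩ k
    by_contra hlt
    rw [not_le] at hlt
    obtain ⟨b, hb⟩ := exists_reverse_getElem? hlt
    have h1 : colGT c k < c.reverse.length := by
      rw [List.length_reverse]
      exact (hlt.trans_le (colGT_le_length d k)).trans_le hlen
    obtain ⟨a, ha⟩ := exists_getElem?_of_lt h1
    have h2 := (lt_iff_of_reverse_getElem? hd hb k).2 hlt
    have h3 := PNat.coe_le_coe _ _ |>.2 (h _ a b ha hb)
    exact lt_irrefl _ ((lt_iff_of_reverse_getElem? hc ha k).1 (h2.trans_le h3))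

lemma entry_eq_some_iff {T : Filling} {r k : ℕ} {a : ℕ+} :
    Filling.entry T r k = some a ↔ ∃ h : k < T.length, T[k].reverse[r]? = some a := by
  rw [Filling.entry, Option.bind_eq_some_iff]
  constructor
  · rintro ⟨c, hc, h⟩
    obtain ⟨hk, rfl⟩ := List.getElem?_eq_some_iff.1 hc
    exact ⟨hk, h⟩
  · rintro ⟨hk, h⟩
    exact ⟨_, List.getElem?_eq_getElem hk, h⟩

/-- The list of the column lengths of a Young diagram. -/
def colLens (ν : YoungDiagram) : List ℕ := (List.range (ν.rowLen 0)).map ν.colLen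

lemma rowLen_eq_countP (ν : YoungDiagram) (i : ℕ) :
    ν.rowLen i = (colLens ν).countP (i + 1 ≤ ·) := by
  have h : ∀ j, i + 1 ≤ ν.colLen j ↔ j < ν.rowLen i := fun j => by
    rw [Nat.succ_le_iff, ← YoungDiagram.mem_iff_lt_colLen, YoungDiagram.mem_iff_lt_rowLen]
  have h0 : ν.rowLen i ≤ ν.rowLen 0 := ν.rowLen_anti _ _ (Nat.zero_le _)
  have key : ∀ n m : ℕ, n ≤ m → (List.range m).countP (fun j => decide (j < n)) = n := by
    intro n m hnm
    induction m with
    | zero => simp; omega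
    | succ m ih =>
      rw [List.range_succ, List.countP_append, List.countP_singleton]
      rcases Nat.lt_or_ge m n with h | h
      · obtain rfl : n = m + 1 := by omega
        rw [List.countP_eq_length.2 (by simp; omega)]
        simp
      · rw [ih h]
        simpa using h
  rw [colLens, List.countP_map]
  refine (key _ _ h0).symm.trans (List.countP_congr fun j _ => ?_)
  simpa using (h j).symm

lemma eq_of_colLens_eq {μ ν : YoungDiagram} (h : colLens μ = colLens ν) : μ = ν := by
  ext ⟨i, j⟩
  rw [YoungDiagram.mem_cells, YoungDiagram.mem_cells, YoungDiagram.mem_iff_lt_rowLen,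
    YoungDiagram.mem_iff_lt_rowLen, rowLen_eq_countP, rowLen_eq_countP, h]

lemma exists_colLens_eq {L : List ℕ} (hL : L.Pairwise (· ≥ ·)) (h0 : 0 ∉ L) :
    ∃ ν : YoungDiagram, colLens ν = L := by
  refine ⟨(YoungDiagram.ofRowLens L hL.sortedGE).transpose, ?_⟩
  have h := YoungDiagram.rowLens_ofRowLens_eq_self (w := L) (hw := hL.sortedGE) fun x hx =>
    Nat.pos_of_ne_zero fun h => h0 (h ▸ hx)
  conv_rhs => rw [← h]
  rw [colLens, YoungDiagram.rowLens, YoungDiagram.rowLen_transpose]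
  exact List.map_congr_left fun j _ => YoungDiagram.colLen_transpose _ j

/-- Weak increase along the rows of bottom-aligned columns is dominance of neighbouring columns,
which is transitive. -/
lemma mem_SST_iff {ν : YoungDiagram} {T : Filling} :
    T ∈ SST ν ↔ IsTableau T ∧ T.map List.length = colLens ν := by
  constructor
  · rintro ⟨h1, h2, h3⟩
    have hlen : T.length = ν.rowLen 0 := by simpa using congrArg List.length h1
    have hcol : ∀ (k : ℕ) (hk : k < T.length), T[k].length = ν.colLen k := fun k hk => by
      have := List.getElem_of_eq h1 (i := k) (by simpa using hk)
      simpa using this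
    refine ⟨⟨h2, fun c hc hnil => ?_, ?_⟩, h1⟩
    · obtain ⟨k, hk, rfl⟩ := List.getElem_of_mem hc
      have h4 : 0 < ν.colLen k := by
        rw [← YoungDiagram.mem_iff_lt_colLen, YoungDiagram.mem_iff_lt_rowLen]
        omega
      rw [← hcol k hk, hnil] at h4
      exact lt_irrefl _ h4
    · let R : List ℕ+ → List ℕ+ → Prop := fun c d => ∀ k, colGT d k ≤ colGT c k
      have : Trans R R R := ⟨fun h h' k => (h' k).trans (h k)⟩
      refine List.isChain_iff_pairwise (R := R).1 (List.isChain_iff_getElem.2 fun k hk => ?_)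
      refine (colGT_le_iff (h2 _ (List.getElem_mem _)) (h2 _ (List.getElem_mem _))).2 ⟨?_, ?_⟩
      · rw [hcol, hcol]
        exact ν.colLen_anti _ _ (Nat.le_succ k)
      · exact fun r a b ha hb => h3 r k a b (entry_eq_some_iff.2 ⟨_, ha⟩)
          (entry_eq_some_iff.2 ⟨_, hb⟩)
  · rintro ⟨hT, h⟩
    refine ⟨h, hT.strict, fun r k a b ha hb => ?_⟩
    obtain ⟨hk, ha⟩ := entry_eq_some_iff.1 ha
    obtain ⟨hk', hb⟩ := entry_eq_some_iff.1 hb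
    exact ((colGT_le_iff (hT.strict _ (List.getElem_mem _)) (hT.strict _ (List.getElem_mem _))).1
      (List.pairwise_iff_getElem.1 hT.dominates k (k + 1) hk hk' (Nat.lt_succ_self k))).2 r a b ha hb

lemma colLen_zero_eq {ν : YoungDiagram} {T : Filling} (h : T.map List.length = colLens ν) :
    ν.colLen 0 = (T.headD []).length := by
  cases T with
  | nil =>
    have h0 : ν.rowLen 0 = 0 := by simpa [colLens] using h.symm
    have : ¬ 0 < ν.colLen 0 := by
      rw [← YoungDiagram.mem_iff_lt_colLen, YoungDiagram.mem_iff_lt_rowLen]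
      omega
    simpa using this
  | cons c T =>
    have h0 : 0 < ν.rowLen 0 := by
      have := congrArg List.length h
      simp [colLens] at this
      omega
    have := List.getElem_of_eq h (i := 0) (by simp)
    simpa [colLens] using this.symm

/-- The largest entry of each row stands in the right-most column, so the flag constrains that
column only. -/
lemma mem_flaggedSST_iff {ν : YoungDiagram} {T : Filling} {φ : List ℕ} {g : ℕ → ℕ}
    (hg0 : g 0 = φ.length) (hg : ∀ k, g k ≤ φ.length)
    (hφ : ∀ r < φ.length, ∀ k, k < φ.getD (φ.length - (r + 1)) 0 ↔ r < g k) :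
    T ∈ flaggedSST ν φ ↔
      IsTableau T ∧ T.map List.length = colLens ν ∧ ∀ k, colGT (T.headD []) k ≤ g k := by
  change T ∈ SST ν ∧ _ ∧ _ ↔ _
  rw [mem_SST_iff, and_assoc]
  refine and_congr_right fun hT => and_congr_right fun hlen => ?_
  rw [colLen_zero_eq hlen]
  have hs : (T.headD []).Pairwise (· < ·) := by
    cases T with
    | nil => simp
    | cons c T => exact hT.strict c List.mem_cons_self
  constructor
  · rintro ⟨h1, h2⟩ k
    by_contra hlt
    rw [not_le] at hlt
    have hr := (hlt.trans_le (colGT_le_length _ k)).trans_le h1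
    obtain ⟨x, hx⟩ := exists_reverse_getElem? hlt
    have h3 := (lt_iff_of_reverse_getElem? hs hx k).2 hlt
    have h4 := h2 (g k) 0 x (entry_eq_some_iff.2 (by
      cases T with
      | nil => simp at hx
      | cons c T => exact ⟨by simp, hx⟩))
    exact lt_irrefl _ ((hφ _ hr k).1 (h3.trans_le h4))
  · intro h
    refine ⟨by rw [← hg0, ← colGT_zero]; exact h 0, fun r k x hx => ?_⟩
    obtain ⟨hk, hx⟩ := entry_eq_some_iff.1 hx
    by_contra hlt
    rw [not_le, lt_iff_of_reverse_getElem? (hT.strict _ (List.getElem_mem _)) hx] at hlt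
    have hhead : ∀ m, colGT T[k] m ≤ colGT (T.headD []) m := by
      intro m
      cases T with
      | nil => simp at hk
      | cons c T =>
        cases k with
        | zero => exact le_rfl
        | succ k => exact (List.pairwise_cons.1 hT.dominates).1 _ (List.getElem_mem _) m
    have h1 := (hlt.trans_le (hhead _)).trans_le (h _)
    exact lt_irrefl _ ((hφ r (h1.trans_le (hg _)) _).2 h1)

/-! ### Assembling the proposition. -/

lemma Describes.eq {w : Equiv.Perm Zx} {a b a' b' : Finset ℕ+} (h : Describes w a b)
    (h' : Describes w a' b') : a = a' ∧ b = b' :=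
  ⟨Finset.ext fun j => (h.1 j).trans (h'.1 j).symm, Finset.ext fun j => (h.2 j).trans (h'.2 j).symm⟩

lemma kappaHat_eq (A : Mat) : kappaHat A = tab (lWord A) := insertWord_reverse _

/-- The ladder condition and the flag condition both say `colGT ≤ numGT a` for the right-most
column, so they match under `kappaHat`; the row lengths are handled by `dvd_countP_lengths` and
`exists_symMat_tab_eq`. -/
lemma image_kappaHat {ε : ℕ} (hε : ε = 1 ∨ ε = 2) {a : Finset ℕ+} {φ : List ℕ}
    (hlen : φ.length = a.card)
    (hφ : ∀ r < φ.length, ∀ k, k < φ.getD (φ.length - (r + 1)) 0 ↔ r < numGT a k) :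
    kappaHat '' (symMat ε ∩ ladder a a) =
      ⋃ ν ∈ {ν : YoungDiagram | ∀ i, ε ∣ ν.rowLen i}, flaggedSST ν φ := by
  have hiff := fun ν T => mem_flaggedSST_iff (ν := ν) (T := T) (φ := φ) (g := numGT a)
    (by rw [numGT_zero, hlen]) (fun k => by rw [hlen]; exact Finset.card_filter_le _ _) hφ
  ext T
  simp only [Set.mem_image, Set.mem_iUnion, exists_prop, Set.mem_ofPred_eq, hiff]
  constructor
  · rintro ⟨A, ⟨hA, hAl⟩, rfl⟩
    rw [kappaHat_eq]
    have hT := isTableau_tab (lWord A)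
    obtain ⟨ν, hν⟩ := exists_colLens_eq hT.lengths_pairwise hT.zero_notMem_lengths
    refine ⟨ν, fun i => ?_, hT, hν.symm, (mem_ladder_iff_tab (mem_symMat_iff.1 hA).1).1 hAl⟩
    rw [rowLen_eq_countP, hν]
    exact dvd_countP_lengths hε hA i.succPNat
  · rintro ⟨ν, hν, hT, hlenT, hk⟩
    obtain ⟨A, hA, hAT⟩ := exists_symMat_tab_eq hε (u := T.flatten) fun i => by
      rw [tab_flatten hT, hlenT]
      have := hν i.natPred
      rw [rowLen_eq_countP, PNat.natPred_add_one] at this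
      exact this
    rw [tab_flatten hT] at hAT
    refine ⟨A, ⟨hA, (mem_ladder_iff_tab (mem_symMat_iff.1 hA).1).2 ?_⟩, ?_⟩
    · rwa [hAT]
    · rw [kappaHat_eq, hAT]

lemma pairwiseDisjoint_flaggedSST (S : Set YoungDiagram) (φ : List ℕ) :
    S.PairwiseDisjoint fun ν => flaggedSST ν φ := by
  intro μ _ ν _ hne
  refine Set.disjoint_left.2 fun T h1 h2 => hne (eq_of_colLens_eq ?_)
  exact h1.1.1.symm.trans h2.1.1

end SymDemazure

theorem mainTheorem9 (ε : ℕ) (hε : ε = 1 ∨ ε = 2) (w : Equiv.Perm SymDemazure.Zx)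
    (hw : w ∈ SymDemazure.hatWCosetReps ε) :
    (∀ l : List ℕ, SymDemazure.IsReducedExpr SymDemazure.hatReflection l w →
      SymDemazure.demazureSet (SymDemazure.foldedF ε) 0 l = SymDemazure.hatDemazure ε w) ∧
    (∀ l : List ℤ, SymDemazure.IsReducedExpr SymDemazure.simpleReflection l w →
      SymDemazure.demazureSet SymDemazure.crystalF 0 l = SymDemazure.demazure w) ∧
    SymDemazure.hatDemazure ε w = SymDemazure.symMat ε ∩ SymDemazure.demazure w ∧
    SymDemazure.kappaHat '' SymDemazure.hatDemazure ε w =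
      ⋃ ν ∈ {ν : YoungDiagram | ∀ i, ε ∣ ν.rowLen i},
        SymDemazure.flaggedSST ν (SymDemazure.flag w) ∧
    {ν : YoungDiagram | ∀ i, ε ∣ ν.rowLen i}.PairwiseDisjoint
      (fun ν => SymDemazure.flaggedSST ν (SymDemazure.flag w)) := by
  open SymDemazure in
  have hodd := isOdd_of_mem_hatW hw.1
  have hmono := strictMono_of_mem_hatWCosetReps hw
  have hG := isGrassmannian_of_strictMono hodd hmono
  obtain ⟨l₁, hl₁, -⟩ := exists_isReducedExpr (exists_hat_list hw.1)
  obtain ⟨l₂, hl₂, -⟩ := exists_isReducedExpr (exists_list_of_mem_closure simpleReflection_inv hw.1.1)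
  -- One reduced word is used to produce `a`. By `Describes.eq` every other reduced word, in either
  -- group, leads to the same set.
  obtain ⟨a, ha, -⟩ := demazureSet_foldedF_eq hε l₁ w hl₁ hG
  have e1 : ∀ l, IsReducedExpr hatReflection l w →
      demazureSet (foldedF ε) 0 l = symMat ε ∩ ladder a a := fun l hl => by
    obtain ⟨a', ha', h⟩ := demazureSet_foldedF_eq hε l w hl hG
    rw [h, (ha'.eq ha).1]
  have e2 : ∀ l, IsReducedExpr simpleReflection l w →
      demazureSet crystalF 0 l = ladder a a := fun l hl => by
    obtain ⟨a', b', hab, -, h⟩ := demazureSet_eq_ladder l w hl hG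
    rw [h, (hab.eq ha).1, (hab.eq ha).2]
  have e3 : hatDemazure ε w = symMat ε ∩ ladder a a := by
    ext A
    exact ⟨fun ⟨l, hl, hA⟩ => e1 l hl ▸ hA, fun hA => ⟨l₁, hl₁, (e1 l₁ hl₁).symm ▸ hA⟩⟩
  have e4 : demazure w = ladder a a := by
    ext A
    exact ⟨fun ⟨l, hl, hA⟩ => e2 l hl ▸ hA, fun hA => ⟨l₂, hl₂, (e2 l₂ hl₂).symm ▸ hA⟩⟩
  refine ⟨fun l hl => by rw [e1 l hl, e3], fun l hl => by rw [e2 l hl, e4], by rw [e3, e4], ?_,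
    pairwiseDisjoint_flaggedSST _ _⟩
  rw [e3]
  exact image_kappaHat hε (length_flag hodd hmono ha)
    fun r hr k => lt_flag_iff hodd hmono ha hr k
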